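/- All vector spaces are over $\mathbb{C}$. A Lie conformal superalgebra $R$ is a $\mathbb{Z}/2$-graded $\mathbb{C}[\partial]$-module with a parity-preserving bilinear $\lambda$-bracket $[a_\lambda b]=\sum_{n\ge 0}\frac{\lambda^n}{n!}\,a_{(n)}b\in\mathbb{C}[\lambda]\otimes R$ satisfying sesquilinearity, skew-commutativity and the Jacobi identity. $R$ is finite if it is finitely generated over $\mathbb{C}[\partial]$; $R'$ is the span of all $a_{(n)}b$; $R$ is simple if its bracket is non-zero and it has no non-trivial (graded) ideals. For $R$ finite with generators $a^1,\dots,a^k$ over $\mathbb{C}[\partial]$, let $\mathrm{Lie}\,R=R[t,t^{-1}]/(\partial+\partial_t)R[t,t^{-1}]$ with $[a_m,b_n]=\sum_j\binom mj(a_{(j)}b)_{m+n-j}$, where $a_n$ is the class of $at^n$. The annihilation algebra $\mathcal{A}(R)$ is the completion of $(\mathrm{Lie}\,R)_-=\mathrm{span}\{a_n: a\in R,\ n\ge 0\}$ in the topology defined by the subspaces $\mathcal{L}_m=\mathrm{span}\{a^j_n : n\ge m\}$; it is a linearly compact Lie superalgebra. $H^2$ denotes continuous cohomology with coefficients in the trivial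 module $\mathbb{C}$ (discrete topology; even and odd cochains). A central extension of a linearly compact Lie superalgebra $Q$ is a surjective homomorphism $E\to Q$ (continuous and even) of linearly compact Lie superalgebras with central kernel; it is universal if it maps uniquely, over $Q$, to every central extension of $Q$. (1) Let $R$ be a finite Lie conformal superalgebra with $R=R'$ that has an element $L$ with $L_{(0)}a=\partial a$ for all $a\in R$. Then $H^2(\mathcal{A}(R))=0$. (2) Let $R$ be a finite simple Lie conformal superalgebra that has an even element $L$ with $L_{(0)}a=\partial a$ for all $a\in R$. Then $\mathcal{A}(R)$ is the universal central extension of its quotient by its center. (3) The conclusions $H^2(\mathcal{A}(R))=0$ and "$\mathcal{A}(R)$ is the universal central extension of its quotient by its center" hold if $R$ is isomorphic to one of the following, where $\wedge(N)$ is the Grassmann algebra in $\xi_1,\dots,\xi_N$, $\partial_i=\partial/\partial\xi_i$, and $W(N)=\{\sum_i P_i\partial_i : P_i\in\wedge(N)\}$ is its Lie superalgebra of derivations: - $W_N=\mathbb{C}[\partial]\otimes(W(N)\oplus\wedge(N))$, $N\ge0$, with $[a_\lambda b]=[a,b]$, $[a_\lambda f]=a(f)-\lambda(-1)^{p(a)p(f)}fa$,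 $[f_\lambda g]=-\partial(fg)-2\lambda fg$ for $a,b\in W(N)$, $f,g\in\wedge(N)$; - $S_{N,a}=\{D\in W_N : \mathrm{div}_a D=0\}$, $N\ge2$, $a\in\mathbb{C}$, where $\mathrm{div}_a$ is $\mathbb{C}[\partial]$-linear with $\mathrm{div}_a(\sum_i P_i\partial_i+f)=\sum_i(-1)^{p(P_i)}\partial_iP_i-\partial f+af$; - $\widetilde S_N=\{D\in W_N : \mathrm{div}_0((1+\xi_1\cdots\xi_N)D)=0\}$, $N\ge2$ even; - $K_N=\mathbb{C}[\partial]\otimes\wedge(N)$, $N\ge0$, $N\ne4$, with $[A_\lambda B]=(\frac r2-1)\partial(AB)+(-1)^r\frac12\sum_i\partial_iA\,\partial_iB+\lambda(\frac{r+s}2-2)AB$ for monomials $A,B$ of degrees $r,s$; - $K_4'$, the derived subalgebra of $K_4$ ($K_4$ being given by the same formula with $N=4$); - $CK_6\subset K_6$, the $\mathbb{C}[\partial]$-span of the elements $f-i(-1)^{r(r+1)/2}(-\partial)^{3-r}f^*$, where $f$ is a monomial of degree $r\le3$ and $f^*$ is the monomial (up to sign) with $ff^*=\xi_1\cdots\xi_6$.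 -/

import Mathlib

noncomputable section

namespace LieConf

open scoped Topology Uniformity

/-! ## Lie conformal superalgebras -/

/-- The sign `(-1)^{ij}` of two parities. -/
def sgn (i j : ZMod 2) : ℂ := if i = 1 ∧ j = 1 then -1 else 1

/-- The data of a conformal superalgebra: parity subspaces, the action of `∂`, and a bilinear
`λ`-bracket. A polynomial in `λ` with coefficients in `R` is stored as the finitely supported
sequence of its coefficients at `λ^n / n!`, so that `br a b n` is the `n`-th product `a_(n) b`. -/
structure ConfData (R : Type*) [AddCommGroup R] [Module ℂ R] where
  part : ZMod 2 → Submodule ℂ R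
  D : R →ₗ[ℂ] R
  br : R →ₗ[ℂ] R →ₗ[ℂ] (ℕ →₀ R)

/-- A Lie conformal superalgebra. The axioms are the coefficients at `λ^n / n!`
(and `λ^m μ^n / (m! n!)`) of sesquilinearity, skew-commutativity and the Jacobi identity. -/
class LieConformalSuperalgebra (R : Type*) [AddCommGroup R] [Module ℂ R]
    extends ConfData R where
  isCompl_part : IsCompl (part 0) (part 1)
  D_mem : ∀ i, ∀ a ∈ part i, D a ∈ part i
  br_mem : ∀ i j, ∀ a ∈ part i, ∀ b ∈ part j, ∀ n, br a b n ∈ part (i + j)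
  /-- `[∂a_λ b] = -λ [a_λ b]` -/
  br_D_left_zero : ∀ a b, br (D a) b 0 = 0
  br_D_left_succ : ∀ a b (n : ℕ), br (D a) b (n + 1) = -((n + 1 : ℂ) • br a b n)
  /-- `[a_λ ∂b] = (∂ + λ) [a_λ b]` -/
  br_D_right_zero : ∀ a b, br a (D b) 0 = D (br a b 0)
  br_D_right_succ : ∀ a b (n : ℕ),
    br a (D b) (n + 1) = D (br a b (n + 1)) + (n + 1 : ℂ) • br a b n
  /-- `[b_λ a] = -(-1)^{p(a)p(b)} [a_{-λ-∂} b]` -/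
  skew : ∀ i j, ∀ a ∈ part i, ∀ b ∈ part j, ∀ n : ℕ,
    br b a n = -(sgn i j • (br a b).sum fun k c =>
      if n ≤ k then ((-1 : ℂ) ^ k / ((k - n).factorial : ℂ)) • (D ^ (k - n)) c else 0)
  /-- `[a_λ [b_μ c]] = [[a_λ b]_{λ+μ} c] + (-1)^{p(a)p(b)} [b_μ [a_λ c]]` -/
  jacobi : ∀ i j, ∀ a ∈ part i, ∀ b ∈ part j, ∀ c, ∀ m n : ℕ,
    br a (br b c n) m =
      ∑ k ∈ Finset.range (m + 1), (m.choose k : ℂ) • br (br a b k) c (m + n - k)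
        + sgn i j • br b (br a c m) n

section Basic

variable (R : Type*) [AddCommGroup R] [Module ℂ R] [LieConformalSuperalgebra R]

/-- The parity subspaces `R_0`, `R_1`. -/
abbrev part (i : ZMod 2) : Submodule ℂ R := (LieConformalSuperalgebra.toConfData (R := R)).part i

/-- The action of `∂`. -/
abbrev del : R →ₗ[ℂ] R := (LieConformalSuperalgebra.toConfData (R := R)).D

/-- The `λ`-bracket. -/
abbrev lbr : R →ₗ[ℂ] R →ₗ[ℂ] (ℕ →₀ R) := (LieConformalSuperalgebra.toConfData (R := R)).br

/-- The derived subalgebra `R'`: the span of all `n`-th products. -/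
def derived : Submodule ℂ R := Submodule.span ℂ {x | ∃ a b n, x = lbr R a b n}

/-- A (graded) ideal: a `ℂ[∂]`-submodule `I` with `R_(n) I ⊆ I` for all `n`. -/
structure IsIdeal (I : Submodule ℂ R) : Prop where
  graded : I = (I ⊓ part R 0) ⊔ (I ⊓ part R 1)
  del_mem : ∀ x ∈ I, del R x ∈ I
  prod_mem : ∀ a, ∀ x ∈ I, ∀ n, lbr R a x n ∈ I

/-- Simplicity: the bracket is not identically zero and there are no non-trivial ideals. -/
structure IsSimple : Prop where
  nonzero : ∃ a b n, lbr R a b n ≠ 0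
  ideal : ∀ I : Submodule ℂ R, IsIdeal R I → I = ⊥ ∨ I = ⊤

/-- A finite system of generators of `R` as a `ℂ[∂]`-module. -/
structure Generators where
  card : ℕ
  gen : Fin card → R
  span_eq : Submodule.span ℂ (Set.range fun p : Fin card × ℕ => (del R ^ p.2) (gen p.1)) = ⊤

/-! ## The Lie superalgebra `Lie R` and the annihilation algebra -/

/-- `∂ ⊗ 1 + 1 ⊗ ∂_t` on `R[t, t⁻¹]`; an element `a ⊗ t^n` is `Finsupp.single n a`. -/
def affD : (ℤ →₀ R) →ₗ[ℂ] (ℤ →₀ R) :=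
  Finsupp.lsum ℂ fun n : ℤ =>
    Finsupp.lsingle n ∘ₗ del R + (n : ℂ) • Finsupp.lsingle (n - 1)

/-- `∑_j c_j λ^j / j! ↦ ∑_j (m choose j) c_j t^{m+n-j}`. -/
def shift (m n : ℤ) : (ℕ →₀ R) →ₗ[ℂ] (ℤ →₀ R) :=
  Finsupp.lsum ℂ fun j : ℕ => ((Ring.choose m j : ℤ) : ℂ) • Finsupp.lsingle (m + n - j)

/-- The `0`-th product on `R[t, t⁻¹]`: `(a t^m)_(0) (b t^n) = ∑_j (m choose j) (a_(j) b) t^{m+n-j}`. -/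
def affBr : (ℤ →₀ R) →ₗ[ℂ] (ℤ →₀ R) →ₗ[ℂ] (ℤ →₀ R) :=
  Finsupp.lsum ℂ fun m : ℤ =>
    (Finsupp.lsum ℂ fun n : ℤ => ((lbr R).compr₂ (shift R m n)).flip).flip

variable {R}

theorem affD_single (n : ℤ) (a : R) : affD R (Finsupp.single n a) =
    Finsupp.single n (del R a) + (n : ℂ) • Finsupp.single (n - 1) a := by
  simp [affD]

theorem affBr_single (m n : ℤ) (a b : R) :
    affBr R (Finsupp.single m a) (Finsupp.single n b) = shift R m n (lbr R a b) := by
  simp [affBr]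

theorem shift_single (m n : ℤ) (j : ℕ) (c : R) :
    shift R m n (Finsupp.single j c) =
      ((Ring.choose m j : ℤ) : ℂ) • Finsupp.single (m + n - j) c := by
  simp [shift]

theorem choose_succ_mul (m : ℤ) (j : ℕ) :
    ((j : ℂ) + 1) * ((Ring.choose m (j + 1) : ℤ) : ℂ) = ((Ring.choose m j : ℤ) : ℂ) * (m - j) := by
  have h := Ring.choose_smul_choose m (Nat.le_succ j)
  simp [Nat.choose_succ_self_right] at h
  exact_mod_cast h

theorem choose_succ_mul' (m : ℤ) (j : ℕ) :
    ((j : ℂ) + 1) * ((Ring.choose m (j + 1) : ℤ) : ℂ) =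
      (m : ℂ) * ((Ring.choose (m - 1) j : ℤ) : ℂ) := by
  have h := Ring.choose_smul_choose m (Nat.le_add_left 1 j)
  simp at h
  exact_mod_cast h

/-- Multiplication by `λ` on polynomials written in the basis `λ^n / n!`. -/
def lamMul (M : Type*) [AddCommGroup M] [Module ℂ M] : (ℕ →₀ M) →ₗ[ℂ] (ℕ →₀ M) :=
  Finsupp.lsum ℂ fun n : ℕ => (n + 1 : ℂ) • Finsupp.lsingle (n + 1)

theorem lamMul_zero {M : Type*} [AddCommGroup M] [Module ℂ M] (x : ℕ →₀ M) :
    lamMul M x 0 = 0 := by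
  induction x using Finsupp.induction_linear with
  | zero => simp
  | add f g hf hg => simp [hf, hg]
  | single n c => simp [lamMul]

theorem lamMul_succ {M : Type*} [AddCommGroup M] [Module ℂ M] (x : ℕ →₀ M) (n : ℕ) :
    lamMul M x (n + 1) = (n + 1 : ℂ) • x n := by
  induction x using Finsupp.induction_linear with
  | zero => simp
  | add f g hf hg => simp [hf, hg]
  | single k c =>
    by_cases h : k = n
    · subst h; simp [lamMul]
    · simp [lamMul, h]

theorem lbr_del_left (a b : R) : lbr R (del R a) b = - lamMul R (lbr R a b) := by
  ext n
  cases n with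
  | zero => simpa [lamMul_zero] using LieConformalSuperalgebra.br_D_left_zero a b
  | succ n => simpa [lamMul_succ] using LieConformalSuperalgebra.br_D_left_succ a b n

theorem lbr_del_right (a b : R) :
    lbr R a (del R b) = Finsupp.mapRange.linearMap (del R) (lbr R a b) + lamMul R (lbr R a b) := by
  ext n
  cases n with
  | zero => simpa [lamMul_zero] using LieConformalSuperalgebra.br_D_right_zero a b
  | succ n => simpa [lamMul_succ] using LieConformalSuperalgebra.br_D_right_succ a b n

theorem shift_lamMul_left (m n : ℤ) (x : ℕ →₀ R) :
    shift R m n (lamMul R x) = (m : ℂ) • shift R (m - 1) n x := by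
  induction x using Finsupp.induction_linear with
  | zero => simp
  | add f g hf hg => simp [hf, hg]
  | single j c =>
    have e : m - 1 + n - (j : ℤ) = m + n - ((j + 1 : ℕ) : ℤ) := by push_cast; ring
    simp only [lamMul, Finsupp.lsum_apply, Finsupp.sum_single_index, LinearMap.smul_apply,
      Finsupp.lsingle_apply, map_smul, map_zero, shift_single, smul_smul]
    rw [e, choose_succ_mul']

theorem affBr_affD_left (x y : ℤ →₀ R) : affBr R (affD R x) y = 0 := by
  induction x using Finsupp.induction_linear with
  | zero => simp
  | add f g hf hg => simp [hf, hg]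
  | single m a =>
    induction y using Finsupp.induction_linear with
    | zero => simp
    | add f g hf hg => simp [hf, hg]
    | single n b =>
      simp [affD_single, affBr_single, lbr_del_left, shift_lamMul_left]

theorem shift_right (m n : ℤ) (x : ℕ →₀ R) :
    shift R m n (Finsupp.mapRange.linearMap (del R) x + lamMul R x)
      + (n : ℂ) • shift R m (n - 1) x = affD R (shift R m n x) := by
  induction x using Finsupp.induction_linear with
  | zero => simp
  | add f g hf hg =>
    simp only [map_add, smul_add] at hf hg ⊢
    rw [← hf, ← hg]; abel
  | single j c =>
    have e : m + (n - 1) - (j : ℤ) = m + n - ((j + 1 : ℕ) : ℤ) := by push_cast; ring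
    have e' : m + n - (j : ℤ) - 1 = m + n - ((j + 1 : ℕ) : ℤ) := by push_cast; ring
    simp only [lamMul, Finsupp.lsum_apply, Finsupp.sum_single_index, LinearMap.smul_apply,
      Finsupp.lsingle_apply, map_smul, map_zero, map_add, shift_single, smul_smul, affD_single,
      Finsupp.mapRange.linearMap_apply, Finsupp.mapRange_single, smul_add, e, e',
      choose_succ_mul]
    rw [add_assoc, ← add_smul]
    congr 2
    push_cast
    ring

theorem affBr_affD_right (x y : ℤ →₀ R) : affBr R x (affD R y) = affD R (affBr R x y) := by
  induction x using Finsupp.induction_linear with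
  | zero => simp
  | add f g hf hg => simp [hf, hg]
  | single m a =>
    induction y using Finsupp.induction_linear with
    | zero => simp
    | add f g hf hg => simp [hf, hg]
    | single n b =>
      rw [affBr_single, ← shift_right, affD_single, map_add, map_smul, affBr_single,
        affBr_single, lbr_del_right]

variable (R)

/-- `Lie R = R[t, t⁻¹] / (∂ ⊗ 1 + 1 ⊗ ∂_t) R[t, t⁻¹]`. -/
abbrev LieR : Type _ := (ℤ →₀ R) ⧸ LinearMap.range (affD R)

/-- The element `a_n` of `Lie R`, the image of `a ⊗ t^n`. -/
def mode (n : ℤ) : R →ₗ[ℂ] LieR R :=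
  (LinearMap.range (affD R)).mkQ ∘ₗ Finsupp.lsingle n

/-- The bracket of `Lie R`: `[a_m, b_n] = ∑_j (m choose j) (a_(j) b)_{m+n-j}`. -/
def lieBr : LieR R →ₗ[ℂ] LieR R →ₗ[ℂ] LieR R :=
  (LinearMap.range (affD R)).liftQ
    ((LinearMap.range (affD R)).liftQ
      (((affBr R).compr₂ (LinearMap.range (affD R)).mkQ).flip) (by
        rintro _ ⟨y, rfl⟩
        rw [LinearMap.mem_ker]
        ext1 x
        ext a
        simp [affBr_affD_right])).flip (by
    rintro _ ⟨x, rfl⟩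
    rw [LinearMap.mem_ker]
    ext y b
    simp [affBr_affD_left])

variable {R}

theorem lieBr_mode (m n : ℤ) (a b : R) :
    lieBr R (mode R m a) (mode R n b) =
      (lbr R a b).sum fun j c => ((Ring.choose m j : ℤ) : ℂ) • mode R (m + n - j) c := by
  have h : lieBr R (mode R m a) (mode R n b) =
      (LinearMap.range (affD R)).mkQ (affBr R (Finsupp.single m a) (Finsupp.single n b)) := rfl
  rw [h, affBr_single]
  generalize lbr R a b = x
  induction x using Finsupp.induction_linear with
  | zero => simp
  | add f g hf hg =>
    rw [map_add, map_add, hf, hg, Finsupp.sum_add_index'] <;> simp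
  | single j c =>
    rw [shift_single, Finsupp.sum_single_index (by simp), map_smul]; rfl

theorem mode_del (n : ℤ) (a : R) : mode R n (del R a) = -((n : ℂ) • mode R (n - 1) a) := by
  have h : (LinearMap.range (affD R)).mkQ (affD R (Finsupp.single n a)) = 0 := by
    simp
  rw [affD_single, map_add, map_smul] at h
  exact eq_neg_of_add_eq_zero_left h

variable (R)

/-- `(Lie R)_-`, the span of the `a_n` with `n ≥ 0`. -/
def lieMinus : Submodule ℂ (LieR R) := Submodule.span ℂ {x | ∃ (a : R) (n : ℕ), x = mode R n a}

variable {R}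

theorem lieBr_mem (x y : LieR R) (hx : x ∈ lieMinus R) (hy : y ∈ lieMinus R) :
    lieBr R x y ∈ lieMinus R := by
  induction hx using Submodule.span_induction with
  | zero => simp
  | add u v _ _ hu hv => simpa using add_mem hu hv
  | smul c u _ hu => simpa using Submodule.smul_mem _ c hu
  | mem u hu =>
    obtain ⟨a, m, rfl⟩ := hu
    induction hy using Submodule.span_induction with
    | zero => simp
    | add u v _ _ hu hv => simpa using add_mem hu hv
    | smul c u _ hu => simpa using Submodule.smul_mem _ c hu
    | mem v hv =>
      obtain ⟨b, n, rfl⟩ := hv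
      rw [lieBr_mode]
      refine Submodule.sum_mem _ fun j _ => ?_
      by_cases hj : j ≤ m
      · refine Submodule.smul_mem _ _ (Submodule.subset_span ⟨lbr R a b j, m + n - j, ?_⟩)
        congr 2
        omega
      · have : (Ring.choose (m : ℤ) j : ℤ) = 0 := by
          rw [Ring.choose_natCast, Nat.choose_eq_zero_of_lt (by omega)]; simp
        simp [this]

/-- `(Lie R)_-`, to be topologized by means of the generators `S`. -/
def Minus (_S : Generators R) : Type _ := lieMinus R

variable (S : Generators R)

instance : AddCommGroup (Minus S) := inferInstanceAs (AddCommGroup (lieMinus R))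
instance : Module ℂ (Minus S) := inferInstanceAs (Module ℂ (lieMinus R))

/-- The inclusion of `(Lie R)_-` in `Lie R`. -/
def incl : Minus S →ₗ[ℂ] LieR R := (lieMinus R).subtype

/-- The element `a_n` (`n ≥ 0`) of `(Lie R)_-`. -/
def mmode (n : ℕ) : R →ₗ[ℂ] Minus S :=
  LinearMap.codRestrict (lieMinus R) (mode R n) fun a => Submodule.subset_span ⟨a, n, rfl⟩

/-- The bracket of `(Lie R)_-`. -/
def minusBr : Minus S →ₗ[ℂ] Minus S →ₗ[ℂ] Minus S :=
  LinearMap.mk₂ ℂ (fun x y => ⟨lieBr R (incl S x) (incl S y), lieBr_mem _ _ x.2 y.2⟩)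
    (fun x x' y => Subtype.ext (by
      change lieBr R (incl S (x + x')) (incl S y) =
        lieBr R (incl S x) (incl S y) + lieBr R (incl S x') (incl S y)
      simp))
    (fun c x y => Subtype.ext (by
      change lieBr R (incl S (c • x)) (incl S y) = c • lieBr R (incl S x) (incl S y)
      simp))
    (fun x y y' => Subtype.ext (by
      change lieBr R (incl S x) (incl S (y + y')) =
        lieBr R (incl S x) (incl S y) + lieBr R (incl S x) (incl S y')
      simp))
    (fun c x y => Subtype.ext (by
      change lieBr R (incl S x) (incl S (c • y)) = c • lieBr R (incl S x) (incl S y)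
      simp))

/-- The subspace `ℒ_m`: the span of the `a_n`, `n ≥ m`, with `a` in the system of generators. -/
def filt (m : ℕ) : Submodule ℂ (Minus S) :=
  Submodule.span ℂ {x | ∃ (j : Fin S.card) (n : ℕ), m ≤ n ∧ x = mmode S n (S.gen j)}

theorem filt_anti {m n : ℕ} (h : m ≤ n) : filt S n ≤ filt S m :=
  Submodule.span_mono fun _ ⟨j, k, hk, e⟩ => ⟨j, k, h.trans hk, e⟩

/-- The `ℒ_m` as a basis of neighbourhoods of `0`. -/
abbrev filtBasis : AddGroupFilterBasis (Minus S) :=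
  addGroupFilterBasisOfComm (Set.range fun m => (filt S m : Set (Minus S)))
    (Set.range_nonempty _)
    (by
      rintro _ _ ⟨m, rfl⟩ ⟨n, rfl⟩
      exact ⟨_, ⟨max m n, rfl⟩, Set.subset_inter (filt_anti S (le_max_left m n))
        (filt_anti S (le_max_right m n))⟩)
    (by rintro _ ⟨m, rfl⟩; exact zero_mem _)
    (by
      rintro _ ⟨m, rfl⟩
      refine ⟨_, ⟨m, rfl⟩, ?_⟩
      rintro _ ⟨x, hx, y, hy, rfl⟩
      exact add_mem hx hy)
    (by
      rintro _ ⟨m, rfl⟩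
      exact ⟨_, ⟨m, rfl⟩, fun x hx => neg_mem hx⟩)

instance : TopologicalSpace (Minus S) := (filtBasis S).topology

instance : IsTopologicalAddGroup (Minus S) := (filtBasis S).isTopologicalAddGroup

instance : UniformSpace (Minus S) := IsTopologicalAddGroup.rightUniformSpace _

instance : IsUniformAddGroup (Minus S) := isUniformAddGroup_of_addCommGroup

theorem nhds_zero_hasBasis :
    (𝓝 (0 : Minus S)).HasBasis (fun _ : ℕ => True) fun m => (filt S m : Set (Minus S)) := by
  refine ⟨fun t => ?_⟩
  rw [(filtBasis S).nhds_zero_hasBasis.mem_iff]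
  constructor
  · rintro ⟨_, ⟨m, rfl⟩, h⟩; exact ⟨m, trivial, h⟩
  · rintro ⟨m, -, h⟩; exact ⟨_, ⟨m, rfl⟩, h⟩

instance : UniformContinuousConstSMul ℂ (Minus S) where
  uniformContinuous_const_smul c := by
    refine uniformContinuous_of_continuousAt_zero (DistribSMul.toAddMonoidHom (Minus S) c) ?_
    rw [ContinuousAt, map_zero]
    exact ((nhds_zero_hasBasis S).tendsto_iff (nhds_zero_hasBasis S)).2 fun m _ =>
      ⟨m, trivial, fun x hx => Submodule.smul_mem _ c hx⟩

theorem mmode_mem (r : R) : ∃ d, ∀ n, mmode S n r ∈ filt S (n - d) := by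
  have hr : r ∈ Submodule.span ℂ
      (Set.range fun p : Fin S.card × ℕ => (del R ^ p.2) (S.gen p.1)) := by
    rw [S.span_eq]; trivial
  induction hr using Submodule.span_induction with
  | zero => exact ⟨0, fun n => by simp⟩
  | add u v _ _ hu hv =>
    obtain ⟨d, hd⟩ := hu
    obtain ⟨e, he⟩ := hv
    refine ⟨max d e, fun n => ?_⟩
    rw [map_add]
    exact add_mem (filt_anti S (by omega) (hd n)) (filt_anti S (by omega) (he n))
  | smul c u _ hu =>
    obtain ⟨d, hd⟩ := hu
    exact ⟨d, fun n => by rw [map_smul]; exact Submodule.smul_mem _ _ (hd n)⟩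
  | mem u hu =>
    obtain ⟨⟨j, k⟩, rfl⟩ := hu
    refine ⟨k, ?_⟩
    dsimp only
    induction k with
    | zero => exact fun n => Submodule.subset_span ⟨j, n, by simp, by simp⟩
    | succ k ih =>
      intro n
      have e : mmode S n ((del R ^ (k + 1)) (S.gen j)) =
          -((n : ℂ) • mmode S (n - 1) ((del R ^ k) (S.gen j))) := by
        apply Subtype.ext
        change mode R n _ = -((n : ℂ) • mode R ((n - 1 : ℕ) : ℤ) _)
        rw [pow_succ', Module.End.mul_apply, mode_del]
        cases n with
        | zero => simp
        | succ n => simp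
      rw [e]
      refine neg_mem (Submodule.smul_mem _ _ ?_)
      have := ih (n - 1)
      rwa [Nat.sub_sub, Nat.add_comm 1 k] at this

theorem minusBr_mmode_mem (a b : R) :
    ∃ d, ∀ m n, minusBr S (mmode S m a) (mmode S n b) ∈ filt S (m + n - d) := by
  choose d hd using mmode_mem S
  refine ⟨(lbr R a b).support.sup fun j => d (lbr R a b j) + j, fun m n => ?_⟩
  have e : minusBr S (mmode S m a) (mmode S n b) =
      (lbr R a b).sum fun j c => ((Ring.choose (m : ℤ) j : ℤ) : ℂ) • mmode S (m + n - j) c := by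
    apply Subtype.ext
    change lieBr R (mode R m a) (mode R n b) = incl S _
    rw [lieBr_mode, map_finsuppSum]
    refine Finset.sum_congr rfl fun j _ => ?_
    dsimp only
    rw [map_smul]
    by_cases hj : j ≤ m
    · change _ = _ • mode R ((m + n - j : ℕ) : ℤ) _
      congr 3
      omega
    · have : (Ring.choose (m : ℤ) j : ℤ) = 0 := by
        rw [Ring.choose_natCast, Nat.choose_eq_zero_of_lt (by omega)]; simp
      simp [this]
  rw [e]
  refine Submodule.sum_mem _ fun j hj => Submodule.smul_mem _ _ ?_
  have h1 : d (lbr R a b j) + j ≤ _ :=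
    Finset.le_sup (f := fun j => d (lbr R a b j) + j) hj
  exact filt_anti S (by omega) (hd (lbr R a b j) (m + n - j))

theorem filt_zero : filt S 0 = ⊤ := by
  rw [eq_top_iff]
  have h : ∀ x : LieR R, ∀ hx : x ∈ lieMinus R, (⟨x, hx⟩ : lieMinus R) ∈ filt S 0 := by
    intro x hx
    induction hx using Submodule.span_induction with
    | zero => exact zero_mem (filt S 0)
    | add u v _ _ hu hv => exact add_mem hu hv
    | smul c u _ hu => exact Submodule.smul_mem _ c hu
    | mem u hu =>
      obtain ⟨a, n, rfl⟩ := hu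
      obtain ⟨d, hd⟩ := mmode_mem S a
      exact filt_anti S (Nat.zero_le _) (hd n)
  exact fun x _ => h x.1 x.2

theorem minusBr_filt : ∃ d, ∀ m n, ∀ x ∈ filt S m, ∀ y ∈ filt S n,
    minusBr S x y ∈ filt S (m + n - d) := by
  choose d hd using minusBr_mmode_mem S
  refine ⟨Finset.univ.sup fun p : Fin S.card × Fin S.card => d (S.gen p.1) (S.gen p.2),
    fun m n x hx y hy => ?_⟩
  induction hx using Submodule.span_induction with
  | zero => simp
  | add u v _ _ hu hv => simpa using add_mem hu hv
  | smul c u _ hu => simpa using Submodule.smul_mem _ c hu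
  | mem u hu =>
    obtain ⟨i, p, hp, rfl⟩ := hu
    induction hy using Submodule.span_induction with
    | zero => simp
    | add u v _ _ hu hv => simpa using add_mem hu hv
    | smul c u _ hu => simpa using Submodule.smul_mem _ c hu
    | mem v hv =>
      obtain ⟨j, q, hq, rfl⟩ := hv
      have h1 : d (S.gen i) (S.gen j) ≤ _ := Finset.le_sup
        (f := fun p : Fin S.card × Fin S.card => d (S.gen p.1) (S.gen p.2))
        (Finset.mem_univ (i, j))
      exact filt_anti S (by omega) (hd _ _ p q)

theorem uniformContinuous_minusBr : UniformContinuous₂ fun x y => minusBr S x y := by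
  obtain ⟨d, hd⟩ := minusBr_filt S
  have hb : (𝓤 (Minus S)).HasBasis (fun _ : ℕ => True)
      fun m => {p : Minus S × Minus S | p.2 - p.1 ∈ filt S m} := by
    rw [uniformity_eq_comap_nhds_zero]
    exact (nhds_zero_hasBasis S).comap _
  refine ((hb.uniformity_prod hb).uniformContinuous_iff hb).2 fun m _ =>
    ⟨(m + d, m + d), ⟨trivial, trivial⟩, ?_⟩
  rintro ⟨x, y⟩ ⟨x', y'⟩ h
  have h1 : x' - x ∈ filt S (m + d) := h.1
  have h2 : y' - y ∈ filt S (m + d) := h.2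
  change minusBr S x' y' - minusBr S x y ∈ filt S m
  have e : minusBr S x' y' - minusBr S x y = minusBr S (x' - x) y' + minusBr S x (y' - y) := by
    simp
  rw [e]
  refine add_mem ?_ ?_
  · exact filt_anti S (by omega) (hd (m + d) 0 _ h1 y' (by rw [filt_zero]; trivial))
  · exact filt_anti S (by omega) (hd 0 (m + d) x (by rw [filt_zero]; trivial) _ h2)

/-- The annihilation algebra `𝒜(R)`: the completion of `(Lie R)_-` in the topology given
by the `ℒ_m`. -/
abbrev Ann : Type _ := UniformSpace.Completion (Minus S)

/-- The continuous extension of the bracket of `(Lie R)_-` to its completion, as a mere map. -/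
def annMap (x y : Ann S) : Ann S := UniformSpace.Completion.map₂ (fun x y => minusBr S x y) x y

theorem annMap_coe (x y : Minus S) : annMap S x y = (minusBr S x y : Ann S) :=
  UniformSpace.Completion.map₂_coe_coe _ _ _ (uniformContinuous_minusBr S)

theorem continuous_annMap {T : Type*} [TopologicalSpace T] {f g : T → Ann S}
    (hf : Continuous f) (hg : Continuous g) : Continuous fun t => annMap S (f t) (g t) :=
  UniformSpace.Completion.continuous_map₂ hf hg

theorem annMap_add_left (x x' y : Ann S) :
    annMap S (x + x') y = annMap S x y + annMap S x' y := by
  refine UniformSpace.Completion.induction_on₃ x x' y (isClosed_eq ?_ ?_) ?_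
  · exact continuous_annMap S (continuous_fst.add (continuous_fst.comp continuous_snd))
      (continuous_snd.comp continuous_snd)
  · exact (continuous_annMap S continuous_fst (continuous_snd.comp continuous_snd)).add
      (continuous_annMap S (continuous_fst.comp continuous_snd)
        (continuous_snd.comp continuous_snd))
  · intro a b c
    rw [← UniformSpace.Completion.coe_add, annMap_coe, annMap_coe, annMap_coe,
      ← UniformSpace.Completion.coe_add, map_add, LinearMap.add_apply]

theorem annMap_add_right (x y y' : Ann S) :
    annMap S x (y + y') = annMap S x y + annMap S x y' := by
  refine UniformSpace.Completion.induction_on₃ x y y' (isClosed_eq ?_ ?_) ?_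
  · exact continuous_annMap S continuous_fst
      ((continuous_fst.comp continuous_snd).add (continuous_snd.comp continuous_snd))
  · exact (continuous_annMap S continuous_fst (continuous_fst.comp continuous_snd)).add
      (continuous_annMap S continuous_fst (continuous_snd.comp continuous_snd))
  · intro a b c
    rw [← UniformSpace.Completion.coe_add, annMap_coe, annMap_coe, annMap_coe,
      ← UniformSpace.Completion.coe_add, map_add]

theorem annMap_smul_left (c : ℂ) (x y : Ann S) : annMap S (c • x) y = c • annMap S x y := by
  refine UniformSpace.Completion.induction_on₂ x y (isClosed_eq ?_ ?_) ?_
  · exact continuous_annMap S (continuous_fst.const_smul c) continuous_snd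
  · exact (continuous_annMap S continuous_fst continuous_snd).const_smul c
  · intro a b
    rw [← UniformSpace.Completion.coe_smul, annMap_coe, annMap_coe,
      ← UniformSpace.Completion.coe_smul, map_smul, LinearMap.smul_apply]

theorem annMap_smul_right (c : ℂ) (x y : Ann S) : annMap S x (c • y) = c • annMap S x y := by
  refine UniformSpace.Completion.induction_on₂ x y (isClosed_eq ?_ ?_) ?_
  · exact continuous_annMap S continuous_fst (continuous_snd.const_smul c)
  · exact (continuous_annMap S continuous_fst continuous_snd).const_smul c
  · intro a b
    rw [← UniformSpace.Completion.coe_smul, annMap_coe, annMap_coe,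
      ← UniformSpace.Completion.coe_smul, map_smul]

/-- The bracket of `𝒜(R)`: the continuous extension of the bracket of `(Lie R)_-`. -/
def annBr : Ann S →ₗ[ℂ] Ann S →ₗ[ℂ] Ann S :=
  LinearMap.mk₂ ℂ (annMap S) (annMap_add_left S) (annMap_smul_left S)
    (annMap_add_right S) (annMap_smul_right S)

/-- The parity subspaces of `𝒜(R)`: the closures of the spans of the `a_n` with `a` of the given
parity. -/
def annPart (i : ZMod 2) : Submodule ℂ (Ann S) :=
  (Submodule.span ℂ {x : Ann S | ∃ a ∈ part R i, ∃ n : ℕ, x = (mmode S n a : Ann S)}).topologicalClosure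

end Basic

/-! ## Topological Lie superalgebras, central extensions and cohomology -/

/-- A superalgebra: parity subspaces and a bilinear product, written as a bracket. -/
class Superalgebra (g : Type*) [AddCommGroup g] [Module ℂ g] where
  gpart : ZMod 2 → Submodule ℂ g
  brk : g →ₗ[ℂ] g →ₗ[ℂ] g

open Superalgebra

instance {R : Type*} [AddCommGroup R] [Module ℂ R] [LieConformalSuperalgebra R]
    (S : Generators R) : Superalgebra (Ann S) where
  gpart := annPart S
  brk := annBr S

section Super

variable (g : Type*) [AddCommGroup g] [Module ℂ g] [Superalgebra g]

/-- The laws of a Lie superalgebra. -/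
structure IsLieSuperalgebra : Prop where
  isCompl_part : IsCompl (gpart 0 : Submodule ℂ g) (gpart 1)
  brk_mem : ∀ i j, ∀ x ∈ (gpart i : Submodule ℂ g), ∀ y ∈ (gpart j : Submodule ℂ g),
    brk x y ∈ (gpart (i + j) : Submodule ℂ g)
  skew : ∀ i j, ∀ x ∈ (gpart i : Submodule ℂ g), ∀ y ∈ (gpart j : Submodule ℂ g),
    brk x y = -(sgn i j • brk y x)
  jacobi : ∀ i j, ∀ x ∈ (gpart i : Submodule ℂ g), ∀ y ∈ (gpart j : Submodule ℂ g), ∀ z,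
    brk x (brk y z) = brk (brk x y) z + sgn i j • brk y (brk x z)

/-- The center. -/
def center : Submodule ℂ g where
  carrier := {z | ∀ x : g, brk z x = 0 ∧ brk x z = 0}
  zero_mem' := fun x => by simp
  add_mem' := fun ha hb x => by simp [ha x, hb x]
  smul_mem' := fun c a ha x => by simp [ha x]

/-- The quotient of a superalgebra by its center. -/
instance : Superalgebra (g ⧸ center g) where
  gpart i := (gpart i : Submodule ℂ g).map (center g).mkQ
  brk := (center g).liftQ
    ((center g).liftQ ((brk.compr₂ (center g).mkQ).flip) (fun z hz => by
      rw [LinearMap.mem_ker]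
      ext x
      simp [(hz x).2])).flip (fun z hz => by
    rw [LinearMap.mem_ker]
    ext x
    simp [(hz x).1])

variable [TopologicalSpace g]

/-- Linear compactness: a Hausdorff, linearly topologized vector space (over the discrete
field `ℂ`) in which every family of closed affine subspaces with the finite intersection property
has non-empty intersection. -/
structure IsLinearlyCompact (V : Type*) [AddCommGroup V] [Module ℂ V] [TopologicalSpace V] :
    Prop where
  t2 : T2Space V
  addGroup : IsTopologicalAddGroup V
  linear : IsLinearTopology ℂ V
  inter : ∀ F : Set (AffineSubspace ℂ V), (∀ s ∈ F, IsClosed (s : Set V)) →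
    (∀ G : Finset (AffineSubspace ℂ V), (G : Set (AffineSubspace ℂ V)) ⊆ F →
      (⋂ s ∈ G, (s : Set V)).Nonempty) →
    (⋂ s ∈ F, (s : Set V)).Nonempty

/-- A linearly compact Lie superalgebra. -/
structure IsLinearlyCompactLie : Prop where
  lie : IsLieSuperalgebra g
  compact : IsLinearlyCompact g
  closed_part : ∀ i, IsClosed ((gpart i : Submodule ℂ g) : Set g)
  continuous_brk : Continuous fun p : g × g => brk p.1 p.2

/-- Continuous `2`-cochains with trivial coefficients that satisfy the cocycle condition:
super-skew-symmetric bilinear forms `φ : g × g → ℂ`, continuous for the discrete topology of `ℂ`,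
with `φ(x, [y, z]) = φ([x, y], z) + (-1)^{p(x)p(y)} φ(y, [x, z])`. Both even and odd forms occur. -/
def Z2 : Submodule ℂ (g →ₗ[ℂ] g →ₗ[ℂ] ℂ) where
  carrier := {φ |
    Continuous[_, ⊥] (fun p : g × g => φ p.1 p.2) ∧
    (∀ i j, ∀ x ∈ (gpart i : Submodule ℂ g), ∀ y ∈ (gpart j : Submodule ℂ g),
      φ x y = -(sgn i j * φ y x)) ∧
    (∀ i j, ∀ x ∈ (gpart i : Submodule ℂ g), ∀ y ∈ (gpart j : Submodule ℂ g), ∀ z,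
      φ x (brk y z) = φ (brk x y) z + sgn i j * φ y (brk x z))}
  zero_mem' := ⟨@continuous_const _ _ _ ⊥ 0, by simp, by simp⟩
  add_mem' := by
    rintro φ ψ ⟨h1, h2, h3⟩ ⟨k1, k2, k3⟩
    refine ⟨?_, ?_, ?_⟩
    · let _ : TopologicalSpace ℂ := ⊥
      have _ : DiscreteTopology ℂ := ⟨rfl⟩
      exact (continuous_of_discreteTopology (f := fun q : ℂ × ℂ => q.1 + q.2)).comp
        (h1.prodMk k1)
    · intro i j x hx y hy
      simp only [LinearMap.add_apply, h2 i j x hx y hy, k2 i j x hx y hy]; ring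
    · intro i j x hx y hy z
      simp only [LinearMap.add_apply, h3 i j x hx y hy, k3 i j x hx y hy]; ring
  smul_mem' := by
    rintro c φ ⟨h1, h2, h3⟩
    refine ⟨?_, ?_, ?_⟩
    · let _ : TopologicalSpace ℂ := ⊥
      have _ : DiscreteTopology ℂ := ⟨rfl⟩
      exact (continuous_of_discreteTopology (f := fun q : ℂ => c * q)).comp h1
    · intro i j x hx y hy
      simp only [LinearMap.smul_apply, smul_eq_mul, h2 i j x hx y hy]; ring
    · intro i j x hx y hy z
      simp only [LinearMap.smul_apply, smul_eq_mul, h3 i j x hx y hy]; ring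

/-- The `2`-coboundaries `(x, y) ↦ β([x, y])` of continuous linear functionals `β`. -/
def B2 : Submodule ℂ (g →ₗ[ℂ] g →ₗ[ℂ] ℂ) where
  carrier := {φ | ∃ β : g →ₗ[ℂ] ℂ, Continuous[_, ⊥] (fun x : g => β x) ∧
    ∀ x y, φ x y = β (brk x y)}
  zero_mem' := ⟨0, @continuous_const _ _ _ ⊥ 0, by simp⟩
  add_mem' := by
    rintro φ ψ ⟨β, h1, h2⟩ ⟨γ, k1, k2⟩
    refine ⟨β + γ, ?_, fun x y => by simp [h2, k2]⟩
    let _ : TopologicalSpace ℂ := ⊥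
    have _ : DiscreteTopology ℂ := ⟨rfl⟩
    exact (continuous_of_discreteTopology (f := fun q : ℂ × ℂ => q.1 + q.2)).comp (h1.prodMk k1)
  smul_mem' := by
    rintro c φ ⟨β, h1, h2⟩
    refine ⟨c • β, ?_, fun x y => by simp [h2]⟩
    let _ : TopologicalSpace ℂ := ⊥
    have _ : DiscreteTopology ℂ := ⟨rfl⟩
    exact (continuous_of_discreteTopology (f := fun q : ℂ => c * q)).comp h1

/-- The second continuous cohomology of `g` with trivial coefficients: the space of cocycles modulo
coboundaries, realized as the image of `Z2` in the quotient of the space of bilinear forms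
by `B2`. -/
abbrev H2 : Type _ := (Z2 g).map (B2 g).mkQ

end Super

/-- Homomorphisms of topological superalgebras: continuous, parity preserving, multiplicative. -/
structure IsHom {g h : Type*} [AddCommGroup g] [Module ℂ g] [Superalgebra g] [TopologicalSpace g]
    [AddCommGroup h] [Module ℂ h] [Superalgebra h] [TopologicalSpace h] (f : g →ₗ[ℂ] h) :
    Prop where
  continuous : Continuous f
  part : ∀ i, ∀ x ∈ (gpart i : Submodule ℂ g), f x ∈ (gpart i : Submodule ℂ h)
  map_brk : ∀ x y, f (brk x y) = brk (f x) (f y)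

/-- `π : E → Q` is a central extension of linearly compact Lie superalgebras. -/
structure IsCentralExtension {E Q : Type*} [AddCommGroup E] [Module ℂ E] [Superalgebra E]
    [TopologicalSpace E] [AddCommGroup Q] [Module ℂ Q] [Superalgebra Q] [TopologicalSpace Q]
    (π : E →ₗ[ℂ] Q) : Prop where
  source : IsLinearlyCompactLie E
  target : IsLinearlyCompactLie Q
  hom : IsHom π
  surjective : Function.Surjective π
  central : LinearMap.ker π ≤ center E

/-- `π : A → Q` is the universal central extension of `Q` among linearly compact Lie
superalgebras: it maps uniquely to every central extension of `Q`. -/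
def IsUniversalCentralExtension.{u, v, w} {A : Type u} {Q : Type v}
    [AddCommGroup A] [Module ℂ A] [Superalgebra A] [TopologicalSpace A]
    [AddCommGroup Q] [Module ℂ Q] [Superalgebra Q] [TopologicalSpace Q] (π : A →ₗ[ℂ] Q) : Prop :=
  IsCentralExtension π ∧
    ∀ (E : Type w) [AddCommGroup E] [Module ℂ E] [Superalgebra E] [TopologicalSpace E]
      (ρ : E →ₗ[ℂ] Q), IsCentralExtension ρ →
      ∃! f : A →ₗ[ℂ] E, IsHom f ∧ ∀ x, ρ (f x) = π x

/-! ## The examples -/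

/-- The free `ℂ[∂]`-module `ℂ[∂] ⊗ V`; `∂^k v` is `Finsupp.single k v`. -/
abbrev Free (V : Type*) [AddCommGroup V] : Type _ := ℕ →₀ V

section Free

variable (V : Type*) [AddCommGroup V] [Module ℂ V]

/-- The action of `∂` on `ℂ[∂] ⊗ V`. -/
def freeD : Free V →ₗ[ℂ] Free V := Finsupp.lsum ℂ fun k : ℕ => Finsupp.lsingle (k + 1)

/-- The extension of a `λ`-bracket from `V` to `ℂ[∂] ⊗ V` by sesquilinearity:
`[∂^p a_λ ∂^q b] = (-λ)^p (∂ + λ)^q [a_λ b]`. -/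
def sesq (b : V →ₗ[ℂ] V →ₗ[ℂ] (ℕ →₀ Free V)) : Free V →ₗ[ℂ] Free V →ₗ[ℂ] (ℕ →₀ Free V) :=
  Finsupp.lsum ℂ fun p : ℕ =>
    (Finsupp.lsum ℂ fun q : ℕ =>
      (b.compr₂ ((-lamMul (Free V)) ^ p *
        (Finsupp.mapRange.linearMap (freeD V) + lamMul (Free V)) ^ q)).flip).flip

/-- The span of the `∂^k v` with `v` in a given subspace. -/
def freePart (P : Submodule ℂ V) : Submodule ℂ (Free V) where
  carrier := {x | ∀ k, x k ∈ P}
  zero_mem' := fun _ => P.zero_mem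
  add_mem' := fun ha hb k => P.add_mem (ha k) (hb k)
  smul_mem' := fun c _ ha k => P.smul_mem c (ha k)

end Free

/-- The Grassmann algebra `Λ(N)` on the odd variables `ξ_i`. -/
abbrev Gr (N : ℕ) : Type := ExteriorAlgebra ℂ (Fin N → ℂ)

section Grassmann

variable (N : ℕ)

/-- The generator `ξ_i`. -/
def xi (i : Fin N) : Gr N := ExteriorAlgebra.ι ℂ (Pi.single i 1)

/-- The odd derivation `∂_i = ∂/∂ξ_i`. -/
def pd (i : Fin N) : Gr N →ₗ[ℂ] Gr N :=
  CliffordAlgebra.contractLeft (LinearMap.proj i : (Fin N → ℂ) →ₗ[ℂ] ℂ)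

/-- The parity operator `f ↦ (-1)^{p(f)} f`. -/
def sig : Gr N →ₗ[ℂ] Gr N := CliffordAlgebra.involute.toLinearMap

/-- The parity subspaces of `Λ(N)`. -/
def grPart (i : ZMod 2) : Submodule ℂ (Gr N) := CliffordAlgebra.evenOdd 0 i

/-- The top monomial `ξ_1 ⋯ ξ_N`. -/
def top : Gr N := (List.ofFn (xi N)).prod

/-- `W(N) ⊕ Λ(N)`: the pair `(P, f)` is `∑ P_i ∂_i + f`. -/
abbrev WGen : Type := (Fin N → Gr N) × Gr N

/-- The parity subspaces of `W(N) ⊕ Λ(N)`. -/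
def wPart (i : ZMod 2) : Submodule ℂ (WGen N) :=
  (Submodule.pi Set.univ fun _ => grPart N (i + 1)).prod (grPart N i)

/-- A `λ`-bracket of the form `b₀ + ∂ b₁ + λ b₂` on generators. -/
def bracketOf {V : Type*} [AddCommGroup V] [Module ℂ V] (b₀ b₁ b₂ : V →ₗ[ℂ] V →ₗ[ℂ] V) :
    V →ₗ[ℂ] V →ₗ[ℂ] (ℕ →₀ Free V) :=
  b₀.compr₂ (Finsupp.lsingle 0 ∘ₗ Finsupp.lsingle 0)
    + b₁.compr₂ (Finsupp.lsingle 0 ∘ₗ Finsupp.lsingle 1)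
    + b₂.compr₂ (Finsupp.lsingle 1 ∘ₗ Finsupp.lsingle 0)

/-- The constant term of the `λ`-bracket on generators of `W_N`, see `confW`. -/
def wBr₀ : WGen N →ₗ[ℂ] WGen N →ₗ[ℂ] WGen N :=
  LinearMap.mk₂ ℂ (fun x y =>
      (fun k => ∑ i, (x.1 i * pd N i (y.1 k) + pd N i (sig N (x.1 k)) * y.1 i),
        ∑ i, (x.1 i * pd N i y.2 + sig N (pd N i x.2 * y.1 i))))
    (fun _ _ _ => by
      ext k <;> simp [add_mul, Finset.sum_add_distrib] <;> abel)
    (fun _ _ _ => by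
      ext k <;> simp [Finset.sum_add_distrib, Finset.smul_sum])
    (fun _ _ _ => by
      ext k <;> simp [mul_add, Finset.sum_add_distrib] <;> abel)
    (fun _ _ _ => by
      ext k <;> simp [Finset.sum_add_distrib, Finset.smul_sum])

/-- The coefficient of `∂` in the `λ`-bracket on generators of `W_N`, see `confW`. -/
def wBr₁ : WGen N →ₗ[ℂ] WGen N →ₗ[ℂ] WGen N :=
  LinearMap.mk₂ ℂ (fun x y => (fun k => -(x.2 * y.1 k), -(x.2 * y.2)))
    (fun _ _ _ => by ext k <;> simp [add_mul] <;> abel)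
    (fun _ _ _ => by ext k <;> simp)
    (fun _ _ _ => by ext k <;> simp [mul_add] <;> abel)
    (fun _ _ _ => by ext k <;> simp)

/-- The coefficient of `λ` in the `λ`-bracket on generators of `W_N`, see `confW`. -/
def wBr₂ : WGen N →ₗ[ℂ] WGen N →ₗ[ℂ] WGen N :=
  LinearMap.mk₂ ℂ (fun x y =>
      (fun k => -(x.1 k * sig N y.2) - x.2 * y.1 k, -(x.2 * y.2) - x.2 * y.2))
    (fun _ _ _ => by ext k <;> simp [add_mul] <;> abel)
    (fun _ _ _ => by ext k <;> simp [smul_sub])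
    (fun _ _ _ => by ext k <;> simp [mul_add] <;> abel)
    (fun _ _ _ => by ext k <;> simp [smul_sub])

/-- The Lie conformal superalgebra `W_N = ℂ[∂] ⊗ (W(N) ⊕ Λ(N))`. On generators, for homogeneous
`A, B ∈ Λ(N)`, its `λ`-bracket is
`[A∂_i λ B∂_j] = A ∂_i(B) ∂_j + (-1)^{p(A)} ∂_j(A) B ∂_i`,
`[A∂_i λ B] = A ∂_i(B) - (-1)^{p(B)} λ A B ∂_i`,
`[A λ B∂_j] = (-1)^{p(∂_j(A) B)} ∂_j(A) B - (∂ + λ) A B ∂_j`,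
`[A λ B] = -∂(A B) - 2 λ A B`.
In other words, `[a_λ b] = [a, b]`, `[a_λ f] = a(f) - λ (-1)^{p(a)p(f)} f a`,
`[f_λ g] = -∂(f g) - 2 λ f g` for `a, b ∈ W(N)`, `f, g ∈ Λ(N)`, and `[f_λ a]` is given by
skew-commutativity. -/
def confW : ConfData (Free (WGen N)) where
  part i := freePart _ (wPart N i)
  D := freeD _
  br := sesq _ (bracketOf (wBr₀ N) (wBr₁ N) (wBr₂ N))

/-- The deformed divergence `∑ P_i ∂_i + f ↦ ∑ (-1)^{p(P_i)} ∂_i(P_i) - ∂ f + a f`,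
extended `ℂ[∂]`-linearly to `W_N`. -/
def dvg (a : ℂ) : Free (WGen N) →ₗ[ℂ] Free (Gr N) :=
  Finsupp.lsum ℂ fun k : ℕ =>
    Finsupp.lsingle k ∘ₗ
        ((∑ i, pd N i ∘ₗ sig N ∘ₗ LinearMap.proj i) ∘ₗ LinearMap.fst ℂ (Fin N → Gr N) (Gr N)
          + a • LinearMap.snd ℂ (Fin N → Gr N) (Gr N))
      - Finsupp.lsingle (k + 1) ∘ₗ LinearMap.snd ℂ (Fin N → Gr N) (Gr N)

/-- Left multiplication by `1 + ξ_1 ⋯ ξ_N` on `W_N`. -/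
def mulTop : Free (WGen N) →ₗ[ℂ] Free (WGen N) :=
  Finsupp.mapRange.linearMap
    ((LinearMap.pi fun i => LinearMap.mulLeft ℂ (1 + top N) ∘ₗ LinearMap.proj i).prodMap
      (LinearMap.mulLeft ℂ (1 + top N)))

/-- `S_{N,a} = {D ∈ W_N | div_a D = 0}`. -/
def subS (a : ℂ) : Submodule ℂ (Free (WGen N)) := LinearMap.ker (dvg N a)

/-- `S̃_N = {D ∈ W_N | div ((1 + ξ_1 ⋯ ξ_N) D) = 0}`. -/
def subSt : Submodule ℂ (Free (WGen N)) := LinearMap.ker (dvg N 0 ∘ₗ mulTop N)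

/-- The Euler operator `∑ ξ_i ∂_i`, which multiplies a monomial by its degree. -/
def euler : Gr N →ₗ[ℂ] Gr N := ∑ i, LinearMap.mulLeft ℂ (xi N i) ∘ₗ pd N i

/-- The constant term of the `λ`-bracket on generators of `K_N`, see `confK`. -/
def kBr₀ : Gr N →ₗ[ℂ] Gr N →ₗ[ℂ] Gr N :=
  (1 / 2 : ℂ) • ∑ i, ((LinearMap.mul ℂ (Gr N)).compl₂ (pd N i)) ∘ₗ (pd N i ∘ₗ sig N)

/-- The coefficient of `∂` in the `λ`-bracket on generators of `K_N`, see `confK`. -/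
def kBr₁ : Gr N →ₗ[ℂ] Gr N →ₗ[ℂ] Gr N :=
  LinearMap.mul ℂ (Gr N) ∘ₗ ((1 / 2 : ℂ) • euler N - LinearMap.id)

/-- The coefficient of `λ` in the `λ`-bracket on generators of `K_N`, see `confK`. -/
def kBr₂ : Gr N →ₗ[ℂ] Gr N →ₗ[ℂ] Gr N :=
  (1 / 2 : ℂ) • (LinearMap.mul ℂ (Gr N) ∘ₗ euler N + (LinearMap.mul ℂ (Gr N)).compl₂ (euler N))
    - (2 : ℂ) • LinearMap.mul ℂ (Gr N)

/-- `K_N = ℂ[∂] ⊗ Λ(N)`; for monomials `A`, `B` of degrees `r`, `s`,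
`[A_λ B] = (r/2 - 1) ∂(A B) + (-1)^r 1/2 ∑ ∂_i(A) ∂_i(B) + λ ((r + s)/2 - 2) A B`. -/
def confK : ConfData (Free (Gr N)) where
  part i := freePart _ (grPart N i)
  D := freeD _
  br := sesq _ (bracketOf (kBr₀ N) (kBr₁ N) (kBr₂ N))

end Grassmann

/-- `K_4'`, the derived subalgebra of `K_4`. -/
def subK4' : Submodule ℂ (Free (Gr 4)) :=
  Submodule.span ℂ {x | ∃ a b n, x = (confK 4).br a b n}

/-- For a permutation `s` of the six indices, with `f = ξ_{s(1)} ⋯ ξ_{s(r)}` and Hodge dual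
`f* = sgn(s) ξ_{s(r+1)} ⋯ ξ_{s(6)}` (so that `f f* = ξ_1 ⋯ ξ_6`), the element
`f - i (-1)^{r(r+1)/2} (-∂)^{3-r} f*` of `K_6`. -/
def ckGen (s : Equiv.Perm (Fin 6)) (r : ℕ) : Free (Gr 6) :=
  Finsupp.single 0 ((List.ofFn fun j => xi 6 (s j)).take r).prod
    - (Complex.I * (-1) ^ (r * (r + 1) / 2) * (-1) ^ (3 - r)
        * ((Equiv.Perm.sign s : ℤ) : ℂ)) •
      Finsupp.single (3 - r) ((List.ofFn fun j => xi 6 (s j)).drop r).prod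

/-- `CK_6`, the `ℂ[∂]`-span of the elements `f - i (-1)^{r(r+1)/2} (-∂)^{3-r} f*`, `r ≤ 3`, of `K_6`. -/
def subCK6 : Submodule ℂ (Free (Gr 6)) :=
  Submodule.span ℂ {x | ∃ (s : Equiv.Perm (Fin 6)) (r k : ℕ), r ≤ 3 ∧
    x = (freeD (Gr 6) ^ k) (ckGen s r)}

/-- The Lie conformal superalgebra `R` is isomorphic to the subalgebra `U` of `M`. -/
def IsCopy (R : Type*) [AddCommGroup R] [Module ℂ R] [LieConformalSuperalgebra R]
    {M : Type*} [AddCommGroup M] [Module ℂ M] (c : ConfData M) (U : Submodule ℂ M) : Prop :=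
  ∃ ι : R →ₗ[ℂ] M, Function.Injective ι ∧ LinearMap.range ι = U ∧
    (∀ i, ∀ a ∈ part R i, ι a ∈ c.part i) ∧
    (∀ a, ι (del R a) = c.D (ι a)) ∧
    (∀ a b n, ι (lbr R a b n) = c.br (ι a) (ι b) n)

/-- `R` is one of `W_N` (`N ≥ 0`), `S_{N,a}` (`N ≥ 2`, `a ∈ ℂ`), `S̃_N` (`N ≥ 2` even),
`K_N` (`N ≥ 0`, `N ≠ 4`), `K_4'`, `CK_6`. -/
def IsListed (R : Type*) [AddCommGroup R] [Module ℂ R] [LieConformalSuperalgebra R] : Prop :=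
  (∃ N, IsCopy R (confW N) ⊤) ∨
  (∃ N, 2 ≤ N ∧ ∃ a : ℂ, IsCopy R (confW N) (subS N a)) ∨
  (∃ N, 2 ≤ N ∧ Even N ∧ IsCopy R (confW N) (subSt N)) ∨
  (∃ N, N ≠ 4 ∧ IsCopy R (confK N) ⊤) ∨
  IsCopy R (confK 4) subK4' ∨
  IsCopy R (confK 6) subCK6

end LieConf

end

universe u w

/-! Everything reduces to one statement on bilinear forms, `exists_primitive`. Let `R = R'`, let `L`
be even with `L_(0) = ∂ + N`, where `N` is locally finite, and let `V` be a complete Hausdorff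
linearly topologized space. A form `Φ` on `(Lie R)_-` with values in `V`, continuous in its second
variable and satisfying the cocycle identity with first argument `L_0`, is `Φ(x, y) = γ([x, y])` for
a continuous linear map `γ`.

The reason is the formula `[L_0, a_n] = -n a_{n-1} + (N a)_n`. If `N = 0`, the requirement `γ([L_0,
w]) = Φ(L_0, w)` forces `γ(a_n) = -Φ(L_0, a_{n+1}) / (n+1)`. In general the same recursion is solved
by an infinite series, which converges because the powers of `N` keep `a` in a finite-dimensional
space on which `Φ(L_0, a_n)` tends to `0` uniformly. The equation at `n = 0` is an obstruction, and
here `R = R'` enters: for a product `a_(j) b` the partial sums telescope, by the cocycle identity,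
to a remainder that tends to `0`. After `γ([x, y])` is subtracted, the form is invariant under `ad
L_0`. Its values `f_{m,n}` on modes satisfy `m f_{m-1,n} + n f_{m,n-1} = f_{m,n} ∘ (N ⊗ 1 + 1 ⊗ N)`
and tend to `0` with `n`, which forces them to vanish (`eq_zero_of_invariant`).

With `V = ℂ` discrete, and after extension by continuity to the completion, this gives `H² = 0`. For
universality, let `ρ : E → Q` be a central extension of the quotient `Q` of the annihilation algebra
by its center, and lift the projection to `Q` to a linear map `τ` into `E`, not necessarily
continuous. The form `[τ x, τ y]` depends only on the images in `Q`. It is separately continuous by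
the open mapping property of linearly compact spaces (`IsLinearlyCompact.continuous_of_comp`), and
`E` is complete, so the form has a primitive `f`, which turns out to be a homomorphism over `Q`.
Uniqueness holds because brackets span a dense subspace when `R = R'`.

A simple `R` equals `R'`, and the even part of an element with `L_(0) = ∂` has the same property.
For the listed algebras, `R = R'` is checked by hand and `L` is exhibited. For `W_N`, `K_N`, `K_4'`
it is `-1`, for `CK_6` it is `-1` plus a multiple of `∂³ ξ_1 ⋯ ξ_6`, and `N = 0`. For `S_{N,a}` and
`S̃_N` the chosen `L` gives `N = -a ad(ξ_i ∂_i)` and an operator of square zero respectively; they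
are the reason for allowing a non-zero `N`. -/

noncomputable section

namespace LieConf

open scoped Topology Uniformity

open Superalgebra

set_option linter.unusedSectionVars false

/-! ## Binomial sums and iterated differences -/

section Binomial

variable {M : Type*} [AddCommGroup M] [Module ℂ M]

/-- `∑_i (m choose i) X_i`. -/
def binomSum (m : ℕ) (X : ℕ → M) : M := ∑ i ∈ Finset.range (m + 1), (m.choose i : ℂ) • X i

theorem binomSum_zero (X : ℕ → M) : binomSum 0 X = X 0 := by simp [binomSum]

theorem binomSum_succ (m : ℕ) (X : ℕ → M) :
    binomSum (m + 1) X = binomSum m X + binomSum m fun i => X (i + 1) := by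
  unfold binomSum
  rw [Finset.sum_range_succ', Finset.sum_congr rfl fun i _ => by
    rw [Nat.choose_succ_succ, Nat.cast_add, add_smul], Finset.sum_add_distrib,
    Finset.sum_range_succ (fun i => ((m.choose (i + 1) : ℕ) : ℂ) • X (i + 1)),
    Finset.sum_range_succ' (fun i => ((m.choose i : ℕ) : ℂ) • X i)]
  simp [Nat.choose_succ_self]
  abel

/-- `binomSum m` is the value at `0` of the `m`-th power of `1 + shift`, so exponents add. This is
Vandermonde's identity in the form used for the Jacobi identity. -/
theorem binomSum_binomSum (m n : ℕ) (X : ℕ → M) :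
    (binomSum m fun p => binomSum n fun q => X (p + q)) = binomSum (m + n) X := by
  induction m generalizing X with
  | zero => simp [binomSum_zero]
  | succ m ih =>
    rw [binomSum_succ, ih, add_right_comm, binomSum_succ, ← ih fun i => X (i + 1)]
    simp only [add_right_comm]

theorem binomSum_congr {m : ℕ} {X Y : ℕ → M} (h : ∀ i ≤ m, X i = Y i) :
    binomSum m X = binomSum m Y :=
  Finset.sum_congr rfl fun i hi => by rw [h i (Nat.lt_succ_iff.1 (Finset.mem_range.1 hi))]

theorem map_binomSum {M' F : Type*} [AddCommGroup M'] [Module ℂ M'] [FunLike F M M']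
    [LinearMapClass F ℂ M M'] (f : F) (m : ℕ) (X : ℕ → M) :
    f (binomSum m X) = binomSum m fun i => f (X i) := by
  simp [binomSum]

theorem binomSum_apply {M' : Type*} [AddCommGroup M'] [Module ℂ M'] (m : ℕ)
    (X : ℕ → M' →ₗ[ℂ] M) (y : M') : binomSum m X y = binomSum m fun i => X i y := by
  simp [binomSum]

theorem binomSum_add (m : ℕ) (X Y : ℕ → M) :
    (binomSum m fun i => X i + Y i) = binomSum m X + binomSum m Y := by
  simp [binomSum, Finset.sum_add_distrib]

theorem binomSum_smul (m : ℕ) (c : ℂ) (X : ℕ → M) :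
    (binomSum m fun i => c • X i) = c • binomSum m X := by
  simp only [binomSum, Finset.smul_sum]
  exact Finset.sum_congr rfl fun i _ => smul_comm _ _ _

theorem binomSum_comm (m n : ℕ) (X : ℕ → ℕ → M) :
    (binomSum m fun i => binomSum n fun j => X i j) =
      binomSum n fun j => binomSum m fun i => X i j := by
  simp only [binomSum, Finset.smul_sum]
  rw [Finset.sum_comm]
  exact Finset.sum_congr rfl fun i _ => Finset.sum_congr rfl fun j _ => smul_comm _ _ _

/-- `(m choose p)(p choose j) = (m choose j)(m - j choose p - j)`, with `i = p - j` as new summation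
index. -/
theorem binomSum_trinomial (m : ℕ) (Y : ℕ → ℕ → M) :
    (binomSum m fun p => binomSum p fun j => Y j (p - j)) =
      binomSum m fun j => binomSum (m - j) fun i => Y j i := by
  simp only [binomSum, Finset.smul_sum, smul_smul]
  rw [Finset.sum_comm' (t' := Finset.range (m + 1)) (s' := fun j => Finset.Ico j (m + 1))
    (by intro x y; simp only [Finset.mem_range, Finset.mem_Ico]; omega)]
  refine Finset.sum_congr rfl fun j hj => ?_
  have hj' := Finset.mem_range.1 hj
  rw [Finset.sum_Ico_eq_sum_range, Nat.sub_add_comm (Nat.lt_succ_iff.1 hj')]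
  refine Finset.sum_congr rfl fun i hi => ?_
  have hi' := Finset.mem_range.1 hi
  have h := Nat.choose_mul (n := m) (k := j + i) (s := j) (by omega)
  rw [Nat.add_sub_cancel_left] at h ⊢
  rw [← Nat.cast_mul, ← Nat.cast_mul, h]

/-- The result at `(m, n)` of applying the `j`-th power of the difference of the two shifts. -/
def diffPow (f : ℕ → ℕ → M) : ℕ → ℕ → ℕ → M
  | 0, m, n => f m n
  | j + 1, m, n => diffPow f j (m + 1) n - diffPow f j m (n + 1)

/-- By Pascal's rule, one difference of a binomial sum raises the first index of `g` by one. At `m =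
0` a single term survives, which recovers the products of `R` from the brackets of modes. -/
theorem diffPow_binomSum (g : ℕ → ℕ → M) (j m n : ℕ) :
    diffPow (fun m n => binomSum m fun i => g i (m + n - i)) j m n =
      binomSum m fun i => g (i + j) (m + n - i) := by
  induction j generalizing m n with
  | zero => rfl
  | succ j ih =>
    simp only [diffPow]
    rw [ih, ih, binomSum_succ, sub_eq_iff_eq_add, add_comm]
    congr 1
    · refine binomSum_congr fun i _ => ?_
      rw [show m + 1 + n - (i + 1) = m + n - i by omega, add_right_comm, add_assoc]
    · refine binomSum_congr fun i _ => ?_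
      rw [show m + 1 + n - i = m + (n + 1) - i by omega]

/-- The differences of row `m` determine row `m + 1`, so all rows vanish with row `0`. Identities
between brackets of all modes are thereby reduced to `m = 0`, where they become identities between
products of `R`. -/
theorem eq_zero_of_diffPow (f : ℕ → ℕ → M) (h : ∀ j n, diffPow f j 0 n = 0) (m n : ℕ) :
    f m n = 0 := by
  have key : ∀ m j n, diffPow f j m n = 0 := by
    intro m
    induction m with
    | zero => exact h
    | succ m ih =>
      intro j n
      have := ih (j + 1) n
      simp only [diffPow] at this
      rw [sub_eq_zero.1 this, ih]
  exact key m 0 n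

theorem map_diffPow {M' : Type*} [AddCommGroup M'] [Module ℂ M'] (g : M →ₗ[ℂ] M')
    (f : ℕ → ℕ → M) (j m n : ℕ) :
    g (diffPow f j m n) = diffPow (fun m n => g (f m n)) j m n := by
  induction j generalizing m n with
  | zero => rfl
  | succ j ih => simp only [diffPow, map_sub, ih]

theorem diffPow_add (f g : ℕ → ℕ → M) (j m n : ℕ) :
    diffPow (fun m n => f m n + g m n) j m n = diffPow f j m n + diffPow g j m n := by
  induction j generalizing m n with
  | zero => rfl
  | succ j ih => simp only [diffPow, ih]; abel

theorem diffPow_sub (f g : ℕ → ℕ → M) (j m n : ℕ) :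
    diffPow (fun m n => f m n - g m n) j m n = diffPow f j m n - diffPow g j m n := by
  induction j generalizing m n with
  | zero => rfl
  | succ j ih => simp only [diffPow, ih]; abel

theorem diffPow_smul (c : ℂ) (f : ℕ → ℕ → M) (j m n : ℕ) :
    diffPow (fun m n => c • f m n) j m n = c • diffPow f j m n :=
  (map_diffPow (c • LinearMap.id : M →ₗ[ℂ] M) f j m n).symm

theorem diffPow_swap (f : ℕ → ℕ → M) (j m n : ℕ) :
    diffPow (fun m n => f n m) j m n = (-1 : ℂ) ^ j • diffPow f j n m := by
  induction j generalizing m n with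
  | zero => simp [diffPow]
  | succ j ih =>
    simp only [diffPow, ih, ← smul_sub, pow_succ, mul_smul, neg_smul, one_smul, neg_sub]

/-- The difference of the shifts commutes with the sum of the derivations. -/
theorem diffPow_deriv (f : ℕ → ℕ → M) (j m n : ℕ) :
    diffPow (fun m n => (m : ℂ) • f (m - 1) n + (n : ℂ) • f m (n - 1)) j m n =
      (m : ℂ) • diffPow f j (m - 1) n + (n : ℂ) • diffPow f j m (n - 1) := by
  induction j generalizing m n with
  | zero => rfl
  | succ j ih =>
    simp only [diffPow, ih, Nat.add_sub_cancel]
    -- At `m = 0` the truncated `m - 1 + 1` is `1`, but the coefficient is then zero.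
    have h1 : (m : ℂ) • diffPow f j (m - 1 + 1) n = (m : ℂ) • diffPow f j m n := by
      cases m <;> simp
    have h2 : (n : ℂ) • diffPow f j m (n - 1 + 1) = (n : ℂ) • diffPow f j m n := by
      cases n <;> simp
    rw [smul_sub, smul_sub, h1, h2]
    push_cast
    module

end Binomial

/-! ## The algebra `(Lie R)_-` -/

section Minus

variable {R : Type*} [AddCommGroup R] [Module ℂ R] [LieConformalSuperalgebra R] (S : Generators R)

theorem incl_injective : Function.Injective (incl S) := Subtype.val_injective

/-- Since `m ≥ 0`, the coefficients with `j > m` vanish; the sum stops at `m` and the natural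
subtraction `m + n - j` is never truncated. -/
theorem minusBr_mmode (m n : ℕ) (a b : R) : minusBr S (mmode S m a) (mmode S n b) =
    binomSum m fun j => mmode S (m + n - j) (lbr R a b j) := by
  apply incl_injective
  rw [map_binomSum]
  change lieBr R (mode R m a) (mode R n b) =
    binomSum m fun j => mode R ((m + n - j : ℕ) : ℤ) (lbr R a b j)
  rw [lieBr_mode, Finsupp.sum, binomSum]
  have h1 := Finset.sum_subset (Finset.subset_union_left (s₁ := (lbr R a b).support)
    (s₂ := Finset.range (m + 1)))
    (f := fun j => ((Ring.choose (m : ℤ) j : ℤ) : ℂ) • mode R (m + n - j) (lbr R a b j))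
    fun j _ hj => by rw [Finsupp.notMem_support_iff.1 hj]; simp
  have h2 := Finset.sum_subset (Finset.subset_union_right (s₁ := (lbr R a b).support)
    (s₂ := Finset.range (m + 1)))
    (f := fun j => ((Ring.choose (m : ℤ) j : ℤ) : ℂ) • mode R (m + n - j) (lbr R a b j))
    fun j _ hj => by
      rw [Ring.choose_natCast, Nat.choose_eq_zero_of_lt (by simpa using hj)]; simp
  rw [h1, ← h2]
  refine Finset.sum_congr rfl fun j hj => ?_
  have hj' := Finset.mem_range.1 hj
  rw [Ring.choose_natCast, show ((m + n - j : ℕ) : ℤ) = m + n - j by omega]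
  simp

theorem mmode_del (n : ℕ) (a : R) : mmode S n (del R a) = -((n : ℂ) • mmode S (n - 1) a) := by
  apply incl_injective
  change mode R n (del R a) = -((n : ℂ) • mode R ((n - 1 : ℕ) : ℤ) a)
  rw [mode_del]
  cases n <;> simp

theorem mmode_del_pow (n i : ℕ) (a : R) : mmode S n ((del R ^ i) a) =
    ((-1 : ℂ) ^ i * (n.descFactorial i : ℂ)) • mmode S (n - i) a := by
  induction i with
  | zero => simp
  | succ i ih =>
    clear ih
    induction i generalizing n a with
    | zero => simp [mmode_del]
    | succ i ih =>
      rw [pow_succ', Module.End.mul_apply, mmode_del, ih]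
      cases n with
      | zero => simp
      | succ n =>
        rw [Nat.succ_descFactorial_succ n, smul_smul, ← neg_smul, Nat.add_sub_cancel]
        congr 1
        · push_cast; ring
        · rw [Nat.add_sub_add_right]

theorem span_mmode : Submodule.span ℂ {x | ∃ (n : ℕ) (a : R), x = mmode S n a} = ⊤ := by
  rw [eq_top_iff, ← filt_zero S]
  exact Submodule.span_mono fun x ⟨j, n, _, h⟩ => ⟨n, S.gen j, h⟩

/-- No clause for scalars is needed, because `c • a_n = (c • a)_n` is again a mode. -/
theorem minus_induction {p : Minus S → Prop} (x : Minus S) (h0 : ∀ n a, p (mmode S n a))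
    (hadd : ∀ x y, p x → p y → p (x + y)) : p x := by
  have hx : x ∈ Submodule.span ℂ {x | ∃ (n : ℕ) (a : R), x = mmode S n a} := by
    rw [span_mmode]; trivial
  induction hx using Submodule.closure_induction with
  | zero => simpa using h0 0 0
  | add x y _ _ hx hy => exact hadd x y hx hy
  | smul_mem c x hx =>
    obtain ⟨n, a, rfl⟩ := hx
    rw [← map_smul]
    exact h0 n _

variable (R) in
theorem exists_parts (a : R) : ∃ a₀ ∈ part R 0, ∃ a₁ ∈ part R 1, a₀ + a₁ = a :=
  Submodule.mem_sup.1 <| by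
    rw [(LieConformalSuperalgebra.isCompl_part (R := R)).sup_eq_top]; trivial

theorem minus_induction_part {p : Minus S → Prop} (x : Minus S)
    (h0 : ∀ n i, ∀ a ∈ part R i, p (mmode S n a))
    (hadd : ∀ x y, p x → p y → p (x + y)) : p x := by
  refine minus_induction S x (fun n a => ?_) hadd
  obtain ⟨a₀, h₀, a₁, h₁, rfl⟩ := exists_parts R a
  rw [map_add]
  exact hadd _ _ (h0 n 0 a₀ h₀) (h0 n 1 a₁ h₁)

/-- The axiom sums over the support; a fixed range, reindexed from `n`, can be compared with a
binomial sum term by term. -/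
theorem lbr_skew_range (i j : ZMod 2) (a : R) (ha : a ∈ part R i) (b : R) (hb : b ∈ part R j)
    (n K : ℕ) (hK : ∀ k, K ≤ k → lbr R a b k = 0) :
    lbr R b a n = -(sgn i j • ∑ k ∈ Finset.range K,
      ((-1 : ℂ) ^ (n + k) / (k.factorial : ℂ)) • (del R ^ k) (lbr R a b (n + k))) := by
  rw [LieConformalSuperalgebra.skew i j a ha b hb n]
  congr 2
  have h1 := Finset.sum_subset (s₁ := (lbr R a b).support) (s₂ := Finset.range (n + K))
    (f := fun k => if n ≤ k then ((-1 : ℂ) ^ k / ((k - n).factorial : ℂ)) •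
      (del R ^ (k - n)) (lbr R a b k) else 0) (fun k hk => by
        rw [Finset.mem_range]
        by_contra h
        exact Finsupp.mem_support_iff.1 hk (hK k (by omega)))
    fun k _ hk => by
      rw [Finsupp.notMem_support_iff.1 hk]; simp
  refine h1.trans ?_
  rw [Finset.sum_range_add, Finset.sum_eq_zero fun k hk => ?_, zero_add]
  · exact Finset.sum_congr rfl fun k _ => by simp
  · have := Finset.mem_range.1 hk
    rw [if_neg (by omega)]

theorem exists_lbr_eq_zero (a b : R) : ∃ K, ∀ k, K ≤ k → lbr R a b k = 0 := by
  refine ⟨(lbr R a b).support.sup id + 1, fun k hk => ?_⟩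
  by_contra h
  have := Finset.le_sup (f := id) (Finsupp.mem_support_iff.2 h)
  simp only [id] at this
  omega

/-- By `eq_zero_of_diffPow` only the iterated differences at `m = 0` matter. There the claim is the
skew-commutativity of `R`: the formula for `(∂^k c)_n` turns its correction terms into the binomial
sum of the opposite bracket. -/
theorem minusBr_skew (i j : ZMod 2) (a : R) (ha : a ∈ part R i) (b : R) (hb : b ∈ part R j)
    (m n : ℕ) : minusBr S (mmode S m a) (mmode S n b) =
      -(sgn i j • minusBr S (mmode S n b) (mmode S m a)) := by
  rw [← add_eq_zero_iff_eq_neg]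
  refine eq_zero_of_diffPow (fun m n => minusBr S (mmode S m a) (mmode S n b) +
    sgn i j • minusBr S (mmode S n b) (mmode S m a)) (fun p n => ?_) m n
  rw [diffPow_add, diffPow_smul, diffPow_swap fun m n => minusBr S (mmode S m b) (mmode S n a)]
  simp only [minusBr_mmode]
  rw [diffPow_binomSum fun i n => mmode S n (lbr R a b i),
    diffPow_binomSum fun i n => mmode S n (lbr R b a i), binomSum_zero]
  obtain ⟨K, hK⟩ := exists_lbr_eq_zero b a
  have hs : sgn j i = sgn i j := by simp only [sgn, and_comm]
  simp only [zero_add, add_zero, Nat.sub_zero]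
  -- The cut-off `n + 1 + K` serves two purposes: it exceeds `K`, beyond which the products vanish,
  -- and its first `n + 1` terms are the binomial sum. The other terms are zero because `(∂^k c)_n =
  -- 0` for `k > n`.
  rw [lbr_skew_range j i b hb a ha p (n + 1 + K) fun k hk => hK k (by omega), map_neg, map_smul,
    map_sum, hs, neg_add_eq_zero, Finset.sum_range_add, Finset.sum_eq_zero (s := Finset.range K),
    add_zero, binomSum]
  · congr 1
    rw [Finset.smul_sum]
    refine Finset.sum_congr rfl fun k _ => ?_
    rw [map_smul, mmode_del_pow, smul_smul, smul_smul, add_comm p k]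
    congr 1
    rw [Nat.descFactorial_eq_factorial_mul_choose, pow_add]
    have h := Nat.cast_ne_zero (R := ℂ).2 k.factorial_ne_zero
    have h2 : ((-1 : ℂ) ^ k) * (-1) ^ k = 1 := by rw [← mul_pow]; simp
    push_cast
    field_simp
    linear_combination (n.choose k : ℂ) * h2
  · intro k _
    rw [map_smul, mmode_del_pow, Nat.descFactorial_of_lt (by omega)]
    simp

/-- Expand all double brackets into products and apply the Jacobi identity of `R`. In the terms
`(a_(l) b)_(q+r) c`, trinomial revision splits the coefficient as `(m choose l)(m - l choose r)`,
and Vandermonde combines `(m - l choose r)` with `(n choose q)` into the coefficients of the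
iterated bracket on the other side. -/
theorem minusBr_jacobi (i j : ZMod 2) (a : R) (ha : a ∈ part R i) (b : R) (hb : b ∈ part R j)
    (c : R) (m n k : ℕ) :
    minusBr S (mmode S m a) (minusBr S (mmode S n b) (mmode S k c)) =
      minusBr S (minusBr S (mmode S m a) (mmode S n b)) (mmode S k c) +
        sgn i j • minusBr S (mmode S n b) (minusBr S (mmode S m a) (mmode S k c)) := by
  have h : ∀ p q, lbr R a (lbr R b c q) p =
      (binomSum p fun l => lbr R (lbr R a b l) c (q + (p - l))) +
        sgn i j • lbr R b (lbr R a c p) q := by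
    intro p q
    rw [LieConformalSuperalgebra.jacobi i j a ha b hb c p q, binomSum]
    congr 1
    refine Finset.sum_congr rfl fun l hl => ?_
    have := Finset.mem_range.1 hl
    rw [show p + q - l = q + (p - l) by omega]
  rw [minusBr_mmode S n k, map_binomSum, minusBr_mmode S m n, map_binomSum, minusBr_mmode S m k,
    map_binomSum]
  have h1 : ∀ q, minusBr S (mmode S m a) (mmode S (n + k - q) (lbr R b c q)) =
      (binomSum m fun l => binomSum (m - l) fun r =>
        mmode S (m + (n + k - q) - (l + r)) (lbr R (lbr R a b l) c (q + r))) +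
      sgn i j • binomSum m fun p => mmode S (m + (n + k - q) - p) (lbr R b (lbr R a c p) q) := by
    intro q
    rw [minusBr_mmode, ← binomSum_trinomial m fun l r =>
      mmode S (m + (n + k - q) - (l + r)) (lbr R (lbr R a b l) c (q + r)), ← binomSum_smul,
      ← binomSum_add]
    refine binomSum_congr fun p _ => ?_
    rw [h, map_add, map_smul, map_binomSum]
    congr 1
    refine binomSum_congr fun l hl => ?_
    rw [Nat.add_sub_cancel' hl]
  simp only [h1]
  rw [binomSum_add, binomSum_smul, binomSum_comm n m, binomSum_comm n m]
  congr 1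
  · rw [binomSum_apply]
    refine binomSum_congr fun l hl => ?_
    rw [minusBr_mmode, show m + n - l = n + (m - l) by omega,
      ← binomSum_binomSum n (m - l)]
    refine binomSum_congr fun q hq => binomSum_congr fun r hr => ?_
    congr 2
    omega
  · congr 1
    refine binomSum_congr fun p hp => ?_
    rw [minusBr_mmode]
    refine binomSum_congr fun q hq => ?_
    congr 2
    omega

/-- `(a_(j) b)_n` as a combination of brackets. -/
theorem mmode_lbr (a b : R) (j n : ℕ) : mmode S n (lbr R a b j) =
    diffPow (fun m n => minusBr S (mmode S m a) (mmode S n b)) j 0 n := by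
  simp only [minusBr_mmode]
  rw [diffPow_binomSum fun i n => mmode S n (lbr R a b i), binomSum_zero]
  simp

theorem minusBr_mmode_zero (L a : R) (n : ℕ) :
    minusBr S (mmode S 0 L) (mmode S n a) = mmode S n (lbr R L a 0) := by
  rw [minusBr_mmode, binomSum_zero]; simp

theorem minusBr_jacobi_zero (L : R) (hL : L ∈ part R 0) (x y : Minus S) :
    minusBr S (mmode S 0 L) (minusBr S x y) =
      minusBr S (minusBr S (mmode S 0 L) x) y + minusBr S x (minusBr S (mmode S 0 L) y) := by
  induction x using minus_induction_part with
  | hadd x x' h h' => simp only [map_add, LinearMap.add_apply, h, h']; abel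
  | h0 n i a ha =>
    induction y using minus_induction with
    | hadd y y' h h' => simp only [map_add, h, h']; abel
    | h0 k c =>
      rw [minusBr_jacobi S 0 i L hL a ha]
      simp [sgn]

theorem del_lbr (a b : R) (n : ℕ) :
    del R (lbr R a b n) = lbr R (del R a) b n + lbr R a (del R b) n := by
  cases n with
  | zero =>
    rw [LieConformalSuperalgebra.br_D_left_zero, LieConformalSuperalgebra.br_D_right_zero, zero_add]
  | succ n =>
    rw [LieConformalSuperalgebra.br_D_left_succ, LieConformalSuperalgebra.br_D_right_succ]
    abel

theorem lbr_zero_lbr {L : R} (hL : L ∈ part R 0) (a b : R) (n : ℕ) :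
    lbr R L (lbr R a b n) 0 = lbr R (lbr R L a 0) b n + lbr R a (lbr R L b 0) n := by
  have h : ∀ i, ∀ a ∈ part R i,
      lbr R L (lbr R a b n) 0 = lbr R (lbr R L a 0) b n + lbr R a (lbr R L b 0) n := by
    intro i a ha
    have := LieConformalSuperalgebra.jacobi 0 i L hL a ha b 0 n
    simpa [sgn] using this
  obtain ⟨a₀, h₀, a₁, h₁, rfl⟩ := exists_parts R a
  simp only [map_add, LinearMap.add_apply, Finsupp.add_apply, h 0 a₀ h₀, h 1 a₁ h₁]
  abel

/-! ## Linear maps out of `(Lie R)_-` -/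

variable {V : Type*} [AddCommGroup V] [Module ℂ V]

/-- Negative modes are sent to `0`. This respects the relation `(∂a)_n = -n a_{n-1}`, since at `n =
0` its right-hand side has coefficient zero; hence the separate condition on `G 0`. -/
theorem range_affD_le_ker (G : ℕ → R →ₗ[ℂ] V) (h0 : ∀ a, G 0 (del R a) = 0)
    (hG : ∀ n a, G (n + 1) (del R a) = -((n + 1 : ℂ) • G n a)) :
    LinearMap.range (affD R) ≤
      LinearMap.ker (Finsupp.lsum ℂ fun n : ℤ => if 0 ≤ n then G n.toNat else 0) := by
  rintro _ ⟨x, rfl⟩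
  rw [LinearMap.mem_ker]
  induction x using Finsupp.induction_linear with
  | zero => simp
  | add f g hf hg => rw [map_add, map_add, hf, hg, add_zero]
  | single n a =>
    rw [affD_single, map_add, map_smul, Finsupp.lsum_single, Finsupp.lsum_single]
    rcases lt_trichotomy n 0 with h | rfl | h
    · rw [if_neg (by omega), if_neg (by omega)]; simp
    · simp [h0]
    · obtain ⟨k, rfl⟩ : ∃ k : ℕ, n = k + 1 := ⟨(n - 1).toNat, by omega⟩
      rw [if_pos (by omega), if_pos (by omega), show ((k : ℤ) + 1).toNat = k + 1 by omega, hG]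
      simp

/-- The linear map sending `a_n` to `G n a`. -/
def minusLift (G : ℕ → R →ₗ[ℂ] V) (h0 : ∀ a, G 0 (del R a) = 0)
    (hG : ∀ n a, G (n + 1) (del R a) = -((n + 1 : ℂ) • G n a)) : Minus S →ₗ[ℂ] V :=
  (LinearMap.range (affD R)).liftQ _ (range_affD_le_ker G h0 hG) ∘ₗ incl S

theorem minusLift_mmode (G : ℕ → R →ₗ[ℂ] V) (h0 : ∀ a, G 0 (del R a) = 0)
    (hG : ∀ n a, G (n + 1) (del R a) = -((n + 1 : ℂ) • G n a)) (n : ℕ) (a : R) :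
    minusLift S G h0 hG (mmode S n a) = G n a := by
  change (LinearMap.range (affD R)).liftQ _ (range_affD_le_ker G h0 hG)
    ((LinearMap.range (affD R)).mkQ (Finsupp.single (n : ℤ) a)) = _
  simp

end Minus

/-! ## Linear topologies -/

section LinearTopology

open Filter

variable {V : Type*} [AddCommGroup V] [Module ℂ V] [TopologicalSpace V] [IsTopologicalAddGroup V]
  [IsLinearTopology ℂ V]

theorem continuous_of_comap_open {W : Type*} [AddCommGroup W] [Module ℂ W] [TopologicalSpace W]
    [IsTopologicalAddGroup W] (f : W →ₗ[ℂ] V)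
    (h : ∀ U : Submodule ℂ V, IsOpen (U : Set V) → (U.comap f : Set W) ∈ 𝓝 0) : Continuous f := by
  refine continuous_of_continuousAt_zero f ?_
  rw [ContinuousAt, map_zero]
  exact ((IsLinearTopology.hasBasis_open_submodule ℂ).tendsto_right_iff).2 fun U hU => h U hU

theorem linearTopology_continuousConstSMul : ContinuousConstSMul ℂ V where
  continuous_const_smul c :=
    continuous_of_comap_open (c • LinearMap.id : V →ₗ[ℂ] V) fun U hU =>
      mem_of_superset (hU.mem_nhds U.zero_mem) fun x hx => by
        change c • x ∈ U
        exact U.smul_mem c hx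

theorem linearTopology_nonarchimedean : NonarchimedeanAddGroup V where
  is_nonarchimedean U hU := by
    obtain ⟨N, hN, h⟩ := (IsLinearTopology.hasBasis_open_submodule ℂ).mem_iff.1 hU
    exact ⟨⟨N.toAddSubgroup, hN⟩, h⟩

theorem eq_zero_of_forall_mem [T2Space V] (x : V)
    (h : ∀ U : Submodule ℂ V, IsOpen (U : Set V) → x ∈ U) : x = 0 := by
  by_contra hx
  obtain ⟨U, hU, h'⟩ := (IsLinearTopology.hasBasis_open_submodule ℂ).mem_iff.1
    (isOpen_compl_singleton.mem_nhds (show (0 : V) ∈ ({x}ᶜ : Set V) from fun h => hx h.symm))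
  exact h' (h U hU) rfl

/-- Convergence on finitely many generators is enough, because each condition `F n w ∈ U` is linear
in `w`. -/
theorem uniform_on_fg {M : Type*} [AddCommGroup M] [Module ℂ M] (F : ℕ → M →ₗ[ℂ] V)
    (hF : ∀ x, Tendsto (fun n => F n x) atTop (𝓝 0)) {W : Submodule ℂ M} (hW : W.FG)
    {U : Submodule ℂ V} (hU : IsOpen (U : Set V)) : ∃ n₀, ∀ n ≥ n₀, ∀ w ∈ W, F n w ∈ U := by
  obtain ⟨s, rfl⟩ := hW
  have h : ∀ᶠ n in atTop, ∀ w ∈ s, F n w ∈ U :=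
    (eventually_all_finset s).2 fun w _ => hF w (hU.mem_nhds U.zero_mem)
  obtain ⟨n₀, h₀⟩ := eventually_atTop.1 h
  exact ⟨n₀, fun n hn w hw => (Submodule.span_le (p := U.comap (F n))).2 (h₀ n hn) hw⟩

end LinearTopology

/-! ## Locally finite operators -/

section LocFin

variable {M : Type*} [AddCommGroup M] [Module ℂ M]

/-- Every vector lies in a finite-dimensional stable subspace. -/
def IsLocFin (T : M →ₗ[ℂ] M) : Prop :=
  ∀ x, ∃ W : Submodule ℂ M, W.FG ∧ x ∈ W ∧ ∀ w ∈ W, T w ∈ W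

/-- The span of `x`, `T x`, `T² x` is stable. The criterion covers every `N` that occurs: zero,
operators of square zero, and `-a ad(ξ_i ∂_i)`. -/
theorem isLocFin_of_pow_three (T : M →ₗ[ℂ] M) (c : ℂ) (h : ∀ x, T (T (T x)) = c • T x) :
    IsLocFin T := fun x => by
  refine ⟨Submodule.span ℂ {x, T x, T (T x)}, Submodule.fg_span (Set.toFinite _),
    Submodule.subset_span (by simp), fun w hw => ?_⟩
  refine (Submodule.span_le (p := (Submodule.span ℂ {x, T x, T (T x)}).comap T)).2 ?_ hw
  rintro y (rfl | rfl | rfl)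
  · exact Submodule.subset_span (by simp)
  · exact Submodule.subset_span (by simp)
  · change T (T (T x)) ∈ Submodule.span ℂ {x, T x, T (T x)}
    rw [h]
    exact Submodule.smul_mem _ _ (Submodule.subset_span (by simp))

open scoped TensorProduct in
/-- `T ⊗ 1 + 1 ⊗ T`. -/
def leibniz (T : M →ₗ[ℂ] M) : M ⊗[ℂ] M →ₗ[ℂ] M ⊗[ℂ] M := T.rTensor M + T.lTensor M

open scoped TensorProduct in
theorem leibniz_tmul (T : M →ₗ[ℂ] M) (a b : M) :
    leibniz T (a ⊗ₜ b) = T a ⊗ₜ b + a ⊗ₜ T b := by simp [leibniz]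

theorem IsLocFin.leibniz {T : M →ₗ[ℂ] M} (hT : IsLocFin T) : IsLocFin (leibniz T) := fun x => by
  induction x using TensorProduct.induction_on with
  | zero => exact ⟨⊥, Submodule.fg_bot, zero_mem _, by simp⟩
  | add x y hx hy =>
    obtain ⟨W, h1, h2, h3⟩ := hx
    obtain ⟨W', k1, k2, k3⟩ := hy
    refine ⟨W ⊔ W', h1.sup k1, Submodule.add_mem_sup h2 k2, fun w hw => ?_⟩
    obtain ⟨u, hu, v, hv, rfl⟩ := Submodule.mem_sup.1 hw
    rw [map_add]
    exact Submodule.add_mem_sup (h3 u hu) (k3 v hv)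
  | tmul a b =>
    obtain ⟨W, h1, h2, h3⟩ := hT a
    obtain ⟨W', k1, k2, k3⟩ := hT b
    refine ⟨Submodule.map₂ (TensorProduct.mk ℂ M M) W W', h1.map₂ _ k1,
      Submodule.apply_mem_map₂ _ h2 k2, fun w hw => ?_⟩
    refine (Submodule.map₂_le (p := W) (q := W')
      (r := (Submodule.map₂ (TensorProduct.mk ℂ M M) W W').comap (LieConf.leibniz T))).2
      (fun u hu v hv => ?_) hw
    rw [Submodule.mem_comap, TensorProduct.mk_apply, leibniz_tmul]
    exact add_mem (Submodule.apply_mem_map₂ (TensorProduct.mk ℂ M M) (h3 u hu) hv)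
      (Submodule.apply_mem_map₂ (TensorProduct.mk ℂ M M) hu (k3 v hv))

open Filter in
-- Induction on `m`: once row `m - 1` vanishes, the relation is `n f_{m,n-1} = f_{m,n} ∘ T`. On a
-- finite-dimensional `T`-stable space the values lie in a given open subspace for large `n`, and
-- the relation transports this down to every `n`. Open subspaces intersect in `0`.
theorem eq_zero_of_invariant {V : Type*} [AddCommGroup V] [Module ℂ V] [TopologicalSpace V]
    [IsTopologicalAddGroup V] [IsLinearTopology ℂ V] [T2Space V]
    {T : M →ₗ[ℂ] M} (hT : IsLocFin T) (f : ℕ → ℕ → M →ₗ[ℂ] V)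
    (hf : ∀ (m n : ℕ) x, (m : ℂ) • f (m - 1) n x + (n : ℂ) • f m (n - 1) x = f m n (T x))
    (hlim : ∀ m x, Tendsto (fun n => f m n x) atTop (𝓝 0)) (m n : ℕ) (x : M) : f m n x = 0 := by
  have step : ∀ m : ℕ, (∀ n x, (m : ℂ) • f (m - 1) n x = 0) → ∀ n x, f m n x = 0 := by
    intro m hm n x
    refine eq_zero_of_forall_mem _ fun U hU => ?_
    obtain ⟨W, hW, hx, hTW⟩ := hT x
    obtain ⟨n₀, h₀⟩ := uniform_on_fg (f m) (hlim m) hW hU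
    -- Descent from `n₀`: dividing by `n + 1` replaces `w` by `T w`, which stays in `W`.
    have key : ∀ k n, n₀ ≤ n + k → ∀ w ∈ W, f m n w ∈ U := by
      intro k
      induction k with
      | zero => exact fun n hn w hw => h₀ n hn w hw
      | succ k ih =>
        intro n hn w hw
        have h := hf m (n + 1) w
        rw [hm, zero_add, Nat.add_sub_cancel] at h
        have hn0 : ((n + 1 : ℕ) : ℂ) ≠ 0 := Nat.cast_ne_zero.2 n.succ_ne_zero
        rw [← inv_smul_smul₀ hn0 (f m n w), h]
        exact U.smul_mem _ (ih (n + 1) (by omega) _ (hTW w hw))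
    exact key n₀ n (by omega) x hx
  induction m generalizing n x with
  | zero => exact step 0 (by simp) n x
  | succ m ih => exact step (m + 1) (by simp [ih]) n x

end LocFin

/-! ## Primitives of invariant forms on `(Lie R)_-` -/

section Primitive

open Filter
open scoped TensorProduct

variable {R : Type*} [AddCommGroup R] [Module ℂ R] [LieConformalSuperalgebra R] (S : Generators R)

theorem tendsto_mmode (a : R) : Tendsto (fun n => mmode S n a) atTop (𝓝 0) := by
  refine (nhds_zero_hasBasis S).tendsto_right_iff.2 fun m _ => ?_
  obtain ⟨d, hd⟩ := mmode_mem S a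
  filter_upwards [eventually_ge_atTop (m + d)] with n hn
  exact filt_anti S (by omega) (hd n)

theorem continuous_minusBr (x : Minus S) : Continuous fun y => minusBr S x y :=
  (uniformContinuous_minusBr S).continuous.comp (Continuous.prodMk_right x)

/-- There are finitely many generators, so one `m` works for all of them and `ℒ_m` is mapped into
the given open subspace. -/
theorem continuous_minusLift {V : Type*} [AddCommGroup V] [Module ℂ V] [TopologicalSpace V]
    [IsTopologicalAddGroup V] [IsLinearTopology ℂ V] (γ : Minus S →ₗ[ℂ] V)
    (h : ∀ a, Tendsto (fun n => γ (mmode S n a)) atTop (𝓝 0)) : Continuous γ := by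
  refine continuous_of_comap_open γ fun U hU => ?_
  have h' : ∀ᶠ n in atTop, ∀ j, γ (mmode S n (S.gen j)) ∈ U :=
    eventually_all.2 fun j => h _ (hU.mem_nhds U.zero_mem)
  obtain ⟨m, hm⟩ := eventually_atTop.1 h'
  refine mem_of_superset ((nhds_zero_hasBasis S).mem_of_mem (i := m) trivial) ?_
  refine Submodule.span_le.2 ?_
  rintro _ ⟨j, n, hn, rfl⟩
  exact hm n hn j

variable {V : Type*} [AddCommGroup V] [Module ℂ V]

/-- The form `a ⊗ b ↦ Φ(a_m, b_n)`. -/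
def modeForm (Φ : Minus S →ₗ[ℂ] Minus S →ₗ[ℂ] V) (m n : ℕ) : R ⊗[ℂ] R →ₗ[ℂ] V :=
  TensorProduct.lift (Φ.compl₁₂ (mmode S m) (mmode S n))

theorem modeForm_tmul (Φ : Minus S →ₗ[ℂ] Minus S →ₗ[ℂ] V) (m n : ℕ) (a b : R) :
    modeForm S Φ m n (a ⊗ₜ b) = Φ (mmode S m a) (mmode S n b) := by simp [modeForm]

variable (R) in
/-- The `j`-th product as a map on the tensor square. -/
def prodMap (j : ℕ) : R ⊗[ℂ] R →ₗ[ℂ] R :=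
  TensorProduct.lift ((lbr R).compr₂ (Finsupp.lapply j))

theorem prodMap_tmul (j : ℕ) (a b : R) : prodMap R j (a ⊗ₜ b) = lbr R a b j := by
  simp [prodMap]

theorem diffPow_apply {M : Type*} [AddCommGroup M] [Module ℂ M] (f : ℕ → ℕ → M →ₗ[ℂ] V)
    (j m n : ℕ) (x : M) : diffPow f j m n x = diffPow (fun m n => f m n x) j m n :=
  map_diffPow (LinearMap.applyₗ x) f j m n

theorem tendsto_modeForm [TopologicalSpace V] [IsTopologicalAddGroup V]
    {Φ : Minus S →ₗ[ℂ] Minus S →ₗ[ℂ] V} (hΦ : ∀ x, Continuous (Φ x)) (m : ℕ) (x : R ⊗[ℂ] R) :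
    Tendsto (fun n => modeForm S Φ m n x) atTop (𝓝 0) := by
  induction x using TensorProduct.induction_on with
  | zero => simpa using tendsto_const_nhds
  | add x y hx hy => simpa using hx.add hy
  | tmul a b =>
    simp only [modeForm_tmul]
    simpa [Function.comp_def] using ((hΦ (mmode S m a)).tendsto 0).comp (tendsto_mmode S b)

theorem tendsto_diffPow [TopologicalSpace V] [IsTopologicalAddGroup V] {f : ℕ → ℕ → V}
    (hf : ∀ m, Tendsto (f m) atTop (𝓝 0)) (j m : ℕ) : Tendsto (diffPow f j m) atTop (𝓝 0) := by
  induction j generalizing m with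
  | zero => exact hf m
  | succ j ih =>
    have h := (ih (m + 1)).sub ((ih m).comp (tendsto_add_atTop_nat 1))
    rw [sub_zero] at h
    exact h

/-- The behaviour of a form under the derivation `ad L_0`. -/
theorem modeForm_deriv (Φ : Minus S →ₗ[ℂ] Minus S →ₗ[ℂ] V) {L : R} {N : R →ₗ[ℂ] R}
    (hN : ∀ a, lbr R L a 0 = del R a + N a) (m n : ℕ) (a b : R) :
    Φ (minusBr S (mmode S 0 L) (mmode S m a)) (mmode S n b) +
      Φ (mmode S m a) (minusBr S (mmode S 0 L) (mmode S n b)) =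
    modeForm S Φ m n (leibniz N (a ⊗ₜ b)) - ((m : ℂ) • modeForm S Φ (m - 1) n (a ⊗ₜ b) +
      (n : ℂ) • modeForm S Φ m (n - 1) (a ⊗ₜ b)) := by
  simp only [minusBr_mmode_zero, hN, map_add, mmode_del, leibniz_tmul, modeForm_tmul,
    LinearMap.add_apply, map_neg, map_smul, LinearMap.neg_apply, LinearMap.smul_apply]
  abel

/-- Write `B_n(a) = Φ(L_0, a_n)` and look for `γ` with `γ((N a)_n) - n γ(a_{n-1}) = B_n(a)`.
Substituting `γ(a_n) = -n! H_{n+1}(a)` gives `H_n(a) = B_n(a)/n! + H_{n+1}(N a)`, whose solution is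
the series `H_n(a) = ∑_i B_{n+i}(N^i a)/(n+i)!`. The condition `H_0 = 0` is what both the equation
at `n = 0` and the relation `(∂a)_0 = 0` require. -/
theorem exists_primitive [UniformSpace V] [IsUniformAddGroup V] [IsLinearTopology ℂ V]
    [CompleteSpace V] [T2Space V] {L : R} (hL : L ∈ part R 0) {N : R →ₗ[ℂ] R}
    (hN : ∀ a, lbr R L a 0 = del R a + N a) (hlf : IsLocFin N) (hder : derived R = ⊤)
    (Φ : Minus S →ₗ[ℂ] Minus S →ₗ[ℂ] V) (hc : ∀ x, Continuous (Φ x))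
    (hΦ : ∀ y z, Φ (mmode S 0 L) (minusBr S y z) =
      Φ (minusBr S (mmode S 0 L) y) z + Φ y (minusBr S (mmode S 0 L) z)) :
    ∃ γ : Minus S →ₗ[ℂ] V, Continuous γ ∧ ∀ x y, Φ x y = γ (minusBr S x y) := by
  have := linearTopology_nonarchimedean (V := V)
  have := linearTopology_continuousConstSMul (V := V)
  -- `N` commutes with `∂` and is a derivation of all products.
  have hNd : ∀ a, N (del R a) = del R (N a) := by
    intro a
    have h := LieConformalSuperalgebra.br_D_right_zero L a
    rw [hN, hN, map_add] at h
    exact add_left_cancel h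
  have hNl : ∀ j x, N (prodMap R j x) = prodMap R j (leibniz N x) := by
    intro j x
    induction x using TensorProduct.induction_on with
    | zero => simp
    | add x y hx hy => simp only [map_add, hx, hy]
    | tmul a b =>
      have h := lbr_zero_lbr hL a b j
      simp only [hN, map_add, LinearMap.add_apply, Finsupp.add_apply, del_lbr] at h
      simp only [leibniz_tmul, map_add, prodMap_tmul]
      exact add_left_cancel (h.trans (by abel))
  -- The functional `Φ(L_0, ·)`.
  set B : ℕ → R →ₗ[ℂ] V := fun n => Φ (mmode S 0 L) ∘ₗ mmode S n with hB
  have hBd : ∀ n a, B n (del R a) = -((n : ℂ) • B (n - 1) a) := by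
    intro n a; simp [hB, mmode_del]
  -- The combination of values of `Φ` in which the brackets of modes would add up to `(a_(j) b)_n`,
  -- as in `mmode_lbr`.
  set Ψ : ℕ → ℕ → R ⊗[ℂ] R →ₗ[ℂ] V := fun j n => diffPow (modeForm S Φ) j 0 n with hΨ
  -- This is the cocycle identity after `j` differences. They commute with the derivation of the
  -- modes by `diffPow_deriv`, and at `m = 0` the term with coefficient `m` drops out.
  have hBΨ : ∀ j n x, B n (prodMap R j x) = Ψ j n (leibniz N x) - (n : ℂ) • Ψ j (n - 1) x := by
    intro j n x
    induction x using TensorProduct.induction_on with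
    | zero => simp
    | add x y hx hy => simp only [map_add, hx, hy, smul_add]; abel
    | tmul a b =>
      simp only [hB, LinearMap.comp_apply, prodMap_tmul, mmode_lbr, map_diffPow, hΦ,
        modeForm_deriv S Φ hN]
      rw [diffPow_sub, diffPow_deriv fun m n => modeForm S Φ m n (a ⊗ₜ b)]
      simp [hΨ, diffPow_apply]
  -- The sum `∑ B_i(N^i a) / i!` vanishes.
  have hsum : ∀ j x I, ∑ i ∈ Finset.range (I + 1),
      ((i.factorial : ℂ)⁻¹) • B i ((N ^ i) (prodMap R j x)) =
        ((I.factorial : ℂ)⁻¹) • Ψ j I ((leibniz N ^ (I + 1)) x) := by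
    intro j x I
    have hpow : ∀ i, (N ^ i) (prodMap R j x) = prodMap R j ((leibniz N ^ i) x) := by
      intro i
      induction i with
      | zero => rfl
      | succ i ih => rw [pow_succ', pow_succ', Module.End.mul_apply, ih, hNl]; rfl
    -- The second term of `hBΨ` at `I + 1`, divided by `(I + 1)!`, cancels the remainder of step
    -- `I`: the sum telescopes.
    induction I with
    | zero => simp [hBΨ]
    | succ I ih =>
      rw [Finset.sum_range_succ, ih, hpow, hBΨ, pow_succ' _ (I + 1), Module.End.mul_apply,
        Nat.add_sub_cancel, smul_sub, smul_smul, Nat.factorial_succ]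
      have h1 : ((I + 1 : ℕ) : ℂ) ≠ 0 := Nat.cast_ne_zero.2 I.succ_ne_zero
      have h2 : (((I + 1) * I.factorial : ℕ) : ℂ)⁻¹ * ((I + 1 : ℕ) : ℂ) =
          (I.factorial : ℂ)⁻¹ := by
        push_cast at h1 ⊢
        field_simp
      rw [h2]
      abel
  -- By `R = R'` it is enough to treat products, where the telescoped remainder tends to `0`: the
  -- powers of `leibniz N` stay in a finite-dimensional space, on which `Ψ j I` becomes uniformly
  -- small. The factors `1 / I!` do no harm, as open subspaces absorb scalars.
  have hlim : ∀ a, Tendsto (fun I => ∑ i ∈ Finset.range I,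
      ((i.factorial : ℂ)⁻¹) • B i ((N ^ i) a)) atTop (𝓝 0) := by
    intro a
    have ha : a ∈ derived R := by rw [hder]; trivial
    induction ha using Submodule.span_induction with
    | zero => simp
    | add a b _ _ ha hb => simpa [Finset.sum_add_distrib] using ha.add hb
    | smul c a _ ha =>
      have := ha.const_smul c
      simpa [Finset.smul_sum, smul_comm c] using this
    | mem a ha =>
      obtain ⟨a, b, j, rfl⟩ := ha
      rw [← prodMap_tmul, ← tendsto_add_atTop_iff_nat 1]
      simp only [hsum]
      refine IsLinearTopology.tendsto_smul_zero ℂ (fun I : ℕ => ((I.factorial : ℂ)⁻¹)) _ ?_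
      refine (IsLinearTopology.hasBasis_open_submodule ℂ).tendsto_right_iff.2 fun U hU => ?_
      obtain ⟨W, hW, hx, hTW⟩ := hlf.leibniz (a ⊗ₜ[ℂ] b)
      obtain ⟨n₀, h₀⟩ := uniform_on_fg (Ψ j) (fun x => by
        simp only [hΨ, diffPow_apply]
        exact tendsto_diffPow (fun m => tendsto_modeForm S hc m x) j 0) hW hU
      filter_upwards [eventually_ge_atTop n₀] with n hn
      refine h₀ n hn _ ?_
      have : ∀ i, (leibniz N ^ i) (a ⊗ₜ[ℂ] b) ∈ W := by
        intro i
        induction i with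
        | zero => exact hx
        | succ i ih => rw [pow_succ']; exact hTW _ ih
      exact this _
  set b : ℕ → R →ₗ[ℂ] V := fun n => ((n.factorial : ℂ)⁻¹) • B n with hb
  have hb0 : ∀ a, Tendsto (fun n => b n a) atTop (𝓝 0) := by
    intro a
    refine IsLinearTopology.tendsto_smul_zero ℂ (fun I : ℕ => ((I.factorial : ℂ)⁻¹)) _ ?_
    simpa [hB, Function.comp_def] using ((hc (mmode S 0 L)).tendsto 0).comp (tendsto_mmode S a)
  have hbd : ∀ n a, b (n + 1) (del R a) = -b n a := by
    intro n a
    simp only [hb, LinearMap.smul_apply, hBd, Nat.add_sub_cancel, smul_neg, smul_smul]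
    have h1 : ((n + 1 : ℕ) : ℂ) ≠ 0 := Nat.cast_ne_zero.2 n.succ_ne_zero
    rw [Nat.factorial_succ]
    congr 2
    push_cast at h1 ⊢
    field_simp
  have hpowmem : ∀ (W : Submodule ℂ R), (∀ w ∈ W, N w ∈ W) → ∀ a ∈ W, ∀ i, (N ^ i) a ∈ W := by
    intro W hW a ha i
    induction i with
    | zero => exact ha
    | succ i ih => rw [pow_succ']; exact hW _ ih
  -- In a complete nonarchimedean group it suffices that the terms tend to `0`.
  have hs : ∀ n a, Summable fun i => b (n + i) ((N ^ i) a) := by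
    intro n a
    refine NonarchimedeanAddGroup.summable_of_tendsto_cofinite_zero ?_
    rw [Nat.cofinite_eq_atTop]
    refine (IsLinearTopology.hasBasis_open_submodule ℂ).tendsto_right_iff.2 fun U hU => ?_
    obtain ⟨W, hW, hx, hTW⟩ := hlf a
    obtain ⟨n₀, h₀⟩ := uniform_on_fg b hb0 hW hU
    filter_upwards [eventually_ge_atTop n₀] with i hi
    exact h₀ _ (by omega) _ (hpowmem W hTW a hx i)
  set H : ℕ → R →ₗ[ℂ] V := fun n =>
    { toFun := fun a => ∑' i, b (n + i) ((N ^ i) a)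
      map_add' := fun a a' => by
        simp only [map_add]
        exact (hs n a).tsum_add (hs n a')
      map_smul' := fun c a => by
        simp only [map_smul, RingHom.id_apply]
        exact (hs n a).tsum_const_smul c } with hH
  have hHdef : ∀ n a, H n a = ∑' i, b (n + i) ((N ^ i) a) := fun _ _ => rfl
  -- The partial sums are those of `hlim`; the obstruction at `n = 0` is gone.
  have hH0 : ∀ a, H 0 a = 0 := by
    intro a
    refine tendsto_nhds_unique (hs 0 a).hasSum.tendsto_sum_nat ?_
    simpa [hb] using hlim a
  have hHs : ∀ n a, H n a = b n a + H (n + 1) (N a) := by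
    intro n a
    rw [hHdef, (hs n a).tsum_eq_zero_add, hHdef]
    simp only [pow_zero, Module.End.one_apply, add_zero, pow_succ, Module.End.mul_apply]
    congr 2
    ext i
    rw [add_right_comm, add_assoc]
  have hHd : ∀ n a, H (n + 1) (del R a) = -H n a := by
    intro n a
    have hcomm : ∀ i a, (N ^ i) (del R a) = del R ((N ^ i) a) := by
      intro i a
      induction i with
      | zero => rfl
      | succ i ih => rw [pow_succ', Module.End.mul_apply, ih, hNd]; rfl
    rw [hHdef, hHdef, ← tsum_neg]
    congr 1
    ext i
    rw [hcomm, add_right_comm, hbd]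
  have hHlim : ∀ a, Tendsto (fun n => H n a) atTop (𝓝 0) := by
    intro a
    refine (IsLinearTopology.hasBasis_open_submodule ℂ).tendsto_right_iff.2 fun U hU => ?_
    obtain ⟨W, hW, hx, hTW⟩ := hlf a
    obtain ⟨n₀, h₀⟩ := uniform_on_fg b hb0 hW hU
    filter_upwards [eventually_ge_atTop n₀] with n hn
    have hcl : IsClosed (U : Set V) := U.toAddSubgroup.isClosed_of_isOpen hU
    exact hcl.mem_of_tendsto (hs n a).hasSum.tendsto_sum_nat <| Eventually.of_forall fun I =>
      U.sum_mem fun i _ => h₀ _ (by omega) _ (hpowmem W hTW a hx i)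
  -- The primitive.
  set γ : Minus S →ₗ[ℂ] V := minusLift S (fun n => -((n.factorial : ℂ) • H (n + 1)))
    (fun a => by simp [hHd, hH0]) (fun n a => by
      simp only [LinearMap.neg_apply, LinearMap.smul_apply, hHd, Nat.factorial_succ]
      push_cast
      module) with hγ
  have hγm : ∀ n a, γ (mmode S n a) = -((n.factorial : ℂ) • H (n + 1) a) := fun n a =>
    minusLift_mmode S _ _ _ n a
  have hγc : Continuous γ := by
    refine continuous_minusLift S γ fun a => ?_
    simp only [hγm, ← neg_smul]
    exact IsLinearTopology.tendsto_smul_zero ℂ (fun I : ℕ => -(I.factorial : ℂ)) _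
      ((tendsto_add_atTop_iff_nat 1).2 (hHlim a))
  -- Here `γ((∂a)_n) = n! H_n(a)` also for `n = 0`, so no separate treatment of that mode is needed.
  have hγB : ∀ w, γ (minusBr S (mmode S 0 L) w) = Φ (mmode S 0 L) w := by
    intro w
    induction w using minus_induction with
    | hadd x y hx hy => simp only [map_add, hx, hy]
    | h0 n a =>
      rw [minusBr_mmode_zero, hN, map_add, map_add, hγm, hγm, hHd]
      have hf : ((n.factorial : ℂ)) ≠ 0 := Nat.cast_ne_zero.2 n.factorial_ne_zero
      have h1 : Φ (mmode S 0 L) (mmode S n a) = (n.factorial : ℂ) • b n a := by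
        simp only [hb, hB, LinearMap.smul_apply, LinearMap.comp_apply]
        rw [smul_inv_smul₀ hf]
      rw [h1, hHs n a]
      module
  refine ⟨γ, hγc, ?_⟩
  set Φ' : Minus S →ₗ[ℂ] Minus S →ₗ[ℂ] V := Φ - (minusBr S).compr₂ γ with hΦ'
  have hΦa : ∀ x y, Φ' x y = Φ x y - γ (minusBr S x y) := fun x y => rfl
  -- `Φ'` vanishes when its first argument is `L_0`, so the cocycle identity turns into invariance
  -- under `ad L_0`.
  have hinv : ∀ y z, Φ' (minusBr S (mmode S 0 L) y) z + Φ' y (minusBr S (mmode S 0 L) z) = 0 := by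
    intro y z
    have h1 := hΦ y z
    have h2 := hγB (minusBr S y z)
    rw [minusBr_jacobi_zero S L hL, map_add] at h2
    rw [hΦa, hΦa, sub_add_sub_comm, ← h1, h2, sub_self]
  have hc' : ∀ x, Continuous (Φ' x) := fun x =>
    (hc x).sub (hγc.comp (continuous_minusBr S x))
  have hzero := eq_zero_of_invariant hlf.leibniz (modeForm S Φ') (fun m n x => by
    induction x using TensorProduct.induction_on with
    | zero => simp
    | add x y hx hy => simp only [map_add, ← hx, ← hy, smul_add]; abel
    | tmul a b =>
      have := modeForm_deriv S Φ' hN m n a b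
      rw [hinv] at this
      exact (sub_eq_zero.1 this.symm).symm) fun m x => tendsto_modeForm S hc' m x
  intro x y
  rw [← sub_eq_zero, ← hΦa]
  induction x using minus_induction with
  | hadd x x' hx hx' => rw [map_add, LinearMap.add_apply, hx, hx', add_zero]
  | h0 m a =>
    induction y using minus_induction with
    | hadd x x' hx hx' => rw [map_add, hx, hx', add_zero]
    | h0 n b => rw [← modeForm_tmul, hzero]

end Primitive

/-! ## Linear compactness -/

section LinearlyCompact

open Filter

variable {V : Type*} [AddCommGroup V] [Module ℂ V] [TopologicalSpace V]

/-- The affine subspace `f⁻¹(w)`. -/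
def levelSet {W : Type*} [AddCommGroup W] [Module ℂ W] (f : V →ₗ[ℂ] W) (w : W) :
    AffineSubspace ℂ V where
  carrier := {v | f v = w}
  smul_vsub_vadd_mem' c p q r hp hq hr := by
    change f (c • (p - q) + r) = w
    have hp' : f p = w := hp
    have hq' : f q = w := hq
    have hr' : f r = w := hr
    simp [hp', hq', hr']

theorem mem_levelSet {W : Type*} [AddCommGroup W] [Module ℂ W] (f : V →ₗ[ℂ] W) (w : W) (v : V) :
    v ∈ levelSet f w ↔ f v = w := Iff.rfl

theorem isOpen_levelSet [IsTopologicalAddGroup V] {W : Type*} [AddCommGroup W] [Module ℂ W]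
    (f : V →ₗ[ℂ] W) {N : Submodule ℂ V} (hN : IsOpen (N : Set V)) (hf : N ≤ LinearMap.ker f)
    (s : Set W) : IsOpen (f ⁻¹' s) := by
  refine isOpen_iff_mem_nhds.2 fun v hv => ?_
  have h : {u | u - v ∈ N} ∈ 𝓝 v :=
    (hN.preimage (continuous_id.sub continuous_const)).mem_nhds (by simp)
  refine mem_of_superset h fun u hu => ?_
  have : f u = f v := sub_eq_zero.1 ((map_sub f u v).symm.trans (hf hu))
  simpa [this] using hv

theorem isClosed_levelSet [IsTopologicalAddGroup V] {W : Type*} [AddCommGroup W] [Module ℂ W]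
    (f : V →ₗ[ℂ] W) {N : Submodule ℂ V} (hN : IsOpen (N : Set V)) (hf : N ≤ LinearMap.ker f)
    (w : W) : IsClosed (levelSet f w : Set V) :=
  ⟨isOpen_levelSet f hN hf {w}ᶜ⟩

theorem isClosed_submodule_of_isOpen [IsTopologicalAddGroup V] {N : Submodule ℂ V}
    (hN : IsOpen (N : Set V)) : IsClosed (N : Set V) :=
  N.toAddSubgroup.isClosed_of_isOpen hN

theorem IsLinearlyCompact.exists_mem (h : IsLinearlyCompact V) {ι : Type*}
    (F : ι → AffineSubspace ℂ V) (hc : ∀ i, IsClosed (F i : Set V))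
    (hF : ∀ s : Finset ι, ∃ x, ∀ i ∈ s, x ∈ F i) : ∃ x, ∀ i, x ∈ F i := by
  classical
  obtain ⟨x, hx⟩ := h.inter (Set.range F) (by rintro _ ⟨i, rfl⟩; exact hc i) fun G hG => by
    obtain ⟨s, -, rfl⟩ := Finset.subset_set_image_iff.1
      (show (G : Set (AffineSubspace ℂ V)) ⊆ F '' Set.univ by rwa [Set.image_univ])
    obtain ⟨x, hx⟩ := hF s
    exact ⟨x, by simpa using hx⟩
  exact ⟨x, fun i => Set.mem_iInter₂.1 hx (F i) ⟨i, rfl⟩⟩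

/-- The conditions "the `i`-th coordinate modulo `N` is `1`" can be satisfied finitely many at a
time, hence all at once. A vector has finitely many non-zero coordinates, so the basis is finite. -/
theorem IsLinearlyCompact.finite_quotient (h : IsLinearlyCompact V) {N : Submodule ℂ V}
    (hN : IsOpen (N : Set V)) : Module.Finite ℂ (V ⧸ N) := by
  have := h.addGroup
  let b := Module.Basis.ofVectorSpace ℂ (V ⧸ N)
  obtain ⟨x, hx⟩ := h.exists_mem (fun i => levelSet (b.coord i ∘ₗ N.mkQ) 1)
    (fun i => isClosed_levelSet _ hN (fun v hv => by
      have : N.mkQ v = 0 := (Submodule.Quotient.mk_eq_zero N).2 hv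
      rw [LinearMap.mem_ker, LinearMap.comp_apply, this, map_zero]) 1) fun s => by
    obtain ⟨v, hv⟩ := N.mkQ_surjective (∑ i ∈ s, b i)
    refine ⟨v, fun i hi => ?_⟩
    rw [mem_levelSet, LinearMap.comp_apply, hv, map_sum]
    classical
    simp [Finsupp.single_apply, hi]
  have hfin : Finite (Module.Basis.ofVectorSpaceIndex ℂ (V ⧸ N)) := by
    refine Set.finite_coe_iff.2 ((Set.toFinite ((b.repr (N.mkQ x)).support.map
      ⟨Subtype.val, Subtype.val_injective⟩ : Set (V ⧸ N))).subset fun i hi => ?_)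
    have h1 : b.repr (N.mkQ x) ⟨i, hi⟩ = 1 := hx ⟨i, hi⟩
    simp only [Finset.coe_map, Function.Embedding.coeFn_mk, Set.mem_image, SetLike.mem_coe]
    exact ⟨⟨i, hi⟩, Finsupp.mem_support_iff.2 (by rw [h1]; exact one_ne_zero), rfl⟩
  exact Module.Finite.of_basis b

/-- A downward directed family of closed subspaces whose intersection lies in an open subspace
has a member that lies in this subspace. -/
theorem IsLinearlyCompact.exists_le (h : IsLinearlyCompact V) {ι : Type*} [Nonempty ι]
    (C : ι → Submodule ℂ V) (hc : ∀ i, IsClosed (C i : Set V)) (hd : Directed (· ≥ ·) C)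
    {N : Submodule ℂ V} (hN : IsOpen (N : Set V)) (hCN : ⨅ i, C i ≤ N) : ∃ i, C i ≤ N := by
  have := h.addGroup
  have := h.finite_quotient hN
  -- With the smallest image in the finite-dimensional quotient, no smaller member of the family
  -- loses any class modulo `N`.
  obtain ⟨i, hi⟩ : ∃ i, ∀ j, Module.finrank ℂ ((C i).map N.mkQ) ≤
      Module.finrank ℂ ((C j).map N.mkQ) :=
    ⟨_, fun j => Function.argmin_le (fun j => Module.finrank ℂ ((C j).map N.mkQ)) j⟩
  refine ⟨i, fun v hv => ?_⟩
  -- The index `none` prescribes the class of `v` modulo `N`, the others membership in each `C j`. A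
  -- common solution lies in the intersection, hence in `N`, and so does `v`.
  obtain ⟨x, hx⟩ := h.exists_mem
    (fun j : Option ι => j.elim (levelSet N.mkQ (N.mkQ v)) fun j => (C j).toAffineSubspace)
    (by
      rintro (_ | j)
      · exact isClosed_levelSet _ hN (by simp) _
      · exact hc j) fun s => by
    classical
    obtain ⟨k, hk⟩ := hd.finset_le (insert i (Finset.eraseNone s))
    have heq := Submodule.eq_of_le_of_finrank_le
      (Submodule.map_mono (f := N.mkQ) (hk i (Finset.mem_insert_self _ _))) (hi k)
    have hv' := Submodule.mem_map_of_mem (f := N.mkQ) hv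
    rw [← heq] at hv'
    obtain ⟨c, hc, hcv⟩ := hv'
    refine ⟨c, ?_⟩
    rintro (_ | j) hj
    · exact hcv
    · exact hk j (Finset.mem_insert_of_mem (Finset.mem_eraseNone.2 hj)) hc
  have hxN : x ∈ N := hCN ((Submodule.mem_iInf _).2 fun j => hx (some j))
  have hxv : N.mkQ x = N.mkQ v := hx none
  rw [Submodule.mkQ_apply, Submodule.mkQ_apply, Submodule.Quotient.eq] at hxv
  simpa using N.sub_mem hxN hxv

/-- A Cauchy filter contains a coset of every open subspace. A point common to all closed affine
subspaces in the filter lies in each of these cosets and is therefore a limit. -/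
theorem IsLinearlyCompact.completeSpace [IsTopologicalAddGroup V] (h : IsLinearlyCompact V) :
    @CompleteSpace V (IsTopologicalAddGroup.rightUniformSpace V) := by
  have := h.linear
  let _ : UniformSpace V := IsTopologicalAddGroup.rightUniformSpace V
  have _ : IsUniformAddGroup V := isUniformAddGroup_of_addCommGroup
  refine ⟨fun {f} hf => ?_⟩
  have hne : f.NeBot := hf.1
  obtain ⟨x, hx⟩ := h.exists_mem
    (fun s : {s : AffineSubspace ℂ V // IsClosed (s : Set V) ∧ (s : Set V) ∈ f} => s.1)
    (fun s => s.2.1) fun G => by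
      have := (biInter_finset_mem (f := f) (s := fun i : {s : AffineSubspace ℂ V //
        IsClosed (s : Set V) ∧ (s : Set V) ∈ f} => (i.1 : Set V)) G).2 fun i _ => i.2.2
      obtain ⟨x, hx⟩ := hne.nonempty_of_mem this
      exact ⟨x, fun i hi => Set.mem_iInter₂.1 hx i hi⟩
  refine ⟨x, fun t ht => ?_⟩
  have ht' : (fun y => y + x) ⁻¹' t ∈ 𝓝 (0 : V) :=
    (continuous_id.add continuous_const).continuousAt (by simpa using ht)
  obtain ⟨U, hU, hUt⟩ := (IsLinearTopology.hasBasis_open_submodule ℂ).mem_iff.1 ht'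
  have hU2 : {p : V × V | p.2 - p.1 ∈ U} ∈ uniformity V := by
    rw [uniformity_eq_comap_nhds_zero]
    exact preimage_mem_comap (hU.mem_nhds U.zero_mem)
  obtain ⟨s, hs, hss⟩ := (cauchy_iff.1 hf).2 _ hU2
  obtain ⟨y, hy⟩ := hne.nonempty_of_mem hs
  have hmk : ∀ z, U.mkQ z = U.mkQ y ↔ z - y ∈ U := fun z => Submodule.Quotient.eq U
  have hsub : s ⊆ (levelSet U.mkQ (U.mkQ y) : Set V) := fun z hz =>
    (hmk z).2 (hss (Set.mk_mem_prod hy hz))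
  have hmem : (levelSet U.mkQ (U.mkQ y) : Set V) ∈ f := mem_of_superset hs hsub
  have hxy : x - y ∈ U := (hmk x).1 (hx ⟨_, isClosed_levelSet U.mkQ hU (by simp) _, hmem⟩)
  refine mem_of_superset hmem fun z hz => ?_
  have hzy : z - y ∈ U := (hmk z).1 hz
  have : z - x ∈ U := by simpa using U.sub_mem hzy hxy
  simpa using hUt this

theorem IsLinearlyCompact.quotient (h : IsLinearlyCompact V) {Z : Submodule ℂ V}
    (hZ : IsClosed (Z : Set V)) : IsLinearlyCompact (V ⧸ Z) := by
  have := h.addGroup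
  have := h.linear
  have := h.t2
  refine ⟨inferInstance, inferInstance, ?_, fun F hF hne => ?_⟩
  · refine IsLinearTopology.mk_of_hasBasis (R := ℂ) (S := Submodule ℂ (V ⧸ Z))
      (p := fun N : Submodule ℂ V => IsOpen (N : Set V)) (s := fun N => N.map Z.mkQ) ?_
    have h0 := (IsLinearTopology.hasBasis_open_submodule (M := V) ℂ).map Z.mkQ
    rw [(Submodule.isOpenQuotientMap_mkQ Z).map_nhds_eq, map_zero] at h0
    exact h0
  · obtain ⟨x, hx⟩ := h.exists_mem (fun s : F => s.1.comap Z.mkQ.toAffineMap)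
      (fun s => (hF s.1 s.2).preimage (Submodule.isOpenQuotientMap_mkQ Z).continuous) fun G => by
        classical
        obtain ⟨y, hy⟩ := hne (G.map ⟨Subtype.val, Subtype.val_injective⟩) (by simp)
        obtain ⟨x, rfl⟩ := Z.mkQ_surjective y
        refine ⟨x, fun i hi => ?_⟩
        exact Set.mem_iInter₂.1 hy i.1 (Finset.mem_map_of_mem _ hi)
    exact ⟨Z.mkQ x, Set.mem_iInter₂.2 fun s hs => hx ⟨s, hs⟩⟩

/-- A continuous linear map on the source of a surjection of linearly compact spaces that kills
the kernel factors through a continuous map. -/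
theorem IsLinearlyCompact.continuous_of_comp (h : IsLinearlyCompact V)
    {Q W : Type*} [AddCommGroup Q] [Module ℂ Q] [TopologicalSpace Q] (hQ : IsLinearlyCompact Q)
    [AddCommGroup W] [Module ℂ W] [TopologicalSpace W] [IsTopologicalAddGroup W]
    [IsLinearTopology ℂ W] (ρ : V →ₗ[ℂ] Q) (hρ : Continuous ρ) (hs : Function.Surjective ρ)
    (f : Q →ₗ[ℂ] W) (hf : Continuous fun v => f (ρ v)) : Continuous f := by
  have := hQ.addGroup
  have := hQ.linear
  have := hQ.t2
  refine continuous_of_comap_open f fun U hU => ?_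
  have : Nonempty {P : Submodule ℂ Q // IsOpen (P : Set Q)} := ⟨⟨⊤, isOpen_univ⟩⟩
  -- The preimages of the open subspaces of `Q` are directed and meet in the kernel of `ρ`, which
  -- lies in the open preimage of `U`; hence one of them already does.
  obtain ⟨P, hP⟩ := h.exists_le (ι := {P : Submodule ℂ Q // IsOpen (P : Set Q)})
    (fun P => P.1.comap ρ) (fun P => (isClosed_submodule_of_isOpen P.2).preimage hρ)
    (fun P P' => ⟨⟨P.1 ⊓ P'.1, P.2.inter P'.2⟩, Submodule.comap_mono inf_le_left,
      Submodule.comap_mono inf_le_right⟩)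
    (N := (U.comap f).comap ρ) (hU.preimage hf) (fun v hv => by
      have : ρ v = 0 := eq_zero_of_forall_mem _ fun P hP => by
        rw [Submodule.mem_iInf] at hv
        exact hv ⟨P, hP⟩
      simp [this])
  refine mem_of_superset (P.2.mem_nhds P.1.zero_mem) fun q hq => ?_
  obtain ⟨v, rfl⟩ := hs q
  exact hP hq

end LinearlyCompact

/-! ### A criterion for linear compactness -/

section Complete

open Filter

variable {V : Type*} [AddCommGroup V] [Module ℂ V] [UniformSpace V] [IsUniformAddGroup V]
  [CompleteSpace V] [T2Space V]

/-- A maximal family of closed affine subspaces with the finite intersection property contains a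
coset of every `U m`, by finite codimension. Representatives of these cosets form a Cauchy sequence,
and its limit is in the closure of every member of the family. -/
theorem isLinearlyCompact_of_complete (U : ℕ → Submodule ℂ V) (hU : ∀ m, IsOpen (U m : Set V))
    (hanti : Antitone U) (hb : (𝓝 (0 : V)).HasBasis (fun _ => True) fun m => (U m : Set V))
    (hfin : ∀ m, Module.Finite ℂ (V ⧸ U m)) : IsLinearlyCompact V := by
  have hlin : IsLinearTopology ℂ V := IsLinearTopology.mk_of_hasBasis ℂ hb
  refine ⟨inferInstance, inferInstance, hlin, fun F hF hne => ?_⟩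
  classical
  -- Extend to a maximal family with the finite intersection property.
  obtain ⟨M, hFM, hM⟩ := zorn_subset_nonempty
    {M : Set (AffineSubspace ℂ V) | (∀ s ∈ M, IsClosed (s : Set V)) ∧
      ∀ G : Finset (AffineSubspace ℂ V), (G : Set (AffineSubspace ℂ V)) ⊆ M →
        ∃ x, ∀ s ∈ G, x ∈ s} (fun c hc hch hcne => by
      refine ⟨⋃₀ c, ⟨fun s ⟨M, hM, hs⟩ => (hc hM).1 s hs, fun G hG => ?_⟩,
        fun s hs => Set.subset_sUnion_of_mem hs⟩
      rw [Set.sUnion_eq_biUnion] at hG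
      obtain ⟨M, hM, hGM⟩ := DirectedOn.exists_mem_subset_of_finset_subset_biUnion hcne
        (f := fun i => i) hch.directedOn hG
      exact (hc hM).2 G hGM) F ⟨hF, fun G hG => by
        obtain ⟨x, hx⟩ := hne G hG
        exact ⟨x, fun s hs => Set.mem_iInter₂.1 hx s hs⟩⟩
  have hcoset : ∀ m, ∃ x, levelSet (U m).mkQ ((U m).mkQ x) ∈ M := by
    intro m
    have := hfin m
    let d : Finset (AffineSubspace ℂ V) → ℕ := fun G =>
      Module.finrank ℂ ((sInf (G : Set (AffineSubspace ℂ V))).direction.map (U m).mkQ)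
    -- The direction of the intersection of `G₀` has the smallest image modulo `U m`, so further
    -- members do not shrink it. Every finite subfamily of `M` thus meets the coset of a point `v`
    -- of that intersection, and maximality puts this coset into `M`.
    obtain ⟨G₀, hG₀, hmin⟩ : ∃ G₀ : Finset (AffineSubspace ℂ V),
        (G₀ : Set (AffineSubspace ℂ V)) ⊆ M ∧
        ∀ G : Finset (AffineSubspace ℂ V), (G : Set (AffineSubspace ℂ V)) ⊆ M → d G₀ ≤ d G := by
      have hn : {k | ∃ G : Finset (AffineSubspace ℂ V),
        (G : Set (AffineSubspace ℂ V)) ⊆ M ∧ d G = k}.Nonempty := ⟨_, ∅, by simp, rfl⟩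
      obtain ⟨G₀, h1, h2⟩ := Nat.sInf_mem hn
      exact ⟨G₀, h1, fun G hG => h2 ▸ Nat.sInf_le ⟨G, hG, rfl⟩⟩
    obtain ⟨v, hv⟩ := hM.prop.2 G₀ hG₀
    refine ⟨v, ?_⟩
    have hmax := hM.eq_of_subset (t := insert (levelSet (U m).mkQ ((U m).mkQ v)) M)
      ⟨?_, fun G hG => ?_⟩ (Set.subset_insert _ _)
    · rw [hmax]; exact Set.mem_insert _ _
    · rintro s (rfl | hs)
      · exact isClosed_levelSet _ (hU m) (by simp) _
      · exact hM.prop.1 s hs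
    · let G' := G.erase (levelSet (U m).mkQ ((U m).mkQ v)) ∪ G₀
      have hG' : (G' : Set (AffineSubspace ℂ V)) ⊆ M := by
        intro s hs
        rcases Finset.mem_union.1 (Finset.mem_coe.1 hs) with h | h
        · exact (hG (Finset.mem_of_mem_erase h)).resolve_left (Finset.ne_of_mem_erase h)
        · exact hG₀ h
      obtain ⟨w, hw⟩ := hM.prop.2 G' hG'
      have hle : sInf (G' : Set (AffineSubspace ℂ V)) ≤ sInf (G₀ : Set (AffineSubspace ℂ V)) :=
        sInf_le_sInf (by intro s hs; exact Finset.mem_union_right _ hs)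
      have heq := Submodule.eq_of_le_of_finrank_le
        (Submodule.map_mono (f := (U m).mkQ) (AffineSubspace.direction_le hle)) (hmin G' hG')
      have hw' : w ∈ sInf (G' : Set (AffineSubspace ℂ V)) :=
        (AffineSubspace.mem_sInf_iff _ _).2 hw
      have hv' : v ∈ sInf (G₀ : Set (AffineSubspace ℂ V)) :=
        (AffineSubspace.mem_sInf_iff _ _).2 hv
      have hvw := Submodule.mem_map_of_mem (f := (U m).mkQ)
        (AffineSubspace.vsub_mem_direction hv' (hle hw'))
      rw [← heq] at hvw
      obtain ⟨z, hz, hzv⟩ := hvw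
      have hzw := AffineSubspace.vadd_mem_of_mem_direction hz hw'
      refine ⟨z +ᵥ w, fun s hs => ?_⟩
      by_cases h : s = levelSet (U m).mkQ ((U m).mkQ v)
      · rw [h, mem_levelSet, vadd_eq_add, map_add, hzv, vsub_eq_sub, map_sub, sub_add_cancel]
      · exact (AffineSubspace.mem_sInf_iff _ _).1 hzw s
          (Finset.mem_union_left _ (Finset.mem_erase.2 ⟨h, hs⟩))
  choose x hx using hcoset
  have hmeet : ∀ s ∈ M, ∀ m, ∃ y ∈ s, y - x m ∈ U m := by
    intro s hs m
    obtain ⟨y, hy⟩ := hM.prop.2 {s, levelSet (U m).mkQ ((U m).mkQ (x m))} (by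
      intro t ht
      rcases Finset.mem_insert.1 (Finset.mem_coe.1 ht) with rfl | ht
      · exact hs
      · rw [Finset.mem_singleton.1 ht]; exact hx m)
    exact ⟨y, hy s (by simp), (Submodule.Quotient.eq (U m)).1 (hy _
      (Finset.mem_insert_of_mem (Finset.mem_singleton_self _)))⟩
  have hxx : ∀ m n, m ≤ n → x n - x m ∈ U m := by
    intro m n hmn
    obtain ⟨y, hy, hym⟩ := hmeet _ (hx n) m
    have : y - x n ∈ U m := hanti hmn ((Submodule.Quotient.eq (U n)).1 hy)
    simpa using (U m).sub_mem hym this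
  have hub : (uniformity V).HasBasis (fun _ : ℕ => True)
      fun m => {p : V × V | p.2 - p.1 ∈ U m} := by
    rw [uniformity_eq_comap_nhds_zero]
    exact hb.comap _
  have hcau : CauchySeq x := by
    refine hub.cauchySeq_iff.2 fun m _ => ⟨m, fun i hi j hj => ?_⟩
    simpa using (U m).sub_mem (hxx m j hj) (hxx m i hi)
  obtain ⟨a, ha⟩ := cauchySeq_tendsto_of_complete hcau
  refine ⟨a, Set.mem_iInter₂.2 fun s hs => ?_⟩
  have ha' : ∀ m, a - x m ∈ U m := by
    intro m
    have h1 : Tendsto (fun n => x n - x m) atTop (𝓝 (a - x m)) := ha.sub tendsto_const_nhds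
    refine (isClosed_submodule_of_isOpen (hU m)).mem_of_tendsto h1 ?_
    filter_upwards [eventually_ge_atTop m] with n hn
    exact hxx m n hn
  rw [← (hF s hs).closure_eq]
  refine mem_closure_iff_nhds.2 fun t ht => ?_
  have ht' : (fun y => y + a) ⁻¹' t ∈ 𝓝 (0 : V) :=
    (continuous_id.add continuous_const).continuousAt (by simpa using ht)
  obtain ⟨m, -, hm⟩ := hb.mem_iff.1 ht'
  obtain ⟨y, hy, hym⟩ := hmeet s (hFM hs) m
  refine ⟨y, ?_, hy⟩
  have : y - a ∈ U m := by simpa using (U m).sub_mem hym (ha' m)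
  simpa using hm this

end Complete

/-! ## The annihilation algebra as a linearly compact Lie superalgebra -/

section Ann

open Filter

variable {R : Type*} [AddCommGroup R] [Module ℂ R] [LieConformalSuperalgebra R] (S : Generators R)

/-- The canonical map of `(Lie R)_-` to its completion. -/
def toAnn : Minus S →ₗ[ℂ] Ann S where
  toFun x := (x : Ann S)
  map_add' := UniformSpace.Completion.coe_add
  map_smul' := UniformSpace.Completion.coe_smul

theorem continuous_toAnn : Continuous (toAnn S) := UniformSpace.Completion.continuous_coe _

theorem denseRange_toAnn : DenseRange (toAnn S) := UniformSpace.Completion.denseRange_coe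

theorem annBr_toAnn (x y : Minus S) :
    annBr S (toAnn S x) (toAnn S y) = toAnn S (minusBr S x y) := annMap_coe S x y

theorem continuous_annBr : Continuous fun p : Ann S × Ann S => annBr S p.1 p.2 :=
  continuous_annMap S continuous_fst continuous_snd

theorem continuous_annBr_left (y : Ann S) : Continuous ((annBr S).flip y) :=
  continuous_annMap S continuous_id continuous_const

theorem continuous_annBr_right (x : Ann S) : Continuous (annBr S x) :=
  continuous_annMap S continuous_const continuous_id

/-- The closure of `ℒ_m` in the annihilation algebra. -/
def annFilt (m : ℕ) : Submodule ℂ (Ann S) := ((filt S m).map (toAnn S)).topologicalClosure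

theorem annFilt_hasBasis :
    (𝓝 (0 : Ann S)).HasBasis (fun _ : ℕ => True) fun m => (annFilt S m : Set (Ann S)) :=
  (nhds_zero_hasBasis S).hasBasis_of_isDenseInducing UniformSpace.Completion.isDenseInducing_coe

theorem annFilt_anti : Antitone (annFilt S) := fun _ _ h =>
  Submodule.topologicalClosure_mono (Submodule.map_mono (filt_anti S h))

theorem isOpen_annFilt (m : ℕ) : IsOpen (annFilt S m : Set (Ann S)) :=
  (annFilt S m).toAddSubgroup.isOpen_of_mem_nhds ((annFilt_hasBasis S).mem_of_mem trivial)

/-- The finitely many generator modes of index below `m` span everything modulo `ℒ_m`. In the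
completion, their span plus the open subspace is open, hence closed, and it is dense. -/
theorem finite_quotient_annFilt (m : ℕ) : Module.Finite ℂ (Ann S ⧸ annFilt S m) := by
  set E : Set (Ann S) := Set.range fun p : Fin S.card × Fin m => toAnn S (mmode S p.2 (S.gen p.1))
    with hE
  have hle : (filt S 0).map (toAnn S) ≤ Submodule.span ℂ E ⊔ annFilt S m := by
    rw [filt, Submodule.map_span_le]
    rintro _ ⟨j, n, -, rfl⟩
    by_cases h : n < m
    · exact Submodule.mem_sup_left (Submodule.subset_span ⟨(j, ⟨n, h⟩), rfl⟩)
    · refine Submodule.mem_sup_right (Submodule.le_topologicalClosure _ ?_)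
      exact Submodule.mem_map_of_mem (Submodule.subset_span ⟨j, n, not_lt.1 h, rfl⟩)
  have htop : Submodule.span ℂ E ⊔ annFilt S m = ⊤ := by
    have hopen : IsOpen ((Submodule.span ℂ E ⊔ annFilt S m : Submodule ℂ (Ann S)) : Set (Ann S)) :=
      (Submodule.span ℂ E ⊔ annFilt S m).toAddSubgroup.isOpen_of_mem_nhds <|
        mem_of_superset ((annFilt_hasBasis S).mem_of_mem (i := m) trivial)
          fun x hx => Submodule.mem_sup_right hx
    rw [eq_top_iff]
    intro x _
    refine (isClosed_submodule_of_isOpen hopen).closure_subset_iff.2 ?_ (denseRange_toAnn S x)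
    rintro _ ⟨y, rfl⟩
    exact hle (Submodule.mem_map_of_mem (by rw [filt_zero]; trivial))
  have hfg : (Submodule.span ℂ E).FG := Submodule.fg_span (Set.finite_range _)
  refine ⟨?_⟩
  have : (⊤ : Submodule ℂ (Ann S ⧸ annFilt S m)) = (Submodule.span ℂ E).map (annFilt S m).mkQ := by
    rw [← (annFilt S m).range_mkQ, LinearMap.range_eq_map, ← htop, Submodule.map_sup]
    simp
  rw [this]
  exact hfg.map _

theorem isLinearlyCompact_ann : IsLinearlyCompact (Ann S) :=
  isLinearlyCompact_of_complete (annFilt S) (isOpen_annFilt S) (annFilt_anti S)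
    (annFilt_hasBasis S) (finite_quotient_annFilt S)

theorem toAnn_mem_annPart {i : ZMod 2} {a : R} (ha : a ∈ part R i) (n : ℕ) :
    toAnn S (mmode S n a) ∈ annPart S i :=
  Submodule.le_topologicalClosure _ (Submodule.subset_span ⟨a, ha, n, rfl⟩)

theorem annPart_le {i : ZMod 2} {K : Submodule ℂ (Ann S)} (hK : IsClosed (K : Set (Ann S)))
    (h : ∀ a ∈ part R i, ∀ n, toAnn S (mmode S n a) ∈ K) : annPart S i ≤ K :=
  Submodule.topologicalClosure_minimal _
    (Submodule.span_le.2 (by rintro _ ⟨a, ha, n, rfl⟩; exact h a ha n)) hK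

theorem isClosed_annPart (i : ZMod 2) : IsClosed (annPart S i : Set (Ann S)) :=
  Submodule.isClosed_topologicalClosure _

theorem ann_le {K : Submodule ℂ (Ann S)} (hK : IsClosed (K : Set (Ann S)))
    (h : ∀ x, toAnn S x ∈ K) (x : Ann S) : x ∈ K :=
  hK.closure_subset_iff.2 (by rintro _ ⟨y, rfl⟩; exact h y) (denseRange_toAnn S x)

theorem ann_eq_zero {M : Type*} [AddCommGroup M] [Module ℂ M] [TopologicalSpace M] [T1Space M]
    {f : Ann S →ₗ[ℂ] M} (hf : Continuous f) (h : ∀ x, f (toAnn S x) = 0) (x : Ann S) : f x = 0 :=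
  ann_le S (K := LinearMap.ker f) (isClosed_singleton.preimage hf) h x

theorem annPart_eq_zero {M : Type*} [AddCommGroup M] [Module ℂ M] [TopologicalSpace M] [T1Space M]
    {i : ZMod 2} {f : Ann S →ₗ[ℂ] M} (hf : Continuous f)
    (h : ∀ a ∈ part R i, ∀ n, f (toAnn S (mmode S n a)) = 0) {x : Ann S} (hx : x ∈ annPart S i) :
    f x = 0 :=
  annPart_le S (K := LinearMap.ker f) (isClosed_singleton.preimage hf) h hx

/-- The extension of a continuous linear map to the completion. -/
theorem exists_extension {V : Type*} [AddCommGroup V] [Module ℂ V] [UniformSpace V]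
    [IsUniformAddGroup V] [CompleteSpace V] [T2Space V] [ContinuousConstSMul ℂ V]
    (γ : Minus S →ₗ[ℂ] V) (hγ : Continuous γ) :
    ∃ f : Ann S →ₗ[ℂ] V, Continuous f ∧ ∀ x, f (toAnn S x) = γ x := by
  have hc := AddMonoidHom.continuous_extension γ.toAddMonoidHom hγ
  have hcoe : ∀ x : Minus S, (γ.toAddMonoidHom.extension hγ) (x : Ann S) = γ x := fun x =>
    AddMonoidHom.extension_coe γ.toAddMonoidHom hγ x
  refine ⟨{ toFun := γ.toAddMonoidHom.extension hγ
            map_add' := map_add _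
            map_smul' := fun c x => ?_ }, hc, hcoe⟩
  refine UniformSpace.Completion.induction_on x (isClosed_eq ?_ ?_) fun x => ?_
  · exact hc.comp (continuous_const_smul c)
  · exact hc.const_smul c
  · rw [← UniformSpace.Completion.coe_smul, hcoe, hcoe, map_smul, RingHom.id_apply]

variable (R) in
/-- The projection of `R` to its even part. -/
def evenProj : R →ₗ[ℂ] R :=
  (part R 0).projection (part R 1) (LieConformalSuperalgebra.isCompl_part (R := R))

theorem evenProj_even {a : R} (ha : a ∈ part R 0) : evenProj R a = a :=
  Submodule.projection_apply_of_mem_left _ ha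

theorem evenProj_odd {a : R} (ha : a ∈ part R 1) : evenProj R a = 0 :=
  Submodule.projection_apply_of_mem_right _ ha

theorem evenProj_del (a : R) : evenProj R (del R a) = del R (evenProj R a) := by
  obtain ⟨a₀, h₀, a₁, h₁, rfl⟩ := exists_parts R a
  simp only [map_add]
  rw [evenProj_even (LieConformalSuperalgebra.D_mem 0 a₀ h₀),
    evenProj_odd (LieConformalSuperalgebra.D_mem 1 a₁ h₁), evenProj_even h₀, evenProj_odd h₁,
    map_zero]

/-- The projection of `R` to its even part commutes with `∂`, so it acts on modes, continuously. A
continuous projection keeps the closures of the two parity spans complementary and later makes the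
parts of the quotient by the center closed. -/
theorem exists_annEvenProj : ∃ P : Ann S →ₗ[ℂ] Ann S, Continuous P ∧
    (∀ x ∈ annPart S 0, P x = x) ∧ ∀ x ∈ annPart S 1, P x = 0 := by
  have hlin := (isLinearlyCompact_ann S).linear
  let γ : Minus S →ₗ[ℂ] Ann S := minusLift S (fun n => toAnn S ∘ₗ mmode S n ∘ₗ evenProj R)
    (fun a => by simp [evenProj_del, mmode_del])
    (fun n a => by simp [evenProj_del, mmode_del])
  have hγ : ∀ n a, γ (mmode S n a) = toAnn S (mmode S n (evenProj R a)) := fun n a =>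
    minusLift_mmode S _ _ _ n a
  obtain ⟨P, hP, hPγ⟩ := exists_extension S γ <| continuous_minusLift S γ fun a => by
    simp only [hγ]
    simpa [Function.comp_def] using
      ((continuous_toAnn S).tendsto 0).comp (tendsto_mmode S (evenProj R a))
  refine ⟨P, hP, fun x hx => ?_, fun x hx => ?_⟩
  · refine sub_eq_zero.1 (annPart_eq_zero S (f := P - LinearMap.id) (hP.sub continuous_id)
      (fun a ha n => ?_) hx)
    simp [hPγ, hγ, evenProj_even ha]
  · refine annPart_eq_zero S hP (fun a ha n => ?_) hx
    simp [hPγ, hγ, evenProj_odd ha]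

theorem isCompl_annPart : IsCompl (annPart S 0) (annPart S 1) := by
  obtain ⟨P, hP, h0, h1⟩ := exists_annEvenProj S
  have hodd : ∀ x : Ann S, P x ∈ annPart S 0 ∧ x - P x ∈ annPart S 1 := by
    refine fun x => ann_le S (K := (annPart S 0).comap P ⊓ (annPart S 1).comap (LinearMap.id - P))
      (((isClosed_annPart S 0).preimage hP).inter
        ((isClosed_annPart S 1).preimage (show Continuous (LinearMap.id - P : Ann S →ₗ[ℂ] Ann S) from
          continuous_id.sub hP))) (fun x => ?_) x
    induction x using minus_induction_part with
    | hadd x y hx hy => rw [map_add]; exact add_mem hx hy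
    | h0 n i a ha =>
      have ha' := toAnn_mem_annPart S ha n
      fin_cases i
      · refine ⟨?_, ?_⟩
        · rw [SetLike.mem_coe, Submodule.mem_comap, h0 _ ha']; exact ha'
        · rw [SetLike.mem_coe, Submodule.mem_comap]
          simp [h0 _ ha']
      · refine ⟨?_, ?_⟩
        · rw [SetLike.mem_coe, Submodule.mem_comap, h1 _ ha']; exact zero_mem _
        · rw [SetLike.mem_coe, Submodule.mem_comap]
          rw [LinearMap.sub_apply, LinearMap.id_apply, h1 _ ha', sub_zero]
          exact ha'
  refine ⟨Submodule.disjoint_def.2 fun x hx hx' => ?_, codisjoint_iff_le_sup.2 fun x _ => ?_⟩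
  · rw [← h0 x hx, h1 x hx']
  · have := Submodule.add_mem_sup (hodd x).1 (hodd x).2
    rwa [add_sub_cancel] at this

theorem lbr_mem {i j : ZMod 2} {a b : R} (ha : a ∈ part R i) (hb : b ∈ part R j) (n : ℕ) :
    lbr R a b n ∈ part R (i + j) := LieConformalSuperalgebra.br_mem i j a ha b hb n

theorem annBr_mem {i j : ZMod 2} {x y : Ann S} (hx : x ∈ annPart S i) (hy : y ∈ annPart S j) :
    annBr S x y ∈ annPart S (i + j) := by
  refine annPart_le S (K := (annPart S (i + j)).comap ((annBr S).flip y))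
    ((isClosed_annPart S _).preimage (continuous_annBr_left S y)) (fun a ha m => ?_) hx
  refine annPart_le S (K := (annPart S (i + j)).comap (annBr S (toAnn S (mmode S m a))))
    ((isClosed_annPart S _).preimage (continuous_annBr_right S _)) (fun b hb n => ?_) hy
  rw [Submodule.mem_comap, annBr_toAnn, minusBr_mmode, map_binomSum]
  exact Submodule.sum_mem _ fun k _ => Submodule.smul_mem _ _
    (toAnn_mem_annPart S (lbr_mem ha hb k) _)

theorem annBr_skew {i j : ZMod 2} {x y : Ann S} (hx : x ∈ annPart S i) (hy : y ∈ annPart S j) :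
    annBr S x y = -(sgn i j • annBr S y x) := by
  rw [← add_eq_zero_iff_eq_neg]
  refine annPart_eq_zero S (f := (annBr S).flip y + sgn i j • annBr S y)
    ((continuous_annBr_left S y).add ((continuous_annBr_right S y).const_smul _))
    (fun a ha m => ?_) hx
  refine annPart_eq_zero S (f := annBr S (toAnn S (mmode S m a)) +
    sgn i j • (annBr S).flip (toAnn S (mmode S m a)))
    ((continuous_annBr_right S _).add ((continuous_annBr_left S _).const_smul _))
    (fun b hb n => ?_) hy
  simp only [LinearMap.add_apply, LinearMap.smul_apply, LinearMap.flip_apply, annBr_toAnn]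
  rw [minusBr_skew S i j a ha b hb, map_neg, map_smul, neg_add_cancel]

theorem annBr_jacobi {i j : ZMod 2} {x y : Ann S} (hx : x ∈ annPart S i) (hy : y ∈ annPart S j)
    (z : Ann S) : annBr S x (annBr S y z) =
      annBr S (annBr S x y) z + sgn i j • annBr S y (annBr S x z) := by
  have hl := continuous_annBr_left S
  have hr := continuous_annBr_right S
  rw [← sub_eq_zero]
  refine annPart_eq_zero S (f := (annBr S).flip (annBr S y z) -
    ((annBr S).flip z ∘ₗ (annBr S).flip y + sgn i j • (annBr S y ∘ₗ (annBr S).flip z)))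
    ((hl _).sub (((hl z).comp (hl y)).add (((hr y).comp (hl z)).const_smul _)))
    (fun a ha m => ?_) hx
  set a' := toAnn S (mmode S m a)
  refine annPart_eq_zero S (f := annBr S a' ∘ₗ (annBr S).flip z -
    ((annBr S).flip z ∘ₗ annBr S a' + sgn i j • ((annBr S).flip (annBr S a' z))))
    (((hr _).comp (hl _)).sub (((hl _).comp (hr _)).add ((hl _).const_smul _)))
    (fun b hb n => ?_) hy
  set b' := toAnn S (mmode S n b)
  refine ann_eq_zero S (f := annBr S a' ∘ₗ annBr S b' -
    (annBr S (annBr S a' b') + sgn i j • (annBr S b' ∘ₗ annBr S a')))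
    (((hr _).comp (hr _)).sub ((hr _).add (((hr _).comp (hr _)).const_smul _))) (fun c => ?_) z
  simp only [LinearMap.add_apply, LinearMap.sub_apply, LinearMap.smul_apply, LinearMap.comp_apply,
    a', b', annBr_toAnn]
  rw [← map_smul, ← map_add, ← map_sub, sub_eq_zero.2, map_zero]
  induction c using minus_induction with
  | hadd c c' h h' => simp only [map_add, smul_add, h, h']; abel
  | h0 k c => rw [minusBr_jacobi S i j a ha b hb]

theorem isLinearlyCompactLie_ann : IsLinearlyCompactLie (Ann S) where
  lie :=
    { isCompl_part := isCompl_annPart S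
      brk_mem := fun _ _ _ hx _ hy => annBr_mem S hx hy
      skew := fun _ _ _ hx _ hy => annBr_skew S hx hy
      jacobi := fun _ _ _ hx _ hy z => annBr_jacobi S hx hy z }
  compact := isLinearlyCompact_ann S
  closed_part := isClosed_annPart S
  continuous_brk := continuous_annBr S

end Ann

/-! ## Cohomology and universality of the annihilation algebra -/

section Center

variable {g : Type*} [AddCommGroup g] [Module ℂ g] [Superalgebra g]

theorem brk_mkQ (x y : g) : brk ((center g).mkQ x) ((center g).mkQ y) = (center g).mkQ (brk x y) :=
  rfl

theorem IsLieSuperalgebra.disjoint_part (h : IsLieSuperalgebra g) (i : ZMod 2) :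
    Disjoint (gpart i : Submodule ℂ g) (gpart (i + 1)) := by
  fin_cases i
  · exact h.isCompl_part.disjoint
  · exact h.isCompl_part.disjoint.symm

theorem IsLieSuperalgebra.exists_parts (h : IsLieSuperalgebra g) (i : ZMod 2) (x : g) :
    ∃ x₀ ∈ (gpart i : Submodule ℂ g), ∃ x₁ ∈ (gpart (i + 1) : Submodule ℂ g), x₀ + x₁ = x := by
  refine Submodule.mem_sup.1 ?_
  have := h.isCompl_part.sup_eq_top
  fin_cases i
  · exact this ▸ Submodule.mem_top
  · exact (sup_comm (gpart 0 : Submodule ℂ g) (gpart 1)).symm.trans this |>.symm ▸ Submodule.mem_top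

theorem IsLieSuperalgebra.mem_center (h : IsLieSuperalgebra g) {i : ZMod 2} {z : g}
    (hz : z ∈ (gpart i : Submodule ℂ g))
    (h0 : ∀ j, ∀ x ∈ (gpart j : Submodule ℂ g), brk z x = 0) : z ∈ center g := by
  intro x
  obtain ⟨x₀, hx₀, x₁, hx₁, rfl⟩ := h.exists_parts 0 x
  simp only [map_add, LinearMap.add_apply]
  rw [h.skew _ _ x₀ hx₀ z hz, h.skew _ _ x₁ hx₁ z hz, h0 _ _ hx₀, h0 _ _ hx₁]
  simp

/-- The brackets of `x` and of `y` with a homogeneous element have opposite parities, so they cannot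
cancel: the center is graded. -/
theorem IsLieSuperalgebra.mem_center_of_add_mem (h : IsLieSuperalgebra g) {i : ZMod 2} {x y : g}
    (hx : x ∈ (gpart i : Submodule ℂ g)) (hy : y ∈ (gpart (i + 1) : Submodule ℂ g))
    (hxy : x + y ∈ center g) : x ∈ center g := by
  refine h.mem_center hx fun j z hz => ?_
  have h1 : brk x z + brk y z = 0 := by simpa using (hxy z).1
  refine (Submodule.disjoint_def.1 (h.disjoint_part (i + j))) _ (h.brk_mem _ _ _ hx _ hz) ?_
  rw [eq_neg_of_add_eq_zero_left h1, add_right_comm]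
  exact neg_mem (h.brk_mem _ _ _ hy _ hz)

theorem IsLieSuperalgebra.quotient_center (h : IsLieSuperalgebra g) :
    IsLieSuperalgebra (g ⧸ center g) where
  isCompl_part := by
    refine ⟨Submodule.disjoint_def.2 ?_, codisjoint_iff.2 ?_⟩
    · rintro _ ⟨x, hx, rfl⟩ ⟨y, hy, hxy⟩
      rw [Submodule.mkQ_apply, Submodule.Quotient.mk_eq_zero]
      refine h.mem_center_of_add_mem (y := -y) hx (neg_mem hy) ?_
      rw [← Submodule.Quotient.mk_eq_zero, ← Submodule.mkQ_apply, map_add, map_neg, hxy]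
      exact add_neg_cancel _
    · change (gpart 0 : Submodule ℂ g).map (center g).mkQ ⊔
        (gpart 1 : Submodule ℂ g).map (center g).mkQ = ⊤
      rw [← Submodule.map_sup, h.isCompl_part.sup_eq_top, Submodule.map_top, Submodule.range_mkQ]
  brk_mem := by
    rintro i j _ ⟨x, hx, rfl⟩ _ ⟨y, hy, rfl⟩
    exact ⟨_, h.brk_mem i j x hx y hy, rfl⟩
  skew := by
    rintro i j _ ⟨x, hx, rfl⟩ _ ⟨y, hy, rfl⟩
    rw [brk_mkQ, brk_mkQ, h.skew i j x hx y hy, map_neg, map_smul]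
  jacobi := by
    rintro i j _ ⟨x, hx, rfl⟩ _ ⟨y, hy, rfl⟩ z
    obtain ⟨z, rfl⟩ := (center g).mkQ_surjective z
    simp only [brk_mkQ]
    rw [h.jacobi i j x hx y hy, map_add, map_smul]

variable [TopologicalSpace g]

theorem IsLinearlyCompactLie.continuous_brk_left (h : IsLinearlyCompactLie g) (y : g) :
    Continuous fun x : g => brk x y :=
  h.continuous_brk.comp (continuous_id.prodMk continuous_const)

theorem IsLinearlyCompactLie.continuous_brk_right (h : IsLinearlyCompactLie g) (x : g) :
    Continuous fun y : g => brk x y :=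
  h.continuous_brk.comp (continuous_const.prodMk continuous_id)

theorem IsLinearlyCompactLie.isClosed_center (h : IsLinearlyCompactLie g) :
    IsClosed (center g : Set g) := by
  have := h.compact.t2
  have : (center g : Set g) = ⋂ x : g, {z | brk z x = 0} ∩ {z | brk x z = 0} := by
    ext z
    simp only [Set.mem_iInter]
    rfl
  rw [this]
  exact isClosed_iInter fun x => (isClosed_singleton.preimage (h.continuous_brk_left x)).inter
    (isClosed_singleton.preimage (h.continuous_brk_right x))

/-- If the projection to the even part is continuous, the quotient of a linearly compact Lie
superalgebra by its center is a linearly compact Lie superalgebra. -/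
theorem IsLinearlyCompactLie.quotient_center (h : IsLinearlyCompactLie g) {P : g →ₗ[ℂ] g}
    (hP : Continuous P) (h0 : ∀ x ∈ (gpart 0 : Submodule ℂ g), P x = x)
    (h1 : ∀ x ∈ (gpart 1 : Submodule ℂ g), P x = 0) : IsLinearlyCompactLie (g ⧸ center g) where
  lie := h.lie.quotient_center
  compact := h.compact.quotient h.isClosed_center
  closed_part := by
    have := h.compact.addGroup
    have hq := (Submodule.isOpenQuotientMap_mkQ (center g)).isQuotientMap
    -- The preimage of a parity part of the quotient consists of the elements whose component of the
    -- other parity is central; these are the two closed subspaces considered here.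
    have hcl : IsClosed ((center g).comap P : Set g) ∧
        IsClosed ((center g).comap (LinearMap.id - P) : Set g) :=
      ⟨h.isClosed_center.preimage hP, h.isClosed_center.preimage
        (show Continuous (LinearMap.id - P : g →ₗ[ℂ] g) from continuous_id.sub hP)⟩
    intro i
    rw [← hq.isClosed_preimage]
    change IsClosed ((((gpart i : Submodule ℂ g).map (center g).mkQ).comap
      (center g).mkQ : Submodule ℂ g) : Set g)
    rw [Submodule.comap_map_mkQ]
    fin_cases i
    · convert hcl.2 using 2
      ext x
      obtain ⟨x₀, hx₀, x₁, hx₁, rfl⟩ := h.lie.exists_parts 0 x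
      rw [Submodule.mem_comap, LinearMap.sub_apply, map_add, map_add, h0 _ hx₀, h1 _ hx₁]
      simp only [LinearMap.id_apply, add_zero, add_sub_cancel_left]
      constructor
      · rw [add_comm x₀ x₁]
        intro hx
        obtain ⟨z, hz, y, hy, e⟩ := Submodule.mem_sup.1 hx
        refine h.lie.mem_center_of_add_mem (i := 1) (y := x₀ - y) hx₁ (sub_mem hx₀ hy) ?_
        rw [← add_sub_assoc, ← e, add_sub_cancel_right]
        exact hz
      · exact fun hx => add_mem (Submodule.mem_sup_right hx₀) (Submodule.mem_sup_left hx)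
    · convert hcl.1 using 2
      ext x
      obtain ⟨x₀, hx₀, x₁, hx₁, rfl⟩ := h.lie.exists_parts 0 x
      rw [Submodule.mem_comap, map_add, h0 _ hx₀, h1 _ hx₁, add_zero]
      constructor
      · intro hx
        obtain ⟨z, hz, y, hy, e⟩ := Submodule.mem_sup.1 hx
        refine h.lie.mem_center_of_add_mem (i := 0) (y := x₁ - y) hx₀ (sub_mem hx₁ hy) ?_
        rw [← add_sub_assoc, ← e, add_sub_cancel_right]
        exact hz
      · exact fun hx => add_mem (Submodule.mem_sup_left hx) (Submodule.mem_sup_right hx₁)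
  continuous_brk := by
    have := h.compact.addGroup
    have hq := Submodule.isOpenQuotientMap_mkQ (center g)
    refine (hq.prodMap hq).isQuotientMap.continuous_iff.2 ?_
    exact hq.continuous.comp h.continuous_brk

end Center

/-! ### Lifting through central extensions -/

section CentralExtension

variable {E Q : Type*} [AddCommGroup E] [Module ℂ E] [Superalgebra E] [TopologicalSpace E]
  [AddCommGroup Q] [Module ℂ Q] [Superalgebra Q] [TopologicalSpace Q] {ρ : E →ₗ[ℂ] Q}

/-- Brackets in a central extension depend only on images in the quotient. Hence an arbitrary linear
section can be used inside brackets. -/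
theorem brk_eq_of_sub_mem_center {g : Type*} [AddCommGroup g] [Module ℂ g] [Superalgebra g]
    {x x' y y' : g} (hx : x - x' ∈ center g) (hy : y - y' ∈ center g) :
    brk x y = brk x' y' := by
  have h1 := (hx y).1
  have h2 := (hy x').2
  rw [map_sub, LinearMap.sub_apply, sub_eq_zero] at h1
  rw [map_sub, sub_eq_zero] at h2
  rw [h1, h2]

theorem IsCentralExtension.sub_mem_center (h : IsCentralExtension ρ) {x y : E}
    (hxy : ρ x = ρ y) : x - y ∈ center E :=
  h.central (by rw [LinearMap.mem_ker, map_sub, hxy, sub_self])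

/-- Used to compare two lifts of the same element, which act identically. -/
theorem IsCentralExtension.exists_homogeneous (h : IsCentralExtension ρ) {i : ZMod 2} {x : E}
    (hx : ρ x ∈ (gpart i : Submodule ℂ Q)) :
    ∃ x' ∈ (gpart i : Submodule ℂ E), x - x' ∈ center E := by
  obtain ⟨x₀, hx₀, x₁, hx₁, rfl⟩ := h.source.lie.exists_parts i x
  refine ⟨x₀, hx₀, h.central ?_⟩
  rw [add_sub_cancel_left, LinearMap.mem_ker]
  refine Submodule.disjoint_def.1 (h.target.lie.disjoint_part i) _ ?_ (h.hom.part _ _ hx₁)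
  rw [map_add] at hx
  exact (Submodule.add_mem_iff_right _ (h.hom.part _ _ hx₀)).1 hx

end CentralExtension

/-! ### Density of the brackets when `R = R'` -/

section Derived

variable {R : Type*} [AddCommGroup R] [Module ℂ R] [LieConformalSuperalgebra R] (S : Generators R)

/-- The spans of products of total parity `0` and `1` lie in the respective parts and together give
`R' = R`; by directness each of them is the whole part. -/
theorem part_le_span (hder : derived R = ⊤) (i : ZMod 2) : part R i ≤
    Submodule.span ℂ {x | ∃ p q, p + q = i ∧ ∃ b ∈ part R p, ∃ c ∈ part R q, ∃ n,
      x = lbr R b c n} := by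
  set D : ZMod 2 → Submodule ℂ R := fun i =>
    Submodule.span ℂ {x | ∃ p q, p + q = i ∧ ∃ b ∈ part R p, ∃ c ∈ part R q, ∃ n,
      x = lbr R b c n} with hD
  have hle : ∀ i, D i ≤ part R i := fun i => Submodule.span_le.2 <| by
    rintro _ ⟨p, q, rfl, b, hb, c, hc, n, rfl⟩
    exact lbr_mem hb hc n
  have hmem : ∀ p q, ∀ b ∈ part R p, ∀ c ∈ part R q, ∀ n, lbr R b c n ∈ D 0 ⊔ D 1 := by
    intro p q b hb c hc n
    have h : lbr R b c n ∈ D (p + q) := Submodule.subset_span ⟨p, q, rfl, b, hb, c, hc, n, rfl⟩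
    generalize p + q = i at h
    fin_cases i
    · exact Submodule.mem_sup_left h
    · exact Submodule.mem_sup_right h
  have htop : D 0 ⊔ D 1 = ⊤ := by
    rw [eq_top_iff, ← hder, derived, Submodule.span_le]
    rintro _ ⟨b, c, n, rfl⟩
    obtain ⟨b₀, hb₀, b₁, hb₁, rfl⟩ := exists_parts R b
    obtain ⟨c₀, hc₀, c₁, hc₁, rfl⟩ := exists_parts R c
    simp only [map_add, LinearMap.add_apply, Finsupp.add_apply]
    exact add_mem (add_mem (hmem _ _ _ hb₀ _ hc₀ n) (hmem _ _ _ hb₁ _ hc₀ n))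
      (add_mem (hmem _ _ _ hb₀ _ hc₁ n) (hmem _ _ _ hb₁ _ hc₁ n))
  have hdis := Submodule.disjoint_def.1 (LieConformalSuperalgebra.isCompl_part (R := R)).disjoint
  intro a ha
  obtain ⟨d₀, h₀, d₁, h₁, rfl⟩ := Submodule.mem_sup.1 (htop ▸ Submodule.mem_top : a ∈ D 0 ⊔ D 1)
  fin_cases i
  · have : d₁ = 0 := hdis _ ((Submodule.add_mem_iff_right _ (hle 0 h₀)).1 ha) (hle 1 h₁)
    rw [this, add_zero]
    exact h₀
  · have : d₀ = 0 := hdis _ (hle 0 h₀) ((Submodule.add_mem_iff_left _ (hle 1 h₁)).1 ha)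
    rw [this, zero_add]
    exact h₁

theorem diffPow_mem {M : Type*} [AddCommGroup M] [Module ℂ M] {K : Submodule ℂ M}
    {f : ℕ → ℕ → M} (hf : ∀ m n, f m n ∈ K) (j m n : ℕ) : diffPow f j m n ∈ K := by
  induction j generalizing m n with
  | zero => exact hf m n
  | succ j ih => exact sub_mem (ih _ _) (ih _ _)

/-- If `R = R'`, then the brackets span a dense subspace of the annihilation algebra,
compatibly with the parity. -/
theorem annPart_le_of_annBr_mem (hder : derived R = ⊤) {i : ZMod 2} {K : Submodule ℂ (Ann S)}
    (hK : IsClosed (K : Set (Ann S)))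
    (h : ∀ p q, p + q = i → ∀ x ∈ annPart S p, ∀ y ∈ annPart S q, annBr S x y ∈ K) :
    annPart S i ≤ K := by
  refine annPart_le S hK fun a ha n => ?_
  refine Submodule.span_le (p := K.comap (toAnn S ∘ₗ mmode S n)).2 ?_ (part_le_span hder i ha)
  rintro _ ⟨p, q, hpq, b, hb, c, hc, j, rfl⟩
  rw [SetLike.mem_coe, Submodule.mem_comap, LinearMap.comp_apply, mmode_lbr, map_diffPow]
  refine diffPow_mem (fun k l => ?_) _ _ _
  rw [← annBr_toAnn]
  exact h p q hpq _ (toAnn_mem_annPart S hb k) _ (toAnn_mem_annPart S hc l)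

theorem mem_of_annBr_mem (hder : derived R = ⊤) {K : Submodule ℂ (Ann S)}
    (hK : IsClosed (K : Set (Ann S))) (h : ∀ x y, annBr S x y ∈ K) (x : Ann S) : x ∈ K := by
  have hle : annPart S 0 ⊔ annPart S 1 ≤ K :=
    sup_le (annPart_le_of_annBr_mem S hder hK fun _ _ _ x _ y _ => h x y)
      (annPart_le_of_annBr_mem S hder hK fun _ _ _ x _ y _ => h x y)
  exact hle ((isCompl_annPart S).sup_eq_top ▸ Submodule.mem_top)

end Derived

/-! ### Vanishing of cohomology and universality -/

section Main

variable {R : Type*} [AddCommGroup R] [Module ℂ R] [LieConformalSuperalgebra R] (S : Generators R)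
  {L : R} {N : R →ₗ[ℂ] R}

theorem exists_primitive_ann {V : Type*} [AddCommGroup V] [Module ℂ V] [UniformSpace V]
    [IsUniformAddGroup V] [IsLinearTopology ℂ V] [CompleteSpace V] [T2Space V]
    (hL : L ∈ part R 0) (hN : ∀ a, lbr R L a 0 = del R a + N a) (hlf : IsLocFin N)
    (hder : derived R = ⊤) (Φ : Ann S →ₗ[ℂ] Ann S →ₗ[ℂ] V) (hr : ∀ x, Continuous (Φ x))
    (hl : ∀ y, Continuous fun x => Φ x y)
    (hΦ : ∀ y z, Φ (toAnn S (mmode S 0 L)) (annBr S y z) =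
      Φ (annBr S (toAnn S (mmode S 0 L)) y) z + Φ y (annBr S (toAnn S (mmode S 0 L)) z)) :
    ∃ β : Ann S →ₗ[ℂ] V, Continuous β ∧ ∀ x y, Φ x y = β (annBr S x y) := by
  have := linearTopology_continuousConstSMul (V := V)
  obtain ⟨γ, hγ, h⟩ := exists_primitive S hL hN hlf hder (Φ.compl₁₂ (toAnn S) (toAnn S))
    (fun x => (hr _).comp (continuous_toAnn S)) (fun y z => by
      simp only [LinearMap.compl₁₂_apply, ← annBr_toAnn]
      exact hΦ _ _)
  obtain ⟨β, hβ, hβγ⟩ := exists_extension S γ hγ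
  refine ⟨β, hβ, fun x y => ?_⟩
  rw [← sub_eq_zero]
  refine ann_eq_zero S (f := Φ.flip y - β ∘ₗ (annBr S).flip y)
    ((hl y).sub (hβ.comp (continuous_annBr_left S y))) (fun x => ?_) x
  refine ann_eq_zero S (f := Φ (toAnn S x) - β ∘ₗ annBr S (toAnn S x))
    ((hr _).sub (hβ.comp (continuous_annBr_right S _))) (fun y => ?_) y
  simp only [LinearMap.sub_apply, LinearMap.comp_apply, annBr_toAnn, hβγ, ← h]
  exact sub_self _

/-- Vanishing of the second cohomology of the annihilation algebra. -/
theorem subsingleton_H2 (hL : L ∈ part R 0) (hN : ∀ a, lbr R L a 0 = del R a + N a)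
    (hlf : IsLocFin N) (hder : derived R = ⊤) : Subsingleton (H2 (Ann S)) := by
  have key : ∀ φ ∈ Z2 (Ann S), φ ∈ B2 (Ann S) := by
    rintro φ ⟨hc, -, hJ⟩
    -- With the discrete uniformity, `ℂ` is an admissible complete space of values.
    let _ : UniformSpace ℂ := ⊥
    have _ : DiscreteUniformity ℂ := ⟨rfl⟩
    have _ : IsUniformAddGroup ℂ := ⟨DiscreteUniformity.uniformContinuous _ _⟩
    have _ : IsLinearTopology ℂ ℂ := inferInstance
    have hc' : Continuous fun p : Ann S × Ann S => φ p.1 p.2 := hc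
    obtain ⟨β, hβ, h⟩ := exists_primitive_ann S hL hN hlf hder φ
      (fun x => hc'.comp (continuous_const.prodMk continuous_id))
      (fun y => hc'.comp (continuous_id.prodMk continuous_const)) (fun y z => by
        obtain ⟨y₀, hy₀, y₁, hy₁, rfl⟩ := (isLinearlyCompactLie_ann S).lie.exists_parts 0 y
        have h0 := hJ 0 0 _ (toAnn_mem_annPart S hL 0) _ hy₀ z
        have h1 := hJ 0 1 _ (toAnn_mem_annPart S hL 0) _ hy₁ z
        simp only [sgn] at h0 h1
        simp only [map_add, LinearMap.add_apply]
        refine (congrArg₂ (· + ·) h0 h1).trans ?_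
        simp only [zero_ne_one, false_and, if_false, one_mul]
        exact add_add_add_comm _ _ _ _)
    exact ⟨β, hβ, h⟩
  refine ⟨?_⟩
  rintro ⟨_, φ, hφ, rfl⟩ ⟨_, ψ, hψ, rfl⟩
  refine Subtype.ext ?_
  change (B2 (Ann S)).mkQ φ = (B2 (Ann S)).mkQ ψ
  rw [(Submodule.Quotient.mk_eq_zero _).2 (key φ hφ) |> fun h => (h : (B2 (Ann S)).mkQ φ = 0),
    (Submodule.Quotient.mk_eq_zero _).2 (key ψ hψ) |> fun h => (h : (B2 (Ann S)).mkQ ψ = 0)]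

theorem isCentralExtension_mkQ_center : IsCentralExtension (center (Ann S)).mkQ := by
  have h := isLinearlyCompactLie_ann S
  obtain ⟨P, hP, h0, h1⟩ := exists_annEvenProj S
  exact
    { source := h
      target := h.quotient_center hP h0 h1
      hom :=
        { continuous := (Submodule.isOpenQuotientMap_mkQ _).continuous
          part := fun i x hx => Submodule.mem_map_of_mem hx
          map_brk := fun _ _ => rfl }
      surjective := Submodule.mkQ_surjective _
      central := (Submodule.ker_mkQ _).le }

/-- The annihilation algebra is the universal central extension of its quotient by its center. -/
theorem isUniversalCentralExtension_mkQ_center.{u₁, u₂} {R : Type u₁} [AddCommGroup R] [Module ℂ R]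
    [LieConformalSuperalgebra R] (S : Generators R) {L : R} {N : R →ₗ[ℂ] R}
    (hL : L ∈ part R 0) (hN : ∀ a, lbr R L a 0 = del R a + N a)
    (hlf : IsLocFin N) (hder : derived R = ⊤) :
    IsUniversalCentralExtension.{u₁, u₁, u₂} (center (Ann S)).mkQ := by
  refine ⟨isCentralExtension_mkQ_center S, fun E _ _ _ _ ρ hρ => ?_⟩
  have hA := isCentralExtension_mkQ_center S
  have := hρ.source.compact.addGroup
  have := hρ.source.compact.linear
  have := hρ.source.compact.t2
  have hcont := hρ.source.continuous_brk_left
  have hcont' := hρ.source.continuous_brk_right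
  let _ : UniformSpace E := IsTopologicalAddGroup.rightUniformSpace E
  have _ : IsUniformAddGroup E := isUniformAddGroup_of_addCommGroup
  have _ : CompleteSpace E := hρ.source.compact.completeSpace
  -- Only linearity of the section is available; continuity and compatibility with brackets and
  -- parity are not.
  obtain ⟨s, hs⟩ := ρ.exists_rightInverse_of_surjective (LinearMap.range_eq_top.2 hρ.surjective)
  replace hs : ∀ q, ρ (s q) = q := fun q => LinearMap.congr_fun hs q
  set π := (center (Ann S)).mkQ
  set τ : Ann S →ₗ[ℂ] E := s ∘ₗ π
  have hτ : ∀ x, ρ (τ x) = π x := fun x => hs _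
  have hτbr : ∀ x y, τ (annBr S x y) - brk (τ x) (τ y) ∈ center E := fun x y =>
    hρ.sub_mem_center (by rw [hτ, hρ.hom.map_brk, hτ, hτ]; rfl)
  have hzero : ∀ x : E, x - x ∈ center E := fun x => by rw [sub_self]; exact zero_mem _
  -- The composite of `[e, s ·]` with `ρ` is `[e, ·]`, which is continuous; so `[e, s ·]` is
  -- continuous on `Q` although `s` may not be.
  have hbrs : ∀ e, Continuous fun x => brk e (τ x) := fun e =>
    (hρ.source.compact.continuous_of_comp hρ.target.compact ρ hρ.hom.continuous hρ.surjective
      (brk e ∘ₗ s) ((hcont' e).congr fun v =>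
        brk_eq_of_sub_mem_center (hzero e) (hρ.sub_mem_center (hs _).symm))).comp hA.hom.continuous
  have hbrs' : ∀ e, Continuous fun x => brk (τ x) e := fun e =>
    (hρ.source.compact.continuous_of_comp hρ.target.compact ρ hρ.hom.continuous hρ.surjective
      (brk.flip e ∘ₗ s) ((hcont e).congr fun v =>
        brk_eq_of_sub_mem_center (hρ.sub_mem_center (hs _).symm) (hzero e))).comp hA.hom.continuous
  -- `τ(L_0)` need not be even. Its even replacement `l` has the same adjoint action and gives a
  -- Jacobi identity without signs.
  obtain ⟨l, hl, hlτ⟩ := hρ.exists_homogeneous (i := 0) (x := τ (toAnn S (mmode S 0 L)))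
    (by rw [hτ]; exact hA.hom.part 0 _ (toAnn_mem_annPart S hL 0))
  have hjac : ∀ y z, brk l (brk y z) = brk (brk l y) z + brk y (brk l z) := fun y z => by
    obtain ⟨y₀, hy₀, y₁, hy₁, rfl⟩ := hρ.source.lie.exists_parts 0 y
    have h0 := hρ.source.lie.jacobi 0 0 _ hl _ hy₀ z
    have h1 := hρ.source.lie.jacobi 0 _ _ hl _ hy₁ z
    simp only [sgn, zero_ne_one, false_and, if_false, one_smul] at h0 h1
    simp only [map_add, LinearMap.add_apply, h0, h1]
    abel
  obtain ⟨f, hf, hfbr⟩ := exists_primitive_ann S hL hN hlf hder (brk.compl₁₂ τ τ)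
    (fun x => hbrs _) (fun y => hbrs' _) (fun y z => by
      simp only [LinearMap.compl₁₂_apply]
      rw [brk_eq_of_sub_mem_center hlτ (hτbr y z), hjac,
        brk_eq_of_sub_mem_center (hτbr _ y) (hzero _),
        brk_eq_of_sub_mem_center (hzero (τ y)) (hτbr _ z),
        brk_eq_of_sub_mem_center hlτ (hzero (τ y)), brk_eq_of_sub_mem_center hlτ (hzero (τ z))])
  simp only [LinearMap.compl₁₂_apply] at hfbr
  -- Both sides are continuous and agree on brackets, whose span is dense.
  have hρf : ∀ x, ρ (f x) = π x := by
    have := hρ.target.compact.t2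
    have := hρ.target.compact.addGroup
    intro x
    rw [← sub_eq_zero]
    refine mem_of_annBr_mem S hder (K := LinearMap.ker (ρ ∘ₗ f - π))
      (isClosed_singleton.preimage ((hρ.hom.continuous.comp hf).sub hA.hom.continuous))
      (fun x y => ?_) x
    rw [LinearMap.mem_ker, LinearMap.sub_apply, LinearMap.comp_apply, ← hfbr, hρ.hom.map_brk, hτ,
      hτ, sub_eq_zero]
    rfl
  -- `f x` and `τ x` lie over the same point of `Q`, so they have the same brackets.
  have hff : ∀ x y, f (annBr S x y) = brk (f x) (f y) := fun x y => by
    rw [← hfbr]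
    exact brk_eq_of_sub_mem_center (hρ.sub_mem_center (by rw [hτ, hρf]))
      (hρ.sub_mem_center (by rw [hτ, hρf]))
  refine ⟨f, ⟨⟨hf, fun i => ?_, hff⟩, hρf⟩, fun g ⟨hg, hgρ⟩ => ?_⟩
  · refine annPart_le_of_annBr_mem S hder (K := (gpart i : Submodule ℂ E).comap f)
      ((hρ.source.closed_part i).preimage hf) ?_
    rintro p q rfl x hx y hy
    rw [Submodule.mem_comap, ← hfbr]
    obtain ⟨x', hx', hxx'⟩ := hρ.exists_homogeneous (i := p) (x := τ x)
      (by rw [hτ]; exact hA.hom.part p _ hx)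
    obtain ⟨y', hy', hyy'⟩ := hρ.exists_homogeneous (i := q) (x := τ y)
      (by rw [hτ]; exact hA.hom.part q _ hy)
    rw [brk_eq_of_sub_mem_center hxx' hyy']
    exact hρ.source.lie.brk_mem p q x' hx' y' hy'
  -- Two lifts over `Q` differ by central elements, so they agree on brackets and, by density,
  -- everywhere.
  · refine LinearMap.ext fun x => sub_eq_zero.1 ?_
    refine mem_of_annBr_mem S hder (K := LinearMap.ker (g - f))
      (isClosed_singleton.preimage (hg.continuous.sub hf)) (fun x y => ?_) x
    rw [LinearMap.mem_ker, LinearMap.sub_apply, hff, sub_eq_zero]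
    refine (hg.map_brk x y).trans ?_
    exact brk_eq_of_sub_mem_center (hρ.sub_mem_center (by rw [hgρ, hρf]))
      (hρ.sub_mem_center (by rw [hgρ, hρf]))

theorem isLocFin_zero {M : Type*} [AddCommGroup M] [Module ℂ M] :
    IsLocFin (0 : M →ₗ[ℂ] M) :=
  isLocFin_of_pow_three 0 0 fun _ => by simp

/-- On a homogeneous `a`, the element `∂a - (L₀)_(0) a` has the parity of `a`, while `(L₁)_(0) a`,
to which it is equal, has the opposite parity. Both are zero. -/
theorem exists_even_of_lbr_zero (h : ∃ L : R, ∀ a, lbr R L a 0 = del R a) :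
    ∃ L ∈ part R 0, ∀ a, lbr R L a 0 = del R a := by
  obtain ⟨L, hL⟩ := h
  obtain ⟨L₀, h₀, L₁, h₁, rfl⟩ := exists_parts R L
  refine ⟨L₀, h₀, fun a => ?_⟩
  have hdis := (LieConformalSuperalgebra.isCompl_part (R := R)).disjoint
  have hdis' : ∀ i, Disjoint (part R i) (part R (1 + i)) := by
    intro i
    fin_cases i
    · exact hdis
    · exact hdis.symm
  have key : ∀ i, ∀ a ∈ part R i, lbr R L₀ a 0 = del R a := by
    intro i a ha
    have e := hL a
    rw [map_add, LinearMap.add_apply, Finsupp.add_apply] at e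
    rw [← sub_eq_zero]
    refine Submodule.disjoint_def.1 (hdis' i) _
      (sub_mem (by simpa using lbr_mem h₀ ha 0) (LieConformalSuperalgebra.D_mem i a ha)) ?_
    rw [show lbr R L₀ a 0 - del R a = -lbr R L₁ a 0 by rw [← e]; abel]
    exact neg_mem (lbr_mem h₁ ha 0)
  obtain ⟨a₀, ha₀, a₁, ha₁, rfl⟩ := exists_parts R a
  rw [map_add, map_add, Finsupp.add_apply, key 0 _ ha₀, key 1 _ ha₁]

theorem del_mem_derived {R : Type*} [AddCommGroup R] [Module ℂ R] [LieConformalSuperalgebra R]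
    (x : R) (hx : x ∈ derived R) : del R x ∈ derived R := by
  refine Submodule.span_le (p := (derived R).comap (del R)).2 ?_ hx
  rintro _ ⟨a, b, n, rfl⟩
  rw [SetLike.mem_coe, Submodule.mem_comap, del_lbr]
  exact add_mem (Submodule.subset_span ⟨_, _, _, rfl⟩) (Submodule.subset_span ⟨_, _, _, rfl⟩)

/-- `R'` is a graded ideal, non-zero because the bracket is. -/
theorem derived_eq_top_of_isSimple (h : IsSimple R) : derived R = ⊤ := by
  refine (h.ideal (derived R) ⟨?_, del_mem_derived,
    fun a x _ n => Submodule.subset_span ⟨a, x, n, rfl⟩⟩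
    ).resolve_left fun h0 => ?_
  · refine le_antisymm ?_ (sup_le inf_le_left inf_le_left)
    have hmem : ∀ p q, ∀ b ∈ part R p, ∀ c ∈ part R q, ∀ n, lbr R b c n ∈
        (derived R ⊓ part R 0) ⊔ (derived R ⊓ part R 1) := by
      intro p q b hb c hc n
      have h1 := lbr_mem hb hc n
      have h2 : lbr R b c n ∈ derived R := Submodule.subset_span ⟨b, c, n, rfl⟩
      generalize p + q = i at h1
      fin_cases i
      · exact Submodule.mem_sup_left ⟨h2, h1⟩
      · exact Submodule.mem_sup_right ⟨h2, h1⟩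
    refine Submodule.span_le.2 ?_
    rintro _ ⟨b, c, n, rfl⟩
    obtain ⟨b₀, hb₀, b₁, hb₁, rfl⟩ := exists_parts R b
    obtain ⟨c₀, hc₀, c₁, hc₁, rfl⟩ := exists_parts R c
    simp only [map_add, LinearMap.add_apply, Finsupp.add_apply]
    exact add_mem (add_mem (hmem _ _ _ hb₀ _ hc₀ n) (hmem _ _ _ hb₁ _ hc₀ n))
      (add_mem (hmem _ _ _ hb₀ _ hc₁ n) (hmem _ _ _ hb₁ _ hc₁ n))
  · obtain ⟨a, b, n, hab⟩ := h.nonzero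
    refine hab ((Submodule.mem_bot ℂ).1 ?_)
    rw [← h0]
    exact Submodule.subset_span ⟨a, b, n, rfl⟩

end Main

/-! ## Calculus in the Grassmann algebra -/

section Grassmann

variable {N : ℕ}

theorem pd_one (i : Fin N) : pd N i 1 = 0 := CliffordAlgebra.contractLeft_one _ _

theorem pd_ι_mul (i : Fin N) (m : Fin N → ℂ) (f : Gr N) :
    pd N i (ExteriorAlgebra.ι ℂ m * f) = m i • f - ExteriorAlgebra.ι ℂ m * pd N i f :=
  CliffordAlgebra.contractLeft_ι_mul _ m f

theorem pd_xi_mul (i j : Fin N) (f : Gr N) :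
    pd N i (xi N j * f) = (if i = j then f else 0) - xi N j * pd N i f := by
  rw [xi, pd_ι_mul, Pi.single_apply, ite_smul, one_smul, zero_smul]

theorem pd_xi_mul_self (i : Fin N) (f : Gr N) :
    pd N i (xi N i * f) = f - xi N i * pd N i f := by
  rw [pd_xi_mul, if_pos rfl]

theorem pd_xi_mul_of_ne {i j : Fin N} (h : i ≠ j) (f : Gr N) :
    pd N i (xi N j * f) = -(xi N j * pd N i f) := by
  rw [pd_xi_mul, if_neg h, zero_sub]

theorem pd_xi (i j : Fin N) : pd N i (xi N j) = if i = j then 1 else 0 := by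
  simpa [pd_one] using pd_xi_mul i j 1

theorem pd_pd_self (i : Fin N) (f : Gr N) : pd N i (pd N i f) = 0 :=
  CliffordAlgebra.contractLeft_contractLeft _ _

theorem pd_comm (i j : Fin N) (f : Gr N) : pd N i (pd N j f) = -pd N j (pd N i f) :=
  CliffordAlgebra.contractLeft_comm _ _ _

theorem xi_sq (i : Fin N) : xi N i * xi N i = 0 := ExteriorAlgebra.ι_sq_zero _

theorem xi_comm (i j : Fin N) : xi N i * xi N j = -(xi N j * xi N i) :=
  eq_neg_of_add_eq_zero_left (ExteriorAlgebra.ι_add_mul_swap _ _)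

theorem xi_mul_xi_mul_self (i : Fin N) (f : Gr N) : xi N i * (xi N i * f) = 0 := by
  rw [← mul_assoc, xi_sq, zero_mul]

theorem sig_one : sig N 1 = 1 :=
  map_one (CliffordAlgebra.involute (Q := (0 : QuadraticForm ℂ (Fin N → ℂ))))

theorem sig_mul (f g : Gr N) : sig N (f * g) = sig N f * sig N g :=
  map_mul (CliffordAlgebra.involute (Q := (0 : QuadraticForm ℂ (Fin N → ℂ)))) f g

theorem sig_ι (m : Fin N → ℂ) : sig N (ExteriorAlgebra.ι ℂ m) = -ExteriorAlgebra.ι ℂ m :=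
  CliffordAlgebra.involute_ι m

theorem sig_xi (i : Fin N) : sig N (xi N i) = -xi N i := sig_ι _

theorem sig_sig (f : Gr N) : sig N (sig N f) = f := CliffordAlgebra.involute_involute f

theorem sig_pd (i : Fin N) (f : Gr N) : sig N (pd N i f) = -pd N i (sig N f) := by
  induction f using CliffordAlgebra.left_induction with
  | algebraMap r =>
    have h : sig N (algebraMap ℂ _ r) = algebraMap ℂ _ r :=
      AlgHom.commutes (CliffordAlgebra.involute (Q := (0 : QuadraticForm ℂ (Fin N → ℂ)))) r
    rw [h, show pd N i (algebraMap ℂ _ r) = 0 from CliffordAlgebra.contractLeft_algebraMap _ _ r]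
    simp
  | add x y hx hy => simp only [map_add, hx, hy]; abel
  | ι_mul x m hx =>
    change sig N (pd N i (ExteriorAlgebra.ι ℂ m * x)) = -pd N i (sig N (ExteriorAlgebra.ι ℂ m * x))
    rw [pd_ι_mul, sig_mul, sig_ι, map_sub, map_smul, sig_mul, sig_ι, hx, neg_mul, neg_mul,
      map_neg, pd_ι_mul]
    simp [sub_eq_add_neg]

theorem pd_mul (i : Fin N) (f g : Gr N) :
    pd N i (f * g) = pd N i f * g + sig N f * pd N i g := by
  induction f using CliffordAlgebra.left_induction with
  | algebraMap r =>
    have h : sig N (algebraMap ℂ _ r) = algebraMap ℂ _ r :=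
      AlgHom.commutes (CliffordAlgebra.involute (Q := (0 : QuadraticForm ℂ (Fin N → ℂ)))) r
    rw [h, show pd N i (algebraMap ℂ _ r) = 0 from CliffordAlgebra.contractLeft_algebraMap _ _ r,
      show pd N i (algebraMap ℂ _ r * g) = algebraMap ℂ _ r * pd N i g from
        CliffordAlgebra.contractLeft_algebraMap_mul _ r g, zero_mul, zero_add]
  | add x y hx hy => simp only [add_mul, map_add, hx, hy]; abel
  | ι_mul x m hx =>
    change pd N i (ExteriorAlgebra.ι ℂ m * x * g) = pd N i (ExteriorAlgebra.ι ℂ m * x) * g +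
      sig N (ExteriorAlgebra.ι ℂ m * x) * pd N i g
    rw [mul_assoc, pd_ι_mul, hx, pd_ι_mul, sig_mul, sig_ι]
    simp only [sub_mul, mul_add, smul_mul_assoc, neg_mul, mul_assoc]
    abel

/-- Supercommutativity, with the sign carried by `sig` instead of a parity hypothesis. -/
theorem xi_mul_comm (i : Fin N) (f : Gr N) : xi N i * sig N f = f * xi N i := by
  induction f using CliffordAlgebra.left_induction with
  | algebraMap r =>
    have h : sig N (algebraMap ℂ _ r) = algebraMap ℂ _ r :=
      AlgHom.commutes (CliffordAlgebra.involute (Q := (0 : QuadraticForm ℂ (Fin N → ℂ)))) r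
    rw [h]
    exact (Algebra.commutes r (xi N i)).symm
  | add x y hx hy => simp only [add_mul, mul_add, map_add, hx, hy]
  | ι_mul x m hx =>
    change xi N i * sig N (ExteriorAlgebra.ι ℂ m * x) = ExteriorAlgebra.ι ℂ m * x * xi N i
    rw [sig_mul, sig_ι, mul_assoc, ← hx, ← mul_assoc, ← mul_assoc, mul_neg]
    congr 1
    exact (eq_neg_of_add_eq_zero_left (ExteriorAlgebra.ι_add_mul_swap _ _)).symm

/-- The even derivation `ξ_i ∂_j`. -/
def xpd (N : ℕ) (i j : Fin N) : Gr N →ₗ[ℂ] Gr N := LinearMap.mulLeft ℂ (xi N i) ∘ₗ pd N j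

theorem xpd_apply (i j : Fin N) (f : Gr N) : xpd N i j f = xi N i * pd N j f := rfl

theorem xpd_mul (i j : Fin N) (f g : Gr N) :
    xpd N i j (f * g) = xpd N i j f * g + f * xpd N i j g := by
  simp only [xpd_apply, pd_mul, mul_add]
  rw [← mul_assoc, ← mul_assoc, xi_mul_comm, mul_assoc, mul_assoc]

theorem sig_xpd (i j : Fin N) (f : Gr N) : sig N (xpd N i j f) = xpd N i j (sig N f) := by
  simp only [xpd_apply, sig_mul, sig_xi, sig_pd, neg_mul_neg]

theorem xpd_xpd_self (i : Fin N) (f : Gr N) : xpd N i i (xpd N i i f) = xpd N i i f := by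
  simp only [xpd_apply]
  rw [pd_xi_mul_self, pd_pd_self, mul_zero, sub_zero]

theorem euler_apply (f : Gr N) : euler N f = ∑ i, xpd N i i f := by
  simp [euler, xpd]

theorem euler_mul (f g : Gr N) : euler N (f * g) = euler N f * g + f * euler N g := by
  simp only [euler_apply, xpd_mul, Finset.sum_add_distrib, Finset.sum_mul, Finset.mul_sum]

theorem euler_one : euler N 1 = 0 := by
  rw [euler_apply]
  exact Finset.sum_eq_zero fun i _ => by rw [xpd_apply, pd_one, mul_zero]

theorem euler_xi (i : Fin N) : euler N (xi N i) = xi N i := by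
  simp [euler_apply, xpd_apply, pd_xi]

theorem euler_list_prod (l : List (Gr N)) (h : ∀ x ∈ l, ∃ j, x = xi N j) :
    euler N l.prod = (l.length : ℂ) • l.prod := by
  induction l with
  | nil => simp [euler_one]
  | cons x l ih =>
    obtain ⟨j, rfl⟩ := h x (by simp)
    rw [List.prod_cons, euler_mul, euler_xi, ih fun x hx => h x (by simp [hx]), List.length_cons,
      Nat.cast_add, Nat.cast_one, add_smul, one_smul, mul_smul_comm, add_comm]

theorem xi_mul_list_prod (i : Fin N) (l : List (Fin N)) (h : i ∈ l) :
    xi N i * (l.map (xi N)).prod = 0 := by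
  induction l with
  | nil => simp at h
  | cons j l ih =>
    rw [List.map_cons, List.prod_cons]
    by_cases hij : i = j
    · rw [hij, xi_mul_xi_mul_self]
    · rw [← mul_assoc, xi_comm, neg_mul, mul_assoc, ih ((List.mem_cons.1 h).resolve_left hij),
        mul_zero, neg_zero]

theorem xi_mul_top (i : Fin N) : xi N i * top N = 0 := by
  rw [top, List.ofFn_eq_map]
  exact xi_mul_list_prod i _ (List.mem_finRange i)

theorem top_mul_xi (i : Fin N) : top N * xi N i = 0 := by
  have h : sig N (xi N i * top N) = 0 := by rw [xi_mul_top, map_zero]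
  rw [← xi_mul_comm]
  rw [sig_mul, sig_xi, neg_mul, neg_eq_zero] at h
  exact h

theorem top_mul_xi_mul (i : Fin N) (f : Gr N) : top N * (xi N i * f) = 0 := by
  rw [← mul_assoc, top_mul_xi, zero_mul]

theorem xi_mul_pd_top (i : Fin N) : xi N i * pd N i (top N) = top N := by
  have h := pd_xi_mul_self i (top N)
  rw [xi_mul_top, map_zero] at h
  exact (sub_eq_zero.1 h.symm).symm

theorem xi_mul_pd_top_of_ne {i j : Fin N} (h : i ≠ j) : xi N i * pd N j (top N) = 0 := by
  have h := pd_xi_mul_of_ne h.symm (top N)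
  rw [xi_mul_top, map_zero] at h
  exact neg_eq_zero.1 h.symm

theorem pd_top_mul_xi_of_ne {i j : Fin N} (h : i ≠ j) : pd N j (top N) * xi N i = 0 := by
  have h' := pd_mul j (top N) (xi N i)
  rwa [top_mul_xi, map_zero, pd_xi, if_neg h.symm, mul_zero, add_zero, eq_comm] at h'

theorem top_mul_top (i : Fin N) : top N * top N = 0 := by
  nth_rewrite 2 [← xi_mul_pd_top i]
  exact top_mul_xi_mul i _

theorem grPart_disjoint : Disjoint (grPart N 0) (grPart N 1) :=
  (CliffordAlgebra.evenOdd_isCompl _).disjoint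

theorem one_mem_grPart : (1 : Gr N) ∈ grPart N 0 :=
  Submodule.one_le.1 (CliffordAlgebra.one_le_evenOdd_zero _)

theorem xi_mem_grPart (i : Fin N) : xi N i ∈ grPart N 1 :=
  CliffordAlgebra.ι_mem_evenOdd_one _ _

theorem list_prod_mem_grPart (l : List (Fin N)) :
    (l.map (xi N)).prod ∈ grPart N (l.length : ZMod 2) := by
  induction l with
  | nil => simpa using one_mem_grPart
  | cons i l ih =>
    rw [List.map_cons, List.prod_cons, List.length_cons, Nat.cast_add, Nat.cast_one, add_comm]
    exact CliffordAlgebra.evenOdd_mul_le _ _ _ (Submodule.mul_mem_mul (xi_mem_grPart i) ih)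

theorem top_mem_grPart (h : Even N) : top N ∈ grPart N 0 := by
  have := list_prod_mem_grPart (List.finRange N)
  rw [List.length_finRange, (ZMod.natCast_eq_zero_iff_even).2 h, ← List.ofFn_eq_map] at this
  exact this

end Grassmann

/-! ## Brackets on free modules -/

section Free

variable {V W : Type*} [AddCommGroup V] [Module ℂ V] [AddCommGroup W] [Module ℂ W]

theorem freeD_single (k : ℕ) (v : V) :
    freeD V (Finsupp.single k v) = Finsupp.single (k + 1) v := by
  simp [freeD]

theorem freeD_apply_succ (x : Free V) (k : ℕ) : freeD V x (k + 1) = x k := by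
  induction x using Finsupp.induction_linear with
  | zero => simp
  | add f g hf hg => simp [hf, hg]
  | single k c => simp [freeD_single, Finsupp.single_apply]

theorem freeD_pow_single (k n : ℕ) (v : V) :
    (freeD V ^ n) (Finsupp.single k v) = Finsupp.single (k + n) v := by
  induction n with
  | zero => simp
  | succ n ih => rw [pow_succ', Module.End.mul_apply, ih, freeD_single, add_assoc]

/-- The `ℂ[∂]`-linear extension of a linear map. -/
abbrev freeMap (T : V →ₗ[ℂ] W) : Free V →ₗ[ℂ] Free W := Finsupp.mapRange.linearMap T

theorem freeMap_freeD (T : V →ₗ[ℂ] W) (x : Free V) :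
    freeMap T (freeD V x) = freeD W (freeMap T x) := by
  induction x using Finsupp.induction_linear with
  | zero => simp
  | add f g hf hg => simp only [map_add, hf, hg]
  | single k c => simp [freeD_single]

theorem freePart_disjoint {P P' : Submodule ℂ V} (h : Disjoint P P') :
    Disjoint (freePart V P) (freePart V P') :=
  Submodule.disjoint_def.2 fun _ hx hx' =>
    Finsupp.ext fun k => Submodule.disjoint_def.1 h _ (hx k) (hx' k)

theorem single_mem_freePart {P : Submodule ℂ V} {v : V} (h : v ∈ P) (k : ℕ) :
    Finsupp.single k v ∈ freePart V P := fun n => by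
  rw [Finsupp.single_apply]
  split_ifs
  · exact h
  · exact P.zero_mem

theorem mem_of_single_zero_mem {Q : Submodule ℂ (Free W)} (hQ : ∀ x ∈ Q, freeD W x ∈ Q)
    (F : Free V →ₗ[ℂ] Free W) (hF : ∀ x, F (freeD V x) = freeD W (F x))
    (h : ∀ v, F (Finsupp.single 0 v) ∈ Q) (x : Free V) : F x ∈ Q := by
  induction x using Finsupp.induction_linear with
  | zero => simp
  | add f g hf hg => rw [map_add]; exact add_mem hf hg
  | single k c =>
    induction k with
    | zero => exact h c
    | succ k ih => rw [← freeD_single, hF]; exact hQ _ ih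

/-- Multiplication by `∂ + λ`. -/
abbrev shiftD (V : Type*) [AddCommGroup V] [Module ℂ V] : Module.End ℂ (ℕ →₀ Free V) :=
  Finsupp.mapRange.linearMap (freeD V) + lamMul (Free V)

/-- Multiplication by `-λ`. -/
abbrev negLam (V : Type*) [AddCommGroup V] [Module ℂ V] : Module.End ℂ (ℕ →₀ Free V) :=
  -lamMul (Free V)

theorem freeMap_zero (y : Free V) : freeMap (0 : V →ₗ[ℂ] W) y = 0 := by ext; simp

theorem sesq_single (b : V →ₗ[ℂ] V →ₗ[ℂ] (ℕ →₀ Free V)) (p q : ℕ) (v w : V) :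
    sesq V b (Finsupp.single p v) (Finsupp.single q w) = (negLam V ^ p *
      shiftD V ^ q) (b v w) := by
  simp [sesq]

theorem shiftPow_apply_zero (q : ℕ) (X : ℕ →₀ Free V) :
    (shiftD V ^ q) X 0 = (freeD V ^ q) (X 0) := by
  induction q with
  | zero => simp
  | succ q ih =>
    rw [pow_succ', Module.End.mul_apply, LinearMap.add_apply, Finsupp.add_apply, lamMul_zero,
      add_zero, Finsupp.mapRange.linearMap_apply, Finsupp.mapRange_apply, ih, pow_succ',
      Module.End.mul_apply]

theorem shiftPow_apply_one (q : ℕ) (X : ℕ →₀ Free V) :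
    (shiftD V ^ q) X 1 =
      (freeD V ^ q) (X 1) + (q : ℂ) • (freeD V ^ (q - 1)) (X 0) := by
  induction q with
  | zero => simp
  | succ q ih =>
    rw [pow_succ', Module.End.mul_apply, LinearMap.add_apply, Finsupp.add_apply, lamMul_succ,
      Finsupp.mapRange.linearMap_apply, Finsupp.mapRange_apply, ih, shiftPow_apply_zero, pow_succ',
      Module.End.mul_apply, map_add, map_smul, add_assoc]
    congr 1
    cases q with
    | zero => simp
    | succ q =>
      rw [Nat.add_sub_cancel, Nat.add_sub_cancel, ← Module.End.mul_apply, ← pow_succ', ← add_smul]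
      simp

theorem negLamPow_apply_zero (p : ℕ) (X : ℕ →₀ Free V) :
    (negLam V ^ (p + 1)) X 0 = 0 := by
  rw [pow_succ', Module.End.mul_apply, LinearMap.neg_apply, Finsupp.neg_apply, lamMul_zero,
    neg_zero]

theorem negLamPow_apply_one (p : ℕ) (X : ℕ →₀ Free V) :
    (negLam V ^ (p + 2)) X 1 = 0 := by
  rw [pow_succ', Module.End.mul_apply, LinearMap.neg_apply, Finsupp.neg_apply, lamMul_succ,
    negLamPow_apply_zero, smul_zero, neg_zero]

variable (b₀ b₁ b₂ : V →ₗ[ℂ] V →ₗ[ℂ] V)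

theorem bracketOf_zero (v w : V) : bracketOf b₀ b₁ b₂ v w 0 =
    Finsupp.single 0 (b₀ v w) + Finsupp.single 1 (b₁ v w) := by
  simp [bracketOf]

theorem bracketOf_one (v w : V) : bracketOf b₀ b₁ b₂ v w 1 = Finsupp.single 0 (b₂ v w) := by
  simp [bracketOf]

theorem bracketOf_add_two (v w : V) (n : ℕ) : bracketOf b₀ b₁ b₂ v w (n + 2) = 0 := by
  simp [bracketOf]

/-- `[∂^p a_λ b]` is divisible by `λ^p`, so the constant term sees only the coefficient `x 0`. This
permits corrections in `∂ M` to `L` without changing `L_(0)`. -/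
theorem sesq_apply_zero (x y : Free V) : sesq V (bracketOf b₀ b₁ b₂) x y 0 =
    freeMap (b₀ (x 0)) y + freeD V (freeMap (b₁ (x 0)) y) := by
  induction x using Finsupp.induction_linear with
  | zero =>
    simp only [map_zero, LinearMap.zero_apply, Finsupp.coe_zero, Pi.zero_apply, freeMap_zero,
      add_zero]
  | add f g hf hg =>
    rw [map_add, LinearMap.add_apply, Finsupp.add_apply, hf, hg]
    have h : ∀ b : V →ₗ[ℂ] V →ₗ[ℂ] V, freeMap (b ((f + g) 0)) y =
        freeMap (b (f 0)) y + freeMap (b (g 0)) y := fun b => by ext; simp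
    rw [h, h, map_add]
    abel
  | single p v =>
    induction y using Finsupp.induction_linear with
    | zero => simp
    | add f g hf hg => simp only [map_add, Finsupp.add_apply, hf, hg]; abel
    | single q w =>
      rw [sesq_single, Module.End.mul_apply]
      cases p with
      | zero =>
        rw [pow_zero, Module.End.one_apply, shiftPow_apply_zero, bracketOf_zero, map_add,
          freeD_pow_single, freeD_pow_single]
        simp [freeD_single, add_comm]
      | succ p =>
        rw [negLamPow_apply_zero, Finsupp.single_eq_of_ne (by simp), map_zero, map_zero,
          freeMap_zero, map_zero, add_zero]

theorem sesq_single_zero_apply_one (v w : V) (q : ℕ) :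
    sesq V (bracketOf b₀ b₁ b₂) (Finsupp.single 0 v) (Finsupp.single q w) 1 =
      Finsupp.single q (b₂ v w) + (q : ℂ) • (Finsupp.single (q - 1) (b₀ v w) +
        Finsupp.single q (b₁ v w)) := by
  rw [sesq_single, pow_zero, one_mul, shiftPow_apply_one, bracketOf_one, bracketOf_zero, map_add,
    freeD_pow_single, freeD_pow_single, freeD_pow_single]
  cases q with
  | zero => simp
  | succ q => simp [add_comm]

theorem sesq_single_add_two_apply_one (v : V) (p : ℕ) (y : Free V) :
    sesq V (bracketOf b₀ b₁ b₂) (Finsupp.single (p + 2) v) y 1 = 0 := by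
  induction y using Finsupp.induction_linear with
  | zero => simp
  | add f g hf hg => simp only [map_add, Finsupp.add_apply, hf, hg, add_zero]
  | single q w => rw [sesq_single, Module.End.mul_apply, negLamPow_apply_one]

/-- A `∂`-stable subspace that contains the coefficients of the brackets of all generators contains
the coefficients of all brackets. -/
theorem sesq_mem {Q : Submodule ℂ (Free V)} (hQ : ∀ x ∈ Q, freeD V x ∈ Q)
    {b : V →ₗ[ℂ] V →ₗ[ℂ] (ℕ →₀ Free V)} (h : ∀ v w n, b v w n ∈ Q) (x y : Free V) (n : ℕ) :
    sesq V b x y n ∈ Q := by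
  have hlam : ∀ X : ℕ →₀ Free V, (∀ n, X n ∈ Q) → ∀ n, lamMul (Free V) X n ∈ Q := by
    rintro X hX (_ | n)
    · rw [lamMul_zero]; exact zero_mem _
    · rw [lamMul_succ]; exact Q.smul_mem _ (hX n)
  have h1 : ∀ p, ∀ X : ℕ →₀ Free V, (∀ n, X n ∈ Q) → ∀ n, (negLam V ^ p) X n ∈ Q := by
    intro p
    induction p with
    | zero => exact fun X hX => hX
    | succ p ih =>
      intro X hX n
      rw [pow_succ', Module.End.mul_apply]
      exact neg_mem (hlam _ (ih X hX) n)
  have h2 : ∀ q, ∀ X : ℕ →₀ Free V, (∀ n, X n ∈ Q) → ∀ n,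
      (shiftD V ^ q) X n ∈ Q := by
    intro q
    induction q with
    | zero => exact fun X hX => hX
    | succ q ih =>
      intro X hX n
      rw [pow_succ', Module.End.mul_apply]
      exact add_mem (hQ _ (ih X hX n)) (hlam _ (ih X hX) n)
  induction x using Finsupp.induction_linear with
  | zero => simp
  | add f g hf hg => rw [map_add]; exact add_mem hf hg
  | single p v =>
    induction y using Finsupp.induction_linear with
    | zero => simp
    | add f g hf hg => rw [map_add]; exact add_mem hf hg
    | single q w =>
      rw [sesq_single, Module.End.mul_apply]
      exact h1 p _ (h2 q _ (h v w)) n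

end Free

/-! ## Subalgebras of `W_N` and `K_N` -/

section Copy

/-- The subspace `U` is spanned over `ℂ[∂]` by the coefficients of the brackets of its elements. -/
def IsPerfect {M : Type*} [AddCommGroup M] [Module ℂ M] (c : ConfData M) (U : Submodule ℂ M) :
    Prop :=
  ∀ Q : Submodule ℂ M, (∀ u ∈ U, ∀ v ∈ U, ∀ n, c.br u v n ∈ Q) → (∀ x ∈ Q, c.D x ∈ Q) → U ≤ Q

theorem IsCopy.derived_eq_top {R : Type*} [AddCommGroup R] [Module ℂ R]
    [LieConformalSuperalgebra R] {M : Type*} [AddCommGroup M] [Module ℂ M] {c : ConfData M}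
    {U : Submodule ℂ M} (h : IsCopy R c U) (hU : IsPerfect c U) : derived R = ⊤ := by
  obtain ⟨ι, hinj, hr, -, hd, hb⟩ := h
  have hle := hU ((derived R).map ι) (by
    rw [← hr]
    rintro _ ⟨a, rfl⟩ _ ⟨b, rfl⟩ n
    rw [← hb]
    exact Submodule.mem_map_of_mem (Submodule.subset_span ⟨a, b, n, rfl⟩)) (by
    rintro _ ⟨a, ha, rfl⟩
    rw [← hd]
    exact Submodule.mem_map_of_mem (del_mem_derived a ha))
  rw [eq_top_iff]
  intro a _
  obtain ⟨b, hb, e⟩ := hle (hr ▸ LinearMap.mem_range_self ι a)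
  exact hinj e ▸ hb

/-- The conclusions on the annihilation algebra for subalgebras with a suitable element `L`. -/
theorem IsCopy.annihilation.{u₁, u₂} {R : Type u₁} [AddCommGroup R] [Module ℂ R]
    [LieConformalSuperalgebra R] (S : Generators R) {M : Type*} [AddCommGroup M] [Module ℂ M]
    {c : ConfData M} {U : Submodule ℂ M} (h : IsCopy R c U) (hU : IsPerfect c U)
    (hdis : Disjoint (c.part 0) (c.part 1)) {L : M} (hL : L ∈ U) (hL0 : L ∈ c.part 0)
    (T : M →ₗ[ℂ] M) (hT : ∀ v ∈ U, c.br L v 0 = c.D v + T v) (k : ℂ)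
    (hT3 : ∀ v ∈ U, T (T (T v)) = k • T v) :
    Subsingleton (H2 (Ann S)) ∧ IsUniversalCentralExtension.{u₁, u₁, u₂} (center (Ann S)).mkQ := by
  have hder := h.derived_eq_top hU
  obtain ⟨ι, hinj, hr, hp, hd, hb⟩ := h
  obtain ⟨L', rfl⟩ : L ∈ LinearMap.range ι := hr ▸ hL
  -- `ι` is only known to map each part into the corresponding one. Disjointness of the two parts in
  -- `M` gives the converse for `L'`.
  have hL' : L' ∈ part R 0 := by
    obtain ⟨a, ha, b, hb, rfl⟩ := exists_parts R L'
    have : ι b = 0 := Submodule.disjoint_def.1 hdis _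
      (by simpa using sub_mem hL0 (hp 0 a ha)) (hp 1 b hb)
    rw [(map_eq_zero_iff ι hinj).1 this, add_zero]
    exact ha
  -- The defect of `L_(0)` from `∂`. Under `ι` it becomes `T`, so the cubic relation, and with it
  -- local finiteness, carries over.
  let N' : R →ₗ[ℂ] R := Finsupp.lapply 0 ∘ₗ lbr R L' - del R
  have hN : ∀ a, lbr R L' a 0 = del R a + N' a := fun a => (add_sub_cancel _ _).symm
  have hιN : ∀ a, ι (N' a) = T (ι a) := fun a => by
    have h1 := hT (ι a) (hr ▸ LinearMap.mem_range_self ι a)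
    rw [← hb, ← hd, hN, map_add] at h1
    exact add_left_cancel h1
  have hlf : IsLocFin N' := isLocFin_of_pow_three N' k fun a => hinj <| by
    rw [map_smul, hιN, hιN, hιN]
    exact hT3 _ (hr ▸ LinearMap.mem_range_self ι a)
  exact ⟨subsingleton_H2 S hL' hN hlf hder, isUniversalCentralExtension_mkQ_center S hL' hN hlf hder⟩

end Copy

theorem freeMap_id {V : Type*} [AddCommGroup V] [Module ℂ V] (x : Free V) :
    freeMap LinearMap.id x = x := by
  rw [freeMap, Finsupp.mapRange.linearMap_id, LinearMap.id_apply]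

/-! ### The algebras `W_N` -/

section ConfW

variable (N : ℕ)

theorem confW_br_zero (x y : Free (WGen N)) : (confW N).br x y 0 =
    freeMap (wBr₀ N (x 0)) y + freeD _ (freeMap (wBr₁ N (x 0)) y) :=
  sesq_apply_zero _ _ _ x y

theorem wPart_disjoint : Disjoint (wPart N 0) (wPart N 1) := by
  refine Submodule.disjoint_def.2 fun x hx hx' => Prod.ext (funext fun k => ?_) ?_
  · exact Submodule.disjoint_def.1 grPart_disjoint.symm _ (hx.1 k trivial) (hx'.1 k trivial)
  · exact Submodule.disjoint_def.1 grPart_disjoint _ hx.2 hx'.2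

theorem confW_part_disjoint : Disjoint ((confW N).part 0) ((confW N).part 1) :=
  freePart_disjoint (wPart_disjoint N)

theorem wBr₀_neg_one : wBr₀ N (0, -1) = 0 := by
  refine LinearMap.ext fun y => Prod.ext (funext fun k => ?_) ?_ <;> simp [wBr₀, pd_one]

theorem wBr₁_neg_one : wBr₁ N (0, -1) = LinearMap.id := by
  refine LinearMap.ext fun y => ?_
  simp [wBr₁]

theorem confW_br_neg_one (v : Free (WGen N)) :
    (confW N).br (Finsupp.single 0 (0, -1)) v 0 = freeD _ v := by
  rw [confW_br_zero, Finsupp.single_eq_same, wBr₀_neg_one, wBr₁_neg_one, freeMap_zero, zero_add,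
    freeMap_id]

theorem mem_of_freeD_stable {V : Type*} [AddCommGroup V] [Module ℂ V] {Q : Submodule ℂ (Free V)}
    (hQ : ∀ x ∈ Q, freeD V x ∈ Q) (h : ∀ v, Finsupp.single 0 v ∈ Q) (x : Free V) : x ∈ Q :=
  mem_of_single_zero_mem hQ LinearMap.id (fun _ => rfl) h x

/-- The first product with `-1` is the identity on `W(N)` and multiplication by `2` on `Λ(N)`, hence
invertible on generators. -/
theorem isPerfect_confW : IsPerfect (confW N) ⊤ := by
  intro Q hQ hD x _
  have key : ∀ y : WGen N, Finsupp.single 0 (y.1, (2 : ℂ) • y.2) ∈ Q := fun y => by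
    have h : sesq _ (bracketOf (wBr₀ N) (wBr₁ N) (wBr₂ N)) (Finsupp.single 0 (0, -1))
        (Finsupp.single 0 y) 1 ∈ Q := hQ _ trivial _ trivial 1
    rw [sesq_single_zero_apply_one, Nat.cast_zero, zero_smul, add_zero] at h
    have e : wBr₂ N (0, -1) y = (y.1, (2 : ℂ) • y.2) := by
      refine Prod.ext (funext fun k => ?_) ?_ <;> simp [wBr₂, two_smul]
    rwa [e] at h
  refine mem_of_freeD_stable hD (fun y => ?_) x
  have h := add_mem (key (y.1, 0)) (key (0, (1 / 2 : ℂ) • y.2))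
  have e : (y.1, (2 : ℂ) • (0 : Gr N)) + ((0 : Fin N → Gr N), (2 : ℂ) • (1 / 2 : ℂ) • y.2) = y := by
    refine Prod.ext ?_ ?_ <;> simp [smul_smul]
  rwa [← Finsupp.single_add, e] at h

end ConfW

/-! ### The algebras `K_N`, `K_4'` and `CK_6` -/

section ConfK

variable (N : ℕ)

theorem confK_br_zero (x y : Free (Gr N)) : (confK N).br x y 0 =
    freeMap (kBr₀ N (x 0)) y + freeD _ (freeMap (kBr₁ N (x 0)) y) :=
  sesq_apply_zero _ _ _ x y

theorem confK_part_disjoint : Disjoint ((confK N).part 0) ((confK N).part 1) :=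
  freePart_disjoint grPart_disjoint

theorem kBr₀_apply (f g : Gr N) :
    kBr₀ N f g = (1 / 2 : ℂ) • ∑ i, pd N i (sig N f) * pd N i g := by
  simp [kBr₀]

theorem kBr₁_apply (f g : Gr N) : kBr₁ N f g = ((1 / 2 : ℂ) • euler N f - f) * g := rfl

theorem kBr₂_apply (f g : Gr N) :
    kBr₂ N f g = (1 / 2 : ℂ) • euler N (f * g) - (2 : ℂ) • (f * g) := by
  rw [euler_mul]
  simp [kBr₂]

theorem kBr₀_neg_one : kBr₀ N (-1) = 0 := by
  refine LinearMap.ext fun f => ?_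
  rw [kBr₀_apply, map_neg, sig_one]
  simp [pd_one]

theorem kBr₁_neg_one : kBr₁ N (-1) = LinearMap.id := by
  refine LinearMap.ext fun f => ?_
  rw [kBr₁_apply, map_neg, euler_one]
  simp

theorem kBr₂_neg_one (f : Gr N) : kBr₂ N (-1) f = (2 : ℂ) • f - (1 / 2 : ℂ) • euler N f := by
  rw [kBr₂_apply, neg_one_mul, map_neg, smul_neg, smul_neg]
  abel

theorem confK_br_neg_one {x : Free (Gr N)} (hx : x 0 = -1) (v : Free (Gr N)) :
    (confK N).br x v 0 = freeD _ v := by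
  rw [confK_br_zero, hx, kBr₀_neg_one, kBr₁_neg_one, freeMap_zero, zero_add,
    freeMap_id]

theorem confK_br_neg_one_one (q : ℕ) (f : Gr N) :
    (confK N).br (Finsupp.single 0 (-1)) (Finsupp.single q f) 1 =
      Finsupp.single q ((2 + q : ℂ) • f - (1 / 2 : ℂ) • euler N f) := by
  refine (sesq_single_zero_apply_one _ _ _ _ _ _).trans ?_
  rw [kBr₀_neg_one, kBr₁_neg_one, kBr₂_neg_one, LinearMap.zero_apply, Finsupp.single_zero, zero_add,
    LinearMap.id_apply, Finsupp.smul_single, ← Finsupp.single_add, add_smul]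
  congr 1
  abel

theorem confK_br_xi (j : Fin N) (f : Gr N) :
    (confK N).br (Finsupp.single 0 (xi N j)) (Finsupp.single 0 f) 0 =
      -((1 / 2 : ℂ) • (Finsupp.single 0 (pd N j f) + Finsupp.single 1 (xi N j * f))) := by
  rw [confK_br_zero, Finsupp.single_eq_same]
  have h0 : kBr₀ N (xi N j) f = -((1 / 2 : ℂ) • pd N j f) := by
    rw [kBr₀_apply, ← smul_neg, Finset.sum_eq_single j]
    · rw [sig_xi, map_neg, pd_xi, if_pos rfl, neg_one_mul]
    · intro i _ hi
      rw [sig_xi, map_neg, pd_xi, if_neg hi, neg_zero, zero_mul]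
    · simp
  have h1 : kBr₁ N (xi N j) f = -((1 / 2 : ℂ) • (xi N j * f)) := by
    rw [kBr₁_apply, euler_xi, sub_mul, smul_mul_assoc]
    nth_rewrite 2 [← one_smul ℂ (xi N j * f)]
    rw [← sub_smul, ← neg_smul]
    norm_num
  rw [Finsupp.mapRange.linearMap_apply, Finsupp.mapRange.linearMap_apply, Finsupp.mapRange_single,
    Finsupp.mapRange_single, freeD_single, h0, h1, Finsupp.single_neg, Finsupp.single_neg,
    ← Finsupp.smul_single, ← Finsupp.smul_single, ← neg_add, ← smul_add]

/-- The element `f - ξ_j ∂_j f = ∂_j (ξ_j f)` is a multiple of `(ξ_j)_(0) (ξ_j f)`. -/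
theorem single_sub_xpd_mem {Q : Submodule ℂ (Free (Gr N))} (j : Fin N) (f : Gr N)
    (h : (confK N).br (Finsupp.single 0 (xi N j)) (Finsupp.single 0 (xi N j * f)) 0 ∈ Q) :
    Finsupp.single 0 (f - xpd N j j f) ∈ Q := by
  rw [confK_br_xi, pd_xi_mul_self, xi_mul_xi_mul_self, Finsupp.single_zero, add_zero] at h
  have := Q.smul_mem (-2 : ℂ) h
  rwa [smul_neg, smul_smul, ← neg_smul, show -((-2 : ℂ) * (1 / 2)) = 1 by norm_num, one_smul]
    at this

/-- The first product with `-1` gives `2f - E f / 2`, where `E` is the Euler operator; summing the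
elements `f - ξ_j ∂_j f` over `j` gives `N f - E f`. Eliminating `E f` leaves `(2 - N/2) f`, and the
factor is zero exactly for `N = 4`. -/
theorem isPerfect_confK (hN : N ≠ 4) : IsPerfect (confK N) ⊤ := by
  intro Q hQ hD x _
  refine mem_of_freeD_stable hD (fun f => ?_) x
  have h1 : Finsupp.single 0 ((2 : ℂ) • f - (1 / 2 : ℂ) • euler N f) ∈ Q := by
    have h := hQ (Finsupp.single 0 (-1)) trivial (Finsupp.single 0 f) trivial 1
    rwa [confK_br_neg_one_one, Nat.cast_zero, add_zero] at h
  have h2 : Finsupp.single 0 ((N : ℂ) • f - euler N f) ∈ Q := by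
    have h : ∑ j : Fin N, Finsupp.single 0 (f - xpd N j j f) ∈ Q :=
      Q.sum_mem fun j _ => single_sub_xpd_mem N j f (hQ _ trivial _ trivial 0)
    rw [← Finsupp.single_finsetSum, Finset.sum_sub_distrib, ← euler_apply] at h
    simpa [← Nat.cast_smul_eq_nsmul ℂ] using h
  have h3 := sub_mem h1 (Q.smul_mem (1 / 2 : ℂ) h2)
  rw [Finsupp.smul_single, ← Finsupp.single_sub, smul_sub, sub_sub_sub_cancel_right, smul_smul,
    ← sub_smul, ← Finsupp.smul_single] at h3
  refine (Q.smul_mem_iff (s := (2 - 1 / 2 * N : ℂ)) fun h0 => hN ?_).1 h3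
  have : (N : ℂ) = (4 : ℕ) := by push_cast; linear_combination -2 * h0
  exact_mod_cast this

theorem single_sub_xpd_mem_subK4' (j : Fin 4) (f : Gr 4) :
    Finsupp.single 0 (f - xpd 4 j j f) ∈ subK4' :=
  single_sub_xpd_mem 4 j f (Submodule.subset_span ⟨_, _, _, rfl⟩)

theorem single_mem_subK4' {j : Fin 4} {f : Gr 4} (h : pd 4 j f = 0) :
    Finsupp.single 0 f ∈ subK4' := by
  simpa [xpd_apply, h] using single_sub_xpd_mem_subK4' j f

theorem single_xi_mem_subK4' (i : Fin 4) : Finsupp.single 0 (xi 4 i) ∈ subK4' := by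
  obtain ⟨j, hj⟩ := exists_ne i
  exact single_mem_subK4' (j := j) (by rw [pd_xi, if_neg hj])

theorem single_neg_one_mem_subK4' : Finsupp.single 0 (-1) ∈ subK4' :=
  single_mem_subK4' (j := 0) (by rw [map_neg, pd_one, neg_zero])

/-- For `f` free of `ξ_j`, the Euler elimination runs over the three other variables and leaves the
factor `2 - 3/2`. All products in `K_4` are built from such `f` and from `∂Λ(4)`: the terms `∂_i A
∂_i B` are free of `ξ_i`, and the `λ`-coefficient is `-1/2` times the sum over `i` of `AB - ξ_i
∂_i(AB)`. -/
theorem isPerfect_subK4' : IsPerfect (confK 4) subK4' := by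
  intro Q hQ hD
  -- elements of `Λ(4)` not involving `ξ_j`
  have h0 : ∀ (j : Fin 4) (f : Gr 4), pd 4 j f = 0 → Finsupp.single 0 f ∈ Q := by
    intro j f hf
    have h1 : Finsupp.single 0 ((2 : ℂ) • f - (1 / 2 : ℂ) • euler 4 f) ∈ Q := by
      have h := hQ _ single_neg_one_mem_subK4' _ (single_mem_subK4' hf) 1
      rwa [confK_br_neg_one_one, Nat.cast_zero, add_zero] at h
    have h2 : ∀ i ∈ Finset.univ.erase j, Finsupp.single 0 (f - xpd 4 i i f) ∈ Q := by
      intro i hi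
      refine single_sub_xpd_mem 4 i f (hQ _ (single_xi_mem_subK4' i) _
        (single_mem_subK4' (j := j) ?_) 0)
      rw [pd_xi_mul_of_ne (Finset.ne_of_mem_erase hi).symm, hf, mul_zero, neg_zero]
    have h3 : Finsupp.single 0 ((3 : ℂ) • f - euler 4 f) ∈ Q := by
      have h := Q.sum_mem h2
      have e : euler 4 f = ∑ i ∈ Finset.univ.erase j, xpd 4 i i f := by
        rw [euler_apply, ← Finset.add_sum_erase _ _ (Finset.mem_univ j), xpd_apply, hf, mul_zero,
          zero_add]
      rw [← Finsupp.single_finsetSum, Finset.sum_sub_distrib, ← e] at h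
      simpa [← Nat.cast_smul_eq_nsmul ℂ] using h
    have h4 := sub_mem h1 (Q.smul_mem (1 / 2 : ℂ) h3)
    rw [Finsupp.smul_single, ← Finsupp.single_sub, smul_sub, sub_sub_sub_cancel_right, smul_smul,
      ← sub_smul, ← Finsupp.smul_single] at h4
    exact (Q.smul_mem_iff (by norm_num)).1 h4
  have hsub : ∀ (j : Fin 4) (f : Gr 4), Finsupp.single 0 (f - xpd 4 j j f) ∈ Q := by
    refine fun j f => h0 j _ ?_
    rw [xpd_apply, map_sub, pd_xi_mul_self, pd_pd_self, mul_zero, sub_zero, sub_self]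
  have hpd : ∀ (j : Fin 4) (f g : Gr 4), Finsupp.single 0 (pd 4 j f * pd 4 j g) ∈ Q := by
    refine fun j f g => h0 j _ ?_
    rw [pd_mul, pd_pd_self, pd_pd_self, zero_mul, mul_zero, add_zero]
  -- Split `f = (f - ξ_0 ∂_0 f) + ξ_0 ∂_0 f`. The first summand is free of `ξ_0`, and `∂` of the
  -- second is a multiple of `(ξ_0)_(0) ∂_0 f`.
  have hone : ∀ f : Gr 4, Finsupp.single 1 f ∈ Q := by
    intro f
    have h1 : Finsupp.single 1 (f - xpd 4 0 0 f) ∈ Q := by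
      have := hD _ (hsub 0 f)
      change freeD _ _ ∈ Q at this
      rwa [freeD_single] at this
    have h2 : Finsupp.single 1 (xpd 4 0 0 f) ∈ Q := by
      have h := hQ _ (single_xi_mem_subK4' 0) _ (single_mem_subK4' (pd_pd_self 0 f)) 0
      rw [confK_br_xi, pd_pd_self, Finsupp.single_zero, zero_add] at h
      have := Q.smul_mem (-2 : ℂ) h
      rwa [smul_neg, smul_smul, ← neg_smul, show -((-2 : ℂ) * (1 / 2)) = 1 by norm_num, one_smul]
        at this
    simpa [← Finsupp.single_add] using add_mem h1 h2
  refine Submodule.span_le.2 ?_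
  rintro _ ⟨a, b, n, rfl⟩
  refine sesq_mem hD (fun f g n => ?_) a b n
  match n with
  | 0 =>
    rw [bracketOf_zero, kBr₀_apply, ← Finsupp.smul_single, Finsupp.single_finsetSum]
    exact add_mem (Q.smul_mem _ (Q.sum_mem fun i _ => hpd i _ _)) (hone _)
  | 1 =>
    have h : ∑ i : Fin 4, Finsupp.single 0 (f * g - xpd 4 i i (f * g)) ∈ Q :=
      Q.sum_mem fun i _ => hsub i _
    rw [← Finsupp.single_finsetSum, Finset.sum_sub_distrib, ← euler_apply] at h
    have h' := Q.smul_mem (-(1 / 2) : ℂ) h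
    rw [bracketOf_one, kBr₂_apply]
    convert h' using 1
    rw [Finsupp.smul_single, smul_sub, Finset.sum_const, Finset.card_univ, Fintype.card_fin,
      ← Nat.cast_smul_eq_nsmul ℂ, smul_smul, neg_smul, sub_neg_eq_add, add_comm, sub_eq_add_neg,
      ← neg_smul]
    norm_num
  | n + 2 => rw [bracketOf_add_two]; exact zero_mem _

theorem neg_ckGen_one_apply_zero : (-ckGen 1 0) 0 = -1 := by
  simp [ckGen]

theorem ckGen_mem (s : Equiv.Perm (Fin 6)) {r : ℕ} (hr : r ≤ 3) : ckGen s r ∈ subCK6 :=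
  Submodule.subset_span ⟨s, r, 0, hr, rfl⟩

/-- Both summands of a generator have conformal weight `2 - r/2`: the degree `6 - r` of the dual is
compensated by the `3 - r` derivatives. The weight is non-zero for `r ≤ 3`, which makes `CK_6`
perfect. -/
theorem confK_br_ckGen (s : Equiv.Perm (Fin 6)) {r : ℕ} (hr : r ≤ 3) :
    (confK 6).br (-ckGen 1 0) (ckGen s r) 1 = (2 - r / 2 : ℂ) • ckGen s r := by
  have hmem : ∀ x ∈ List.ofFn fun j => xi 6 (s j), ∃ j, x = xi 6 j := by
    intro x hx
    obtain ⟨j, rfl⟩ := (List.mem_ofFn' _ _).1 hx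
    exact ⟨_, rfl⟩
  have h1 := euler_list_prod _ fun x hx => hmem x (List.mem_of_mem_take (i := r) hx)
  have h2 := euler_list_prod _ fun x hx => hmem x (List.mem_of_mem_drop (i := r) hx)
  -- The part of `L` with `∂³` contributes multiples of `λ³`, which the first product does not see.
  have hL : ∃ y, -ckGen 1 0 = Finsupp.single 0 (-1) + Finsupp.single (1 + 2) y := by
    rw [ckGen, neg_sub, sub_eq_add_neg, add_comm, ← Finsupp.single_neg, Finsupp.smul_single]
    exact ⟨_, rfl⟩
  obtain ⟨y, hy⟩ := hL
  have h3 : ∀ v, (confK 6).br (Finsupp.single (1 + 2) y) v 1 = 0 :=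
    sesq_single_add_two_apply_one _ _ _ _ _
  rw [hy, map_add, LinearMap.add_apply, Finsupp.add_apply, h3, add_zero, ckGen, map_sub,
    map_smul, Finsupp.sub_apply, Finsupp.smul_apply, confK_br_neg_one_one, confK_br_neg_one_one,
    h1, h2, smul_sub]
  rw [List.length_take, List.length_drop, List.length_ofFn, min_eq_left (by omega), smul_smul,
    smul_smul, ← sub_smul, ← sub_smul, smul_comm (2 - r / 2 : ℂ), Finsupp.smul_single (2 - r / 2 : ℂ),
    Finsupp.smul_single (2 - r / 2 : ℂ)]
  have e1 : (2 + (0 : ℕ) - 1 / 2 * r : ℂ) = 2 - r / 2 := by push_cast; ring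
  have e2 : (2 + (3 - r : ℕ) - 1 / 2 * (6 - r : ℕ) : ℂ) = 2 - r / 2 := by
    rw [Nat.cast_sub (by omega), Nat.cast_sub (by omega)]
    push_cast
    ring
  rw [e1, e2]

theorem isPerfect_subCK6 : IsPerfect (confK 6) subCK6 := by
  intro Q hQ hD
  refine Submodule.span_le.2 ?_
  rintro _ ⟨s, r, k, hr, rfl⟩
  induction k with
  | zero =>
    have h := hQ _ (neg_mem (ckGen_mem 1 (Nat.zero_le 3))) _ (ckGen_mem s hr) 1
    rw [confK_br_ckGen s hr] at h
    refine (Q.smul_mem_iff fun h0 => ?_).1 h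
    have : (r : ℂ) = (4 : ℕ) := by push_cast; linear_combination -2 * h0
    have : r = 4 := by exact_mod_cast this
    omega
  | succ k ih =>
    rw [pow_succ', Module.End.mul_apply]
    exact hD _ ih

theorem neg_ckGen_mem_part : -ckGen 1 0 ∈ (confK 6).part 0 := by
  refine neg_mem (sub_mem (single_mem_freePart ?_ 0) (Submodule.smul_mem _ _
    (single_mem_freePart ?_ _)))
  · simpa using one_mem_grPart
  · exact top_mem_grPart (N := 6) (by decide)

end ConfK

/-! ## The algebras `S_{N,a}` and `S̃_N` -/

section Special

variable (N : ℕ)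

/-- The adjoint action of `ξ_i ∂_j` on generators of `W_N`. -/
def adXi (i j : Fin N) : WGen N →ₗ[ℂ] WGen N := wBr₀ N (Pi.single j (xi N i), 0)

/-- Multiplication by `1 + ε ξ_1 ⋯ ξ_N`. -/
def twist (ε : ℂ) : WGen N →ₗ[ℂ] WGen N :=
  (LinearMap.pi fun i => LinearMap.mulLeft ℂ (1 + ε • top N) ∘ₗ LinearMap.proj i).prodMap
    (LinearMap.mulLeft ℂ (1 + ε • top N))

/-- The common generalization of `S_{N,a}` and `S̃_N`. -/
def special (a ε : ℂ) : Submodule ℂ (Free (WGen N)) :=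
  LinearMap.ker (dvg N a ∘ₗ freeMap (twist N ε))

/-- The divergence `∑ (-1)^{p(P_i)} ∂_i P_i + a f` of a generator. -/
def divGen (a : ℂ) : WGen N →ₗ[ℂ] Gr N :=
  (∑ i, pd N i ∘ₗ sig N ∘ₗ LinearMap.proj i) ∘ₗ LinearMap.fst ℂ (Fin N → Gr N) (Gr N)
    + a • LinearMap.snd ℂ (Fin N → Gr N) (Gr N)

/-- The divergence-free field `(∂_i g) ∂_j + (∂_j g) ∂_i`, up to signs. -/
def rotGen (i j : Fin N) : Gr N →ₗ[ℂ] WGen N :=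
  LinearMap.inl ℂ (Fin N → Gr N) (Gr N) ∘ₗ
    (LinearMap.single ℂ (fun _ : Fin N => Gr N) j ∘ₗ sig N ∘ₗ pd N i +
      LinearMap.single ℂ (fun _ : Fin N => Gr N) i ∘ₗ sig N ∘ₗ pd N j)

/-- The field `g ∂_i`, up to sign. -/
def fieldGen (i : Fin N) : Gr N →ₗ[ℂ] WGen N :=
  LinearMap.inl ℂ (Fin N → Gr N) (Gr N) ∘ₗ LinearMap.single ℂ (fun _ : Fin N => Gr N) i ∘ₗ sig N

/-- The divergence-free element `∂_i h + (∂ - a) h ∂_i`, up to signs. -/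
def potential (a : ℂ) (i : Fin N) : Free (Gr N) →ₗ[ℂ] Free (WGen N) :=
  freeMap (LinearMap.inr ℂ (Fin N → Gr N) (Gr N) ∘ₗ pd N i - a • fieldGen N i) +
    freeD (WGen N) ∘ₗ freeMap (fieldGen N i)

variable {N}

theorem adXi_fst (i j k : Fin N) (y : WGen N) :
    (adXi N i j y).1 k = xpd N i j (y.1 k) - if k = j then y.1 i else 0 := by
  change ∑ m, ((Pi.single j (xi N i) : Fin N → Gr N) m * pd N m (y.1 k) +
    pd N m (sig N ((Pi.single j (xi N i) : Fin N → Gr N) k)) * y.1 m) = _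
  rw [Finset.sum_add_distrib, Finset.sum_eq_single j (fun m _ hm => by simp [hm]) (by simp),
    Pi.single_eq_same, xpd_apply, sub_eq_add_neg]
  congr 1
  split_ifs with h
  · rw [h, Pi.single_eq_same, sig_xi]
    simp [pd_xi]
  · simp [h]

theorem adXi_snd (i j : Fin N) (y : WGen N) : (adXi N i j y).2 = xpd N i j y.2 := by
  change ∑ m, ((Pi.single j (xi N i) : Fin N → Gr N) m * pd N m y.2 +
    sig N (pd N m 0 * y.1 m)) = _
  rw [Finset.sum_add_distrib, Finset.sum_eq_single j (fun m _ hm => by simp [hm]) (by simp),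
    Pi.single_eq_same, xpd_apply]
  simp

theorem twist_fst (ε : ℂ) (y : WGen N) (k : Fin N) :
    (twist N ε y).1 k = (1 + ε • top N) * y.1 k := rfl

theorem twist_snd (ε : ℂ) (y : WGen N) : (twist N ε y).2 = (1 + ε • top N) * y.2 := rfl

theorem divGen_apply (a : ℂ) (y : WGen N) :
    divGen N a y = ∑ i, pd N i (sig N (y.1 i)) + a • y.2 := by
  simp [divGen]

theorem rotGen_fst (i j k : Fin N) (g : Gr N) : (rotGen N i j g).1 k =
    (if k = j then sig N (pd N i g) else 0) + if k = i then sig N (pd N j g) else 0 := by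
  simp [rotGen, Pi.single_apply]

theorem rotGen_snd (i j : Fin N) (g : Gr N) : (rotGen N i j g).2 = 0 := by
  simp [rotGen]

theorem fieldGen_fst (i k : Fin N) (g : Gr N) :
    (fieldGen N i g).1 k = if k = i then sig N g else 0 := by
  simp [fieldGen, Pi.single_apply]

theorem fieldGen_snd (i : Fin N) (g : Gr N) : (fieldGen N i g).2 = 0 := by
  simp [fieldGen]

theorem pd_xpd_of_ne {i j : Fin N} (h : i ≠ j) (k : Fin N) (g : Gr N) :
    pd N i (xpd N j k g) = xpd N j k (pd N i g) := by
  rw [xpd_apply, xpd_apply, pd_xi_mul_of_ne h, pd_comm, mul_neg, neg_neg]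

theorem pd_xpd_self (i k : Fin N) (g : Gr N) :
    pd N i (xpd N i k g) = pd N k g + xpd N i k (pd N i g) := by
  rw [xpd_apply, xpd_apply, pd_xi_mul_self, pd_comm, mul_neg, sub_neg_eq_add]

theorem xpd_pd (i k : Fin N) (g : Gr N) : xpd N i k (pd N k g) = 0 := by
  rw [xpd_apply, pd_pd_self, mul_zero]

theorem twistFactor_mul_xi (ε : ℂ) (i : Fin N) : (1 + ε • top N) * xi N i = xi N i := by
  rw [add_mul, one_mul, smul_mul_assoc, top_mul_xi, smul_zero, add_zero]

theorem twistFactor_mul_xi_mul (ε : ℂ) (i : Fin N) (g : Gr N) :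
    (1 + ε • top N) * (xi N i * g) = xi N i * g := by
  rw [← mul_assoc, twistFactor_mul_xi]

theorem xpd_one (i j : Fin N) : xpd N i j 1 = 0 := by
  rw [xpd_apply, pd_one, mul_zero]

/-- For `i ≠ j` the field `ξ_i ∂_j` kills `ξ_1 ⋯ ξ_N`. -/
theorem adXi_twist {i j : Fin N} (h : i ≠ j) (ε : ℂ) (y : WGen N) :
    adXi N i j (twist N ε y) = twist N ε (adXi N i j y) := by
  have key : ∀ g, xpd N i j ((1 + ε • top N) * g) = (1 + ε • top N) * xpd N i j g := fun g => by
    rw [xpd_mul, map_add, map_smul, xpd_one, xpd_apply i j (top N), xi_mul_pd_top_of_ne h, smul_zero,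
      add_zero, zero_mul, zero_add]
  refine Prod.ext (funext fun k => ?_) ?_
  · simp only [adXi_fst, twist_fst, key, mul_sub, mul_ite, mul_zero]
  · simp only [adXi_snd, twist_snd, key]

/-- `ξ_i ∂_i` and `ξ_l ∂_l` both fix `ξ_1 ⋯ ξ_N`, so their difference kills it; neither one commutes
with the twist alone. -/
theorem adXi_sub_twist (i l : Fin N) (ε : ℂ) (y : WGen N) :
    (adXi N i i - adXi N l l) (twist N ε y) = twist N ε ((adXi N i i - adXi N l l) y) := by
  have key : ∀ i g, xpd N i i ((1 + ε • top N) * g) =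
      (ε • top N) * g + (1 + ε • top N) * xpd N i i g := fun i g => by
    rw [xpd_mul, map_add, map_smul, xpd_one, xpd_apply i i (top N), xi_mul_pd_top, zero_add]
  refine Prod.ext (funext fun k => ?_) ?_
  · simp only [LinearMap.sub_apply, Prod.fst_sub, Pi.sub_apply, adXi_fst, twist_fst, key, mul_sub,
      mul_ite, mul_zero]
    abel
  · simp only [LinearMap.sub_apply, Prod.snd_sub, adXi_snd, twist_snd, key, mul_sub]
    abel

/-- The top monomial has square zero. The index `i` excludes `N = 0`, where the empty product is
`1`. -/
theorem twist_twist_neg (i : Fin N) (ε : ℂ) (y : WGen N) : twist N ε (twist N (-ε) y) = y := by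
  have key : ∀ g, (1 + ε • top N) * ((1 + -ε • top N) * g) = g := fun g => by
    rw [← mul_assoc, add_mul, mul_add, mul_add, smul_mul_smul_comm, top_mul_top i, smul_zero]
    simp
  refine Prod.ext (funext fun k => ?_) ?_
  · simp only [twist_fst, key]
  · simp only [twist_snd, key]

theorem freeMap_freeMap {U V W : Type*} [AddCommGroup U] [Module ℂ U] [AddCommGroup V] [Module ℂ V]
    [AddCommGroup W] [Module ℂ W] (T : V →ₗ[ℂ] W) (T' : U →ₗ[ℂ] V) (x : Free U) :
    freeMap T (freeMap T' x) = freeMap (T ∘ₗ T') x := by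
  ext k : 1
  simp

theorem dvg_eq (a : ℂ) (x : Free (WGen N)) : dvg N a x = freeMap (divGen N a) x -
    freeD _ (freeMap (LinearMap.snd ℂ (Fin N → Gr N) (Gr N)) x) := by
  induction x using Finsupp.induction_linear with
  | zero => simp
  | add f g hf hg => rw [map_add, hf, hg, map_add, map_add, map_add]; abel
  | single k y =>
    rw [Finsupp.mapRange.linearMap_apply, Finsupp.mapRange.linearMap_apply,
      Finsupp.mapRange_single, Finsupp.mapRange_single, freeD_single]
    simp [dvg, divGen]

theorem freeMap_rotGen_mem (a : ℂ) (i j : Fin N) (h : Free (Gr N)) :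
    freeMap (rotGen N i j) h ∈ LinearMap.ker (dvg N a) := by
  have h1 : divGen N a ∘ₗ rotGen N i j = 0 := LinearMap.ext fun g => by
    rw [LinearMap.comp_apply, divGen_apply, rotGen_snd, smul_zero, add_zero]
    simp only [rotGen_fst, map_add, Finset.sum_add_distrib, apply_ite (sig N),
      apply_ite (pd N _), map_zero, Finset.sum_ite_eq', Finset.mem_univ, if_true, sig_sig]
    rw [pd_comm, neg_add_cancel, LinearMap.zero_apply]
  have h2 : LinearMap.snd ℂ (Fin N → Gr N) (Gr N) ∘ₗ rotGen N i j = 0 :=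
    LinearMap.ext fun g => rotGen_snd i j g
  rw [LinearMap.mem_ker, dvg_eq, freeMap_freeMap, freeMap_freeMap, h1, h2, freeMap_zero,
    map_zero, sub_zero]

theorem potential_mem (a : ℂ) (i : Fin N) (h : Free (Gr N)) :
    potential N a i h ∈ LinearMap.ker (dvg N a) := by
  have h1 : divGen N a ∘ₗ fieldGen N i = pd N i := LinearMap.ext fun g => by
    rw [LinearMap.comp_apply, divGen_apply, fieldGen_snd, smul_zero, add_zero]
    simp only [fieldGen_fst, apply_ite (sig N), apply_ite (pd N _), map_zero, Finset.sum_ite_eq',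
      Finset.mem_univ, if_true, sig_sig]
  have h2 : LinearMap.snd ℂ (Fin N → Gr N) (Gr N) ∘ₗ fieldGen N i = 0 :=
    LinearMap.ext fun g => fieldGen_snd i g
  have h3 : divGen N a ∘ₗ (LinearMap.inr ℂ (Fin N → Gr N) (Gr N) ∘ₗ pd N i - a • fieldGen N i) =
      0 := by
    rw [LinearMap.comp_sub, LinearMap.comp_smul, h1]
    refine LinearMap.ext fun g => ?_
    simp [divGen_apply]
  have h4 : LinearMap.snd ℂ (Fin N → Gr N) (Gr N) ∘ₗ
      (LinearMap.inr ℂ (Fin N → Gr N) (Gr N) ∘ₗ pd N i - a • fieldGen N i) = pd N i := by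
    rw [LinearMap.comp_sub, LinearMap.comp_smul, h2, smul_zero, sub_zero, ← LinearMap.comp_assoc,
      LinearMap.snd_comp_inr, LinearMap.id_comp]
  rw [LinearMap.mem_ker, dvg_eq, potential, LinearMap.add_apply, LinearMap.comp_apply, map_add,
    map_add, freeMap_freeD, freeMap_freeD, freeMap_freeMap, freeMap_freeMap, freeMap_freeMap,
    freeMap_freeMap, h1, h2, h3, h4, freeMap_zero, map_zero, zero_add, add_zero,
    sub_self]

theorem adXi_sub_rotGen {i l : Fin N} (h : i ≠ l) (g : Gr N) :
    (adXi N i i - adXi N l l) (rotGen N i i g) = -rotGen N i i (g + xpd N l l g) := by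
  refine Prod.ext (funext fun k => ?_) ?_
  · simp only [LinearMap.sub_apply, Prod.fst_sub, Prod.fst_neg, Pi.sub_apply, Pi.neg_apply,
      adXi_fst, rotGen_fst, if_neg h.symm, add_zero, ite_self, sub_zero, if_true]
    by_cases hk : k = i
    · simp only [hk, if_true, map_add, ← sig_xpd, xpd_pd, map_zero, pd_xpd_of_ne h]
      abel
    · simp [hk]
  · simp [adXi_snd, rotGen_snd]

theorem adXi_rotGen {i j : Fin N} (h : i ≠ j) (g : Gr N) :
    adXi N i j (rotGen N i i g) = rotGen N i i (xpd N i j g) - (2 : ℂ) • rotGen N i j g := by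
  refine Prod.ext (funext fun k => ?_) ?_
  · simp only [Prod.fst_sub, Prod.smul_fst, Pi.sub_apply, Pi.smul_apply, adXi_fst, rotGen_fst,
      if_true]
    by_cases hk : k = i
    · simp only [hk, if_true, if_neg h, map_add, ← sig_xpd, pd_xpd_self, two_smul]
      abel
    · by_cases hk' : k = j
      · simp [hk', h.symm, two_smul]
      · simp [hk, hk']
  · simp [adXi_snd, rotGen_snd]

theorem adXi_fieldGen (i j : Fin N) (g : Gr N) :
    adXi N j i (fieldGen N j g) = fieldGen N j (xpd N j i g) - fieldGen N i g := by
  refine Prod.ext (funext fun k => ?_) ?_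
  · simp only [Prod.fst_sub, Pi.sub_apply, adXi_fst, fieldGen_fst, if_true, sig_xpd,
      apply_ite (xpd N j i), map_zero]
  · simp [adXi_snd, fieldGen_snd]

theorem freeMap_adXi_potential (i j : Fin N) (a : ℂ) (x : Free (Gr N)) :
    freeMap (adXi N j i) (potential N a j x) =
      potential N a j (freeMap (xpd N j i) x) - potential N a i x := by
  have h1 : adXi N j i ∘ₗ fieldGen N j = fieldGen N j ∘ₗ xpd N j i - fieldGen N i :=
    LinearMap.ext (adXi_fieldGen i j)
  have h2 : adXi N j i ∘ₗ (LinearMap.inr ℂ (Fin N → Gr N) (Gr N) ∘ₗ pd N j) =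
      LinearMap.inr ℂ (Fin N → Gr N) (Gr N) ∘ₗ pd N j ∘ₗ xpd N j i -
        LinearMap.inr ℂ (Fin N → Gr N) (Gr N) ∘ₗ pd N i := by
    refine LinearMap.ext fun g => Prod.ext (funext fun k => ?_) ?_
    · simp [adXi_fst]
    · simp [adXi_snd, pd_xpd_self]
  have h3 : ∀ (T T' : Gr N →ₗ[ℂ] WGen N) (x : Free (Gr N)), freeMap (T - T') x =
      freeMap T x - freeMap T' x := fun T T' x => by ext k : 1; simp
  simp only [potential, LinearMap.add_apply, LinearMap.comp_apply, map_add, freeMap_freeD,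
    freeMap_freeMap, LinearMap.comp_smul, h1, h2, h3, map_sub,
    LinearMap.smul_comp, smul_sub, LinearMap.comp_assoc]
  abel

theorem wBr₁_of_snd_eq_zero {X : WGen N} (h : X.2 = 0) : wBr₁ N X = 0 := by
  refine LinearMap.ext fun y => Prod.ext (funext fun k => ?_) ?_ <;> simp [wBr₁, h]

theorem divGen_single (a : ℂ) (j : Fin N) (f : Gr N) :
    divGen N a (Pi.single j f, 0) = pd N j (sig N f) := by
  rw [divGen_apply, smul_zero, add_zero]
  dsimp only
  rw [Finset.sum_eq_single j (fun m _ hm => by simp [hm]) (by simp), Pi.single_eq_same]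

theorem single_zero_mem_special {a ε : ℂ} {X : WGen N} (h : divGen N a (twist N ε X) = 0)
    (h' : (twist N ε X).2 = 0) : Finsupp.single 0 X ∈ special N a ε := by
  rw [special, LinearMap.mem_ker, LinearMap.comp_apply, Finsupp.mapRange.linearMap_apply,
    Finsupp.mapRange_single, dvg_eq, Finsupp.mapRange.linearMap_apply,
    Finsupp.mapRange.linearMap_apply, Finsupp.mapRange_single, Finsupp.mapRange_single,
    LinearMap.snd_apply, h, h', Finsupp.single_zero, map_zero, sub_zero]

theorem twist_single_xi (ε : ℂ) (i j : Fin N) :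
    twist N ε (Pi.single j (xi N i), 0) = (Pi.single j (xi N i), 0) := by
  refine Prod.ext (funext fun k => ?_) ?_
  · rw [twist_fst]
    by_cases hk : k = j
    · simp only [hk, Pi.single_eq_same, twistFactor_mul_xi]
    · simp [hk]
  · simp [twist_snd]

theorem single_mem_special (a ε : ℂ) {i j : Fin N} (h : i ≠ j) :
    Finsupp.single 0 (Pi.single j (xi N i), 0) ∈ special N a ε := by
  refine single_zero_mem_special ?_ ?_
  · rw [twist_single_xi, divGen_single, sig_xi, map_neg, pd_xi, if_neg h.symm, neg_zero]
  · rw [twist_single_xi]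

theorem single_sub_mem_special (a ε : ℂ) (i l : Fin N) :
    Finsupp.single 0 ((Pi.single i (xi N i), 0) - (Pi.single l (xi N l), 0)) ∈ special N a ε := by
  refine single_zero_mem_special ?_ ?_
  · rw [map_sub, map_sub, twist_single_xi, twist_single_xi, divGen_single, divGen_single, sig_xi,
      sig_xi, map_neg, map_neg, pd_xi, pd_xi, if_pos rfl, if_pos rfl, sub_self]
  · rw [map_sub, twist_single_xi, twist_single_xi, Prod.snd_sub, sub_zero]

/-- `(1 - ε ξ_1 ⋯ ξ_N) ∂_j`. -/
theorem single_twist_mem_special (a ε : ℂ) (j : Fin N) :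
    Finsupp.single 0 (twist N (-ε) (Pi.single j 1, 0)) ∈ special N a ε := by
  refine single_zero_mem_special ?_ ?_
  · rw [twist_twist_neg j, divGen_single, sig_one, pd_one]
  · rw [twist_twist_neg j]

theorem freeMap_twist_mem_special (i : Fin N) {a ε : ℂ} {y : Free (WGen N)}
    (hy : y ∈ LinearMap.ker (dvg N a)) : freeMap (twist N (-ε)) y ∈ special N a ε := by
  have h : twist N ε ∘ₗ twist N (-ε) = LinearMap.id := LinearMap.ext (twist_twist_neg i ε)
  rw [special, LinearMap.mem_ker, LinearMap.comp_apply, freeMap_freeMap, h, freeMap_id]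
  exact hy

theorem sig_pd_top_mul_xi_of_ne {i j : Fin N} (h : i ≠ j) :
    sig N (pd N j (top N)) * xi N i = 0 := by
  have := congrArg (sig N) (pd_top_mul_xi_of_ne h)
  rwa [sig_mul, sig_xi, mul_neg, map_zero, neg_eq_zero] at this

theorem wBr₀_twist_fst (ε : ℂ) (j k : Fin N) (y : WGen N) :
    (wBr₀ N (twist N ε (Pi.single j 1, 0)) y).1 k = (1 + ε • top N) * pd N j (y.1 k) -
      if k = j then ε • ∑ m, sig N (pd N m (top N)) * y.1 m else 0 := by
  change ∑ m, ((1 + ε • top N) * (Pi.single j 1 : Fin N → Gr N) m * pd N m (y.1 k) +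
    pd N m (sig N ((1 + ε • top N) * (Pi.single j 1 : Fin N → Gr N) k)) * y.1 m) = _
  rw [Finset.sum_add_distrib, Finset.sum_eq_single j (fun m _ hm => by simp [hm]) (by simp),
    Pi.single_eq_same, mul_one, sub_eq_add_neg]
  congr 1
  split_ifs with h
  · rw [h, Pi.single_eq_same, mul_one, Finset.smul_sum, ← Finset.sum_neg_distrib]
    refine Finset.sum_congr rfl fun m _ => ?_
    rw [map_add, map_smul, sig_one, map_add, map_smul, pd_one, zero_add, sig_pd, neg_mul, smul_neg,
      neg_neg, smul_mul_assoc]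
  · simp [h]

theorem wBr₀_twist_snd (ε : ℂ) (j : Fin N) (y : WGen N) :
    (wBr₀ N (twist N ε (Pi.single j 1, 0)) y).2 = (1 + ε • top N) * pd N j y.2 := by
  change ∑ m, ((1 + ε • top N) * (Pi.single j 1 : Fin N → Gr N) m * pd N m y.2 +
    sig N (pd N m ((1 + ε • top N) * 0) * y.1 m)) = _
  rw [Finset.sum_add_distrib, Finset.sum_eq_single j (fun m _ hm => by simp [hm]) (by simp),
    Pi.single_eq_same, mul_one]
  simp

/-- The twisted `∂_j` acts here as `∂_j` conjugated by the twist. The extra terms contain the top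
monomial, or its derivative in `ξ_i` with `i ≠ j`, times `ξ_j`, and vanish. -/
theorem wBr₀_twist_fieldGen (ε : ℂ) {i j : Fin N} (h : i ≠ j) {g : Gr N} (hg : pd N j g = 0) :
    wBr₀ N (twist N ε (Pi.single j 1, 0)) (twist N ε (fieldGen N i (xi N j * g))) =
      -twist N ε (fieldGen N i g) := by
  have h1 : pd N j (sig N g) = 0 := by
    have := sig_pd j g
    rwa [hg, map_zero, eq_comm, neg_eq_zero] at this
  refine Prod.ext (funext fun k => ?_) ?_
  · rw [wBr₀_twist_fst]
    simp only [twist_fst, fieldGen_fst, sig_mul, sig_xi, neg_mul, mul_ite, mul_zero, mul_neg,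
      twistFactor_mul_xi_mul, Finset.sum_ite_eq', Finset.mem_univ, if_true, Prod.fst_neg,
      Pi.neg_apply]
    rw [← mul_assoc, sig_pd_top_mul_xi_of_ne h.symm, zero_mul, neg_zero, smul_zero, ite_self,
      sub_zero]
    split_ifs
    · rw [map_neg, pd_xi_mul_self, h1, mul_zero, sub_zero, mul_neg]
    · rw [map_zero, mul_zero, neg_zero]
  · rw [wBr₀_twist_snd]
    simp [twist_snd, fieldGen_snd]

theorem wBr₀_twist_inr (ε : ℂ) {i j : Fin N} (h : i ≠ j) {g : Gr N} (hg : pd N j g = 0) :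
    wBr₀ N (twist N ε (Pi.single j 1, 0)) (twist N ε (0, pd N i (xi N j * g))) =
      -twist N ε (0, pd N i g) := by
  refine Prod.ext (funext fun k => ?_) ?_
  · rw [wBr₀_twist_fst]
    simp [twist_fst]
  · rw [wBr₀_twist_snd, twist_snd, pd_xi_mul_of_ne h, mul_neg, twistFactor_mul_xi_mul, map_neg,
      pd_xi_mul_self, pd_comm, hg, map_zero, neg_zero, mul_zero, sub_zero, mul_neg]
    rfl

/-- A homotopy formula: multiplication by `ξ_i` contracts `1 - ad(ξ_i ∂_i)` onto rotations and
potentials, up to a term in the divergence. When the deformed divergence vanishes, `divGen` equals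
`∂` of the function part, and the last term becomes the `∂`-part of the potential. -/
theorem adXi_decomposition (a : ℂ) (i : Fin N) (y : WGen N) : y - adXi N i i y =
    ∑ j, rotGen N i j (xi N i * sig N (y.1 j)) +
      ((LinearMap.inr ℂ (Fin N → Gr N) (Gr N) ∘ₗ pd N i - a • fieldGen N i) (xi N i * y.2) +
        fieldGen N i (xi N i * divGen N a y)) := by
  refine Prod.ext (funext fun k => ?_) ?_
  · have h1 : ∑ j, pd N j (xi N i * sig N (y.1 j)) =
        sig N (y.1 i) - xi N i * (divGen N a y - a • y.2) := by
      rw [divGen_apply, add_sub_cancel_right, Finset.mul_sum]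
      simp [pd_xi_mul, Finset.sum_sub_distrib]
    have h2 : ∑ j, sig N (pd N j (xi N i * sig N (y.1 j))) =
        y.1 i - sig N (xi N i * divGen N a y) + a • sig N (xi N i * y.2) := by
      rw [← map_sum, h1, map_sub, sig_sig, mul_sub, map_sub, mul_smul_comm, map_smul]
      abel
    simp only [Prod.fst_sub, Prod.fst_add, Prod.fst_sum, Pi.sub_apply, Pi.add_apply,
      Finset.sum_apply, adXi_fst, rotGen_fst, LinearMap.sub_apply, LinearMap.smul_apply,
      Prod.smul_fst, Pi.smul_apply, fieldGen_fst, LinearMap.comp_apply, LinearMap.inr_apply,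
      Pi.zero_apply, Finset.sum_add_distrib, Finset.sum_ite_eq, Finset.mem_univ, if_true]
    rw [pd_xi_mul_self, map_sub, sig_sig, ← xpd_apply, sig_xpd, sig_sig]
    split_ifs with hk
    · rw [h2]
      abel
    · simp
  · simp only [Prod.snd_sub, Prod.snd_add, Prod.snd_sum, adXi_snd, rotGen_snd, LinearMap.sub_apply,
      LinearMap.smul_apply, Prod.smul_snd, fieldGen_snd, LinearMap.comp_apply, LinearMap.inr_apply,
      pd_xi_mul_self, xpd_apply]
    simp

theorem sub_freeMap_adXi {a : ℂ} {y : Free (WGen N)} (hy : y ∈ LinearMap.ker (dvg N a))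
    (i : Fin N) : y - freeMap (adXi N i i) y =
      ∑ j, freeMap (rotGen N i j) (freeMap (LinearMap.mulLeft ℂ (xi N i) ∘ₗ sig N ∘ₗ
        LinearMap.proj j ∘ₗ LinearMap.fst ℂ (Fin N → Gr N) (Gr N)) y) +
      potential N a i (freeMap (LinearMap.mulLeft ℂ (xi N i) ∘ₗ
        LinearMap.snd ℂ (Fin N → Gr N) (Gr N)) y) := by
  rw [LinearMap.mem_ker, dvg_eq, sub_eq_zero] at hy
  rw [potential, LinearMap.add_apply, LinearMap.comp_apply, ← freeMap_freeMap _ _ y,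
    ← freeMap_freeD, ← freeMap_freeD, ← hy]
  ext n : 1
  simpa using adXi_decomposition a i (y n)

/-- The algebras `S_{N,a}` and `S̃_N` are perfect. -/
theorem isPerfect_special (hN : 2 ≤ N) (a ε : ℂ) : IsPerfect (confW N) (special N a ε) := by
  intro Q hQ _
  have : Nontrivial (Fin N) := Fin.nontrivial_iff_two_le.2 hN
  let i₀ : Fin N := ⟨0, by omega⟩
  set t := twist N (-ε)
  set K := LinearMap.ker (dvg N a)
  have hU : ∀ y ∈ K, freeMap t y ∈ special N a ε := fun y hy => freeMap_twist_mem_special i₀ hy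
  -- Multiplication by `1 - ε ξ_1 ⋯ ξ_N` maps the divergence-free space `K` onto `special N a ε`, so
  -- all computations can be done in `K`.
  suffices H : ∀ y ∈ K, freeMap t y ∈ Q by
    intro x hx
    have h : t ∘ₗ twist N ε = LinearMap.id := LinearMap.ext fun y => by
      simpa using twist_twist_neg i₀ (-ε) y
    have := H (freeMap (twist N ε) x) hx
    rwa [freeMap_freeMap, h, freeMap_id] at this
  -- the adjoint action of elements of the form `∑ P_i ∂_i`
  have hact : ∀ X : WGen N, X.2 = 0 → Finsupp.single 0 X ∈ special N a ε → ∀ y ∈ K,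
      freeMap (wBr₀ N X) (freeMap t y) ∈ Q := by
    intro X hX hXU y hy
    have h := hQ _ hXU _ (hU y hy) 0
    rwa [confW_br_zero, Finsupp.single_eq_same, wBr₁_of_snd_eq_zero hX, freeMap_zero, map_zero,
      add_zero] at h
  have hoff : ∀ i j : Fin N, i ≠ j → ∀ y ∈ K, freeMap t (freeMap (adXi N i j) y) ∈ Q := by
    intro i j hij y hy
    have h := hact _ rfl (single_mem_special a ε hij) y hy
    rw [freeMap_freeMap] at h ⊢
    rwa [show t ∘ₗ adXi N i j = adXi N i j ∘ₗ t from
      LinearMap.ext fun y => (adXi_twist hij _ y).symm]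
  have hdiag : ∀ i l : Fin N, ∀ y ∈ K, freeMap t (freeMap (adXi N i i - adXi N l l) y) ∈ Q := by
    intro i l y hy
    have h := hact _ (sub_zero 0) (single_sub_mem_special a ε i l) y hy
    rw [map_sub] at h
    rw [freeMap_freeMap] at h ⊢
    rwa [show t ∘ₗ (adXi N i i - adXi N l l) = (adXi N i i - adXi N l l) ∘ₗ t from
      LinearMap.ext fun y => (adXi_sub_twist i l _ y).symm]
  -- all generators of the divergence-free fields belong to `Q`
  have hrot' : ∀ (i : Fin N) (h : Free (Gr N)), freeMap t (freeMap (rotGen N i i) h) ∈ Q := by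
    intro i h
    obtain ⟨l, hl⟩ := exists_ne i
    -- By `adXi_sub_rotGen` the action on rotations is `-(1 + ξ_l ∂_l)`. As `ξ_l ∂_l` is idempotent,
    -- its inverse is `ξ_l ∂_l / 2 - 1`.
    have h1 := hdiag i l _ (freeMap_rotGen_mem a i i
      (freeMap ((1 / 2 : ℂ) • xpd N l l - LinearMap.id) h))
    rw [freeMap_freeMap, freeMap_freeMap] at h1
    rw [freeMap_freeMap] at h1 ⊢
    convert h1 using 2
    refine congrArg _ (LinearMap.ext fun g => ?_)
    simp only [LinearMap.comp_apply, adXi_sub_rotGen hl.symm]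
    rw [← map_neg (rotGen N i i)]
    congr 2
    simp only [LinearMap.sub_apply, LinearMap.smul_apply, LinearMap.id_apply, map_sub, map_smul,
      xpd_xpd_self]
    module
  have hrot : ∀ (i j : Fin N) (h : Free (Gr N)), freeMap t (freeMap (rotGen N i j) h) ∈ Q := by
    intro i j h
    by_cases hij : i = j
    · rw [hij]; exact hrot' j h
    have h1 := hoff i j hij _ (freeMap_rotGen_mem a i i h)
    have h2 := sub_mem (hrot' i (freeMap (xpd N i j) h)) h1
    have e : freeMap t (freeMap (rotGen N i i) (freeMap (xpd N i j) h)) -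
        freeMap t (freeMap (adXi N i j) (freeMap (rotGen N i i) h)) =
          (2 : ℂ) • freeMap t (freeMap (rotGen N i j) h) := by
      rw [← map_sub, ← map_smul]
      congr 1
      ext n : 1
      simp [adXi_rotGen hij]
    rw [e] at h2
    exact (Q.smul_mem_iff two_ne_zero).1 h2
  -- For a function `f` free of `ξ_j`, the potential of `f` is, up to sign, the twisted `∂_j`
  -- applied to the potential of `ξ_j f`.
  have hpot₀ : ∀ i j : Fin N, i ≠ j → ∀ h : Free (Gr N),
      freeMap t (potential N a i (h - freeMap (xpd N j j) h)) ∈ Q := by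
    intro i j hij h
    have h1 := hact _ (by simp [twist_snd]) (single_twist_mem_special a ε j) _
      (potential_mem a i (freeMap (LinearMap.mulLeft ℂ (xi N j)) (h - freeMap (xpd N j j) h)))
    rw [← neg_mem_iff] at h1
    convert h1 using 1
    have hz : ∀ n, pd N j ((h - freeMap (xpd N j j) h) n) = 0 := fun n => by
      rw [Finsupp.sub_apply, Finsupp.mapRange.linearMap_apply, Finsupp.mapRange_apply, map_sub,
        pd_xpd_self, xpd_pd, add_zero, sub_self]
    generalize h - freeMap (xpd N j j) h = f at hz
    have e1 : freeMap (wBr₀ N (twist N (-ε) (Pi.single j 1, 0))) (freeMap t (freeMap (fieldGen N i)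
        (freeMap (LinearMap.mulLeft ℂ (xi N j)) f))) = -freeMap t (freeMap (fieldGen N i) f) := by
      ext n : 1
      simpa using wBr₀_twist_fieldGen (-ε) hij (hz n)
    have e2 : freeMap (wBr₀ N (twist N (-ε) (Pi.single j 1, 0))) (freeMap t
        (freeMap (LinearMap.inr ℂ (Fin N → Gr N) (Gr N) ∘ₗ pd N i - a • fieldGen N i)
        (freeMap (LinearMap.mulLeft ℂ (xi N j)) f))) = -freeMap t
        (freeMap (LinearMap.inr ℂ (Fin N → Gr N) (Gr N) ∘ₗ pd N i - a • fieldGen N i) f) := by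
      ext n : 1
      have h1 := wBr₀_twist_fieldGen (-ε) hij (hz n)
      have h2 := wBr₀_twist_inr (-ε) hij (hz n)
      simp only [Finsupp.mapRange.linearMap_apply, Finsupp.mapRange_apply, Finsupp.neg_apply,
        LinearMap.sub_apply, LinearMap.smul_apply, LinearMap.comp_apply, LinearMap.inr_apply,
        LinearMap.mulLeft_apply, map_sub, map_smul, t, h1, h2, smul_neg, neg_sub_neg, neg_sub]
    simp only [potential, LinearMap.add_apply, LinearMap.comp_apply, map_add, freeMap_freeD, e1, e2,
      map_neg, neg_add, neg_neg]
  have hpot : ∀ (i : Fin N) (h : Free (Gr N)), freeMap t (potential N a i h) ∈ Q := by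
    intro i h
    obtain ⟨j, hj⟩ := exists_ne i
    have hswap : ∀ i j : Fin N, i ≠ j → ∀ h, freeMap t (potential N a j (freeMap (xpd N j i) h)) -
        freeMap t (potential N a i h) ∈ Q := by
      intro i j hij h
      have := hoff j i hij.symm _ (potential_mem a j h)
      rwa [freeMap_adXi_potential, map_sub] at this
    have h1 := hswap i j hj.symm h
    have h2 := hswap j i hj (freeMap (xpd N j i) h)
    have h3 := hpot₀ i j hj.symm (freeMap (xpd N i i) h)
    -- Swapping from `i` to `j` and back replaces `h` by `ξ_i ∂_i h - ξ_j ∂_j ξ_i ∂_i h`. This is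
    -- free of `ξ_j`, so `h3` covers it, and the two swaps return to the potential of `h`.
    have e : freeMap (xpd N i j) (freeMap (xpd N j i) h) =
        freeMap (xpd N i i) h - freeMap (xpd N j j) (freeMap (xpd N i i) h) := by
      ext n : 1
      simp only [Finsupp.mapRange.linearMap_apply, Finsupp.mapRange_apply, Finsupp.sub_apply]
      rw [xpd_apply i j, pd_xpd_self, xpd_apply j j, pd_xpd_of_ne hj, xpd_apply i i, mul_add,
        xpd_apply j i, ← mul_assoc (xi N i), xi_comm i j, neg_mul, mul_assoc, sub_eq_add_neg]
      rfl
    rw [e] at h2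
    have := sub_mem (sub_mem h3 h2) h1
    simpa using this
  -- elimination of the components
  have hstep : ∀ i : Fin N, ∀ y ∈ K, freeMap (adXi N i i) y ∈ K ∧
      freeMap t (y - freeMap (adXi N i i) y) ∈ Q := by
    intro i y hy
    have e := sub_freeMap_adXi hy i
    constructor
    · have h1 : y - freeMap (adXi N i i) y ∈ K := by
        rw [e]
        exact add_mem (K.sum_mem fun j _ => freeMap_rotGen_mem a i j _) (potential_mem a i _)
      simpa using sub_mem hy h1
    · rw [e, map_add, map_sum]
      exact add_mem (Q.sum_mem fun j _ => hrot i j _) (hpot i _)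
  -- Put `A = ad(ξ_i ∂_i)`. Modulo `Q`, `y` equals `A y` and `A² y`, hence `(A + A²) y / 2`. On the
  -- `i`-th component `A` is an idempotent minus `1`, so `A + A²` kills it; on all other components
  -- `A` is idempotent, and vanishing components stay zero.
  have hstep' : ∀ i : Fin N, ∀ y ∈ K, ∃ z ∈ K, freeMap t (y - z) ∈ Q ∧ (∀ n, (z n).1 i = 0) ∧
      ∀ k, (∀ n, (y n).1 k = 0) → ∀ n, (z n).1 k = 0 := by
    intro i y hy
    obtain ⟨hy1, hq1⟩ := hstep i y hy
    obtain ⟨hy2, hq2⟩ := hstep i _ hy1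
    refine ⟨(1 / 2 : ℂ) • (freeMap (adXi N i i) y + freeMap (adXi N i i) (freeMap (adXi N i i) y)),
      K.smul_mem _ (add_mem hy1 hy2), ?_, fun n => ?_, fun k hk n => ?_⟩
    · have := add_mem hq1 (Q.smul_mem (1 / 2 : ℂ) hq2)
      rw [← map_smul, ← map_add] at this
      convert this using 2
      module
    · simp only [Finsupp.smul_apply, Finsupp.add_apply, Prod.smul_fst, Prod.fst_add, Pi.smul_apply,
        Pi.add_apply, Finsupp.mapRange.linearMap_apply, Finsupp.mapRange_apply, adXi_fst, if_true,
        map_sub, xpd_xpd_self]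
      simp
    · simp only [Finsupp.smul_apply, Finsupp.add_apply, Prod.smul_fst, Prod.fst_add, Pi.smul_apply,
        Pi.add_apply, Finsupp.mapRange.linearMap_apply, Finsupp.mapRange_apply, adXi_fst, if_true]
      by_cases hki : k = i
      · subst hki
        simp [hk]
      · simp [hk, hki]
  have helim : ∀ s : Finset (Fin N), ∀ y ∈ K, ∃ z ∈ K, freeMap t (y - z) ∈ Q ∧
      ∀ k ∈ s, ∀ n, (z n).1 k = 0 := by
    intro s
    induction s using Finset.induction_on with
    | empty => exact fun y hy => ⟨y, hy, by simp, by simp⟩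
    | insert i s _ ih =>
      intro y hy
      obtain ⟨z, hz, hyz, hzs⟩ := ih y hy
      obtain ⟨w, hw, hzw, hwi, hwk⟩ := hstep' i z hz
      refine ⟨w, hw, ?_, fun k hk => ?_⟩
      · have := add_mem hyz hzw
        rwa [← map_add, sub_add_sub_cancel] at this
      · rcases Finset.mem_insert.1 hk with rfl | hk
        · exact hwi
        · exact hwk k (hzs k hk)
  intro y hy
  obtain ⟨z, hz, hyz, hz0⟩ := helim Finset.univ y hy
  suffices hzero : z = 0 by rwa [hzero, sub_zero] at hyz
  have hz1 : ∀ n, (z n).1 = 0 := fun n => funext fun k => hz0 k (Finset.mem_univ k) n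
  -- Only a function remains, and zero divergence says `∂ f = a f`. A polynomial in `∂` with this
  -- property is zero.
  have hz2 : ∀ n, (z n).2 = a • (z (n + 1)).2 := by
    intro n
    have h := DFunLike.congr_fun (show dvg N a z = 0 from hz) (n + 1)
    rw [dvg_eq, Finsupp.sub_apply, freeD_apply_succ, Finsupp.mapRange.linearMap_apply,
      Finsupp.mapRange.linearMap_apply, Finsupp.mapRange_apply, Finsupp.mapRange_apply,
      divGen_apply, hz1] at h
    exact (sub_eq_zero.1 (by simpa using h)).symm
  have hz3 : ∀ m n, (z n).2 = a ^ m • (z (n + m)).2 := by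
    intro m
    induction m with
    | zero => simp
    | succ m ih => intro n; rw [ih, hz2, smul_smul, pow_succ, add_assoc]
  obtain ⟨M, hM⟩ : ∃ M, ∀ n, M < n → z n = 0 :=
    ⟨z.support.sup id, fun n hn => Finsupp.notMem_support_iff.1 fun h =>
      absurd (Finset.le_sup (f := id) h) (not_le.2 hn)⟩
  ext1 n
  refine Prod.ext (hz1 n) ?_
  rw [hz3 (M + 1) n, hM _ (by omega)]
  simp

/-- The element `L = -(1 - ε ξ_1 ⋯ ξ_N) + (∂ - a) ξ_i ∂_i`. -/
def specialL (a ε : ℂ) (i : Fin N) : Free (WGen N) :=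
  Finsupp.single 0 (-(a • (Pi.single i (xi N i) : Fin N → Gr N)), -(1 + -ε • top N)) +
    Finsupp.single 1 (Pi.single i (xi N i), 0)

theorem specialL_mem (a ε : ℂ) (i : Fin N) : specialL a ε i ∈ special N a ε := by
  have e : ((-(a • Pi.single i (xi N i)) : Fin N → Gr N), -(1 + -ε • top N)) =
      -(a • ((Pi.single i (xi N i) : Fin N → Gr N), (0 : Gr N)) + twist N (-ε) (0, 1)) := by
    refine Prod.ext (funext fun k => ?_) ?_ <;> simp [twist_fst, twist_snd]
  have h : divGen N a (Pi.single i (xi N i), 0) = -1 := by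
    rw [divGen_single, sig_xi, map_neg, pd_xi, if_pos rfl]
  have h1 : divGen N a (0, 1) = a • (1 : Gr N) := by
    simp [divGen_apply]
  rw [special, LinearMap.mem_ker, LinearMap.comp_apply, specialL, map_add]
  simp only [Finsupp.mapRange.linearMap_apply, Finsupp.mapRange_single]
  rw [e, map_neg, map_add (twist N ε), map_smul, twist_single_xi, twist_twist_neg i,
    map_add, dvg_eq, dvg_eq]
  simp only [Finsupp.mapRange.linearMap_apply, Finsupp.mapRange_single, freeD_single,
    LinearMap.snd_apply, map_neg, map_add, map_smul, h, h1]
  simp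

theorem specialL_mem_part {a ε : ℂ} (hε : ε • top N ∈ grPart N 0) (i : Fin N) :
    specialL a ε i ∈ (confW N).part 0 := by
  have hxi : ∀ k, (Pi.single i (xi N i) : Fin N → Gr N) k ∈ grPart N (0 + 1) := by
    intro k
    by_cases hk : k = i
    · rw [hk, Pi.single_eq_same]; exact xi_mem_grPart i
    · rw [Pi.single_eq_of_ne hk]; exact zero_mem _
  refine add_mem (single_mem_freePart (P := wPart N 0) ⟨fun k _ => ?_, ?_⟩ 0)
    (single_mem_freePart (P := wPart N 0) ⟨fun k _ => hxi k, zero_mem _⟩ 1)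
  · exact neg_mem (Submodule.smul_mem _ _ (hxi k))
  · refine neg_mem (add_mem one_mem_grPart ?_)
    rw [neg_smul]
    exact neg_mem hε

theorem specialL_apply_zero (a ε : ℂ) (i : Fin N) :
    specialL a ε i 0 = (-(a • Pi.single i (xi N i)), -(1 + -ε • top N)) := by
  simp [specialL]

/-- The eigenvalues of `ad(ξ_i ∂_i)` are among `0`, `1`, `-1`. -/
theorem adXi_pow_three (i : Fin N) (y : WGen N) :
    adXi N i i (adXi N i i (adXi N i i y)) = adXi N i i y := by
  refine Prod.ext (funext fun k => ?_) ?_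
  · simp only [adXi_fst, if_true, map_sub, xpd_xpd_self]
    split_ifs with hk
    · simp [hk, xpd_xpd_self]
    · simp
  · simp only [adXi_snd, xpd_xpd_self]

theorem subS_eq_special (a : ℂ) : subS N a = special N a 0 := by
  have h : twist N 0 = LinearMap.id := LinearMap.ext fun y => by
    refine Prod.ext (funext fun k => ?_) ?_
    · rw [twist_fst, zero_smul, add_zero, one_mul]; rfl
    · rw [twist_snd, zero_smul, add_zero, one_mul]; rfl
  ext x
  rw [subS, special, LinearMap.mem_ker, LinearMap.mem_ker, LinearMap.comp_apply, h, freeMap_id]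

theorem subSt_eq_special : subSt N = special N 0 1 := by
  rw [subSt, special, mulTop, twist, one_smul]

theorem confW_br_specialL_zero (a : ℂ) (i : Fin N) (v : Free (WGen N)) :
    (confW N).br (specialL a 0 i) v 0 = freeD _ v + freeMap (-a • adXi N i i) v := by
  have e : ((-(a • Pi.single i (xi N i)) : Fin N → Gr N), -(1 + -(0 : ℂ) • top N)) =
      -a • ((Pi.single i (xi N i) : Fin N → Gr N), (0 : Gr N)) + (0, -1) := by
    refine Prod.ext (funext fun k => ?_) ?_ <;> simp
  have h1 : wBr₁ N (-a • ((Pi.single i (xi N i) : Fin N → Gr N), (0 : Gr N)) + (0, -1)) =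
      LinearMap.id := by
    rw [map_add, wBr₁_of_snd_eq_zero (smul_zero _), wBr₁_neg_one, zero_add]
  rw [confW_br_zero, specialL_apply_zero, e, h1, map_add, map_smul, wBr₀_neg_one, add_zero,
    freeMap_id, add_comm]
  rfl

theorem top_mul_sig_pd_top [Nontrivial (Fin N)] (i : Fin N) (f : Gr N) :
    top N * sig N (pd N i (top N) * f) = 0 := by
  obtain ⟨j, hj⟩ := exists_ne i
  rw [← xi_mul_pd_top j, pd_xi_mul_of_ne hj.symm, xi_mul_pd_top j, neg_mul, map_neg, mul_assoc,
    sig_mul, sig_xi, neg_mul, neg_neg, top_mul_xi_mul]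

theorem pd_top_mul_top [Nontrivial (Fin N)] (i : Fin N) : pd N i (top N) * top N = 0 := by
  obtain ⟨j, hj⟩ := exists_ne i
  nth_rewrite 2 [← xi_mul_pd_top j]
  rw [← mul_assoc, pd_top_mul_xi_of_ne hj, zero_mul]

theorem wBr₀_inr (f : Gr N) (y : WGen N) :
    wBr₀ N (0, f) y = (0, ∑ i, sig N (pd N i f * y.1 i)) := by
  refine Prod.ext (funext fun k => ?_) ?_ <;> simp [wBr₀]

theorem wBr₁_inr (f : Gr N) (y : WGen N) :
    wBr₁ N (0, f) y = (fun k => -(f * y.1 k), -(f * y.2)) := rfl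

/-- The nilpotent part of the action of `L` on `S̃_N`. -/
def nilTop (N : ℕ) : Free (WGen N) →ₗ[ℂ] Free (WGen N) :=
  freeMap (wBr₀ N (0, top N)) + freeD _ ∘ₗ freeMap (wBr₁ N (0, top N))

theorem confW_br_specialL_one (i : Fin N) (v : Free (WGen N)) :
    (confW N).br (specialL 0 1 i) v 0 = freeD _ v + nilTop N v := by
  have e : ((-((0 : ℂ) • Pi.single i (xi N i)) : Fin N → Gr N), -(1 + -(1 : ℂ) • top N)) =
      (0, top N) + (0, -1) := by
    refine Prod.ext (funext fun k => ?_) ?_ <;> simp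
  have h : ∀ (T T' : WGen N →ₗ[ℂ] WGen N), freeMap (T + T') v = freeMap T v + freeMap T' v :=
    fun T T' => by ext k : 1; simp
  rw [confW_br_zero, specialL_apply_zero, e, map_add, map_add, wBr₀_neg_one, wBr₁_neg_one, add_zero,
    h, freeMap_id, map_add, nilTop, LinearMap.add_apply, LinearMap.comp_apply]
  abel

/-- Each mixed or second-type composite contains the top monomial twice, with at most one factor
differentiated, and such products vanish for `N ≥ 2`. The square of the undifferentiated part `wBr₀`
is zero because its output has no `∂_i`-components. -/
theorem nilTop_nilTop [Nontrivial (Fin N)] (v : Free (WGen N)) : nilTop N (nilTop N v) = 0 := by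
  obtain ⟨i₀, -⟩ := exists_pair_ne (Fin N)
  have h00 : wBr₀ N (0, top N) ∘ₗ wBr₀ N (0, top N) = 0 := LinearMap.ext fun y => by
    simp [wBr₀_inr]
  have h01 : wBr₀ N (0, top N) ∘ₗ wBr₁ N (0, top N) = 0 := LinearMap.ext fun y => by
    rw [LinearMap.comp_apply, wBr₁_inr, wBr₀_inr]
    simp [← mul_assoc, pd_top_mul_top]
  have h10 : wBr₁ N (0, top N) ∘ₗ wBr₀ N (0, top N) = 0 := LinearMap.ext fun y => by
    rw [LinearMap.comp_apply, wBr₀_inr, wBr₁_inr]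
    refine Prod.ext (funext fun k => ?_) ?_
    · simp
    · simp [Finset.mul_sum, top_mul_sig_pd_top]
  have h11 : wBr₁ N (0, top N) ∘ₗ wBr₁ N (0, top N) = 0 := LinearMap.ext fun y => by
    rw [LinearMap.comp_apply, wBr₁_inr, wBr₁_inr]
    refine Prod.ext (funext fun k => ?_) ?_ <;> simp [← mul_assoc, top_mul_top i₀]
  simp only [nilTop, LinearMap.add_apply, LinearMap.comp_apply, map_add, freeMap_freeD,
    freeMap_freeMap, h00, h01, h10, h11, freeMap_zero, map_zero, add_zero]

end Special

/-- The conclusions on the annihilation algebra for the algebras in the list. -/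
theorem IsListed.annihilation.{u₁, u₂} {R : Type u₁} [AddCommGroup R] [Module ℂ R]
    [LieConformalSuperalgebra R] (S : Generators R) (h : IsListed R) :
    Subsingleton (H2 (Ann S)) ∧ IsUniversalCentralExtension.{u₁, u₁, u₂} (center (Ann S)).mkQ := by
  rcases h with ⟨N, h⟩ | ⟨N, hN, a, h⟩ | ⟨N, hN, hN2, h⟩ | ⟨N, hN, h⟩ | h | h
  · refine h.annihilation S (isPerfect_confW N) (confW_part_disjoint N)
      (L := Finsupp.single 0 (0, -1)) trivial (single_mem_freePart ?_ 0) 0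
      (fun v _ => ?_) 0 (fun v _ => by simp)
    · exact ⟨fun k _ => zero_mem _, neg_mem one_mem_grPart⟩
    · rw [confW_br_neg_one, LinearMap.zero_apply, add_zero]
      rfl
  · let i : Fin N := ⟨0, by omega⟩
    rw [subS_eq_special] at h
    -- Here `T = -a ad(ξ_i ∂_i)`, and `adXi_pow_three` gives `T³ = a² T`.
    refine h.annihilation S (isPerfect_special hN a 0) (confW_part_disjoint N)
      (specialL_mem a 0 i) (specialL_mem_part (by rw [zero_smul]; exact zero_mem _) i)
      (freeMap (-a • adXi N i i)) (fun v _ => confW_br_specialL_zero a i v) (a ^ 2) (fun v _ => ?_)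
    ext n : 1
    simp only [Finsupp.mapRange.linearMap_apply, Finsupp.mapRange_apply, Finsupp.smul_apply,
      LinearMap.smul_apply, map_smul, adXi_pow_three, smul_smul]
    congr 1
    ring
  · let i : Fin N := ⟨0, by omega⟩
    have : Nontrivial (Fin N) := Fin.nontrivial_iff_two_le.2 hN
    rw [subSt_eq_special] at h
    refine h.annihilation S (isPerfect_special hN 0 1) (confW_part_disjoint N)
      (specialL_mem 0 1 i) (specialL_mem_part (by rw [one_smul]; exact top_mem_grPart hN2) i)
      (nilTop N) (fun v _ => confW_br_specialL_one i v) 0 (fun v _ => ?_)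
    rw [nilTop_nilTop, zero_smul]
  · refine h.annihilation S (isPerfect_confK N hN) (confK_part_disjoint N)
      (L := Finsupp.single 0 (-1)) trivial (single_mem_freePart (neg_mem one_mem_grPart) 0) 0
      (fun v _ => ?_) 0 (fun v _ => by simp)
    rw [confK_br_neg_one N Finsupp.single_eq_same, LinearMap.zero_apply, add_zero]
    rfl
  · refine h.annihilation S isPerfect_subK4' (confK_part_disjoint 4)
      single_neg_one_mem_subK4' (single_mem_freePart (neg_mem one_mem_grPart) 0) 0
      (fun v _ => ?_) 0 (fun v _ => by simp)
    rw [confK_br_neg_one 4 Finsupp.single_eq_same, LinearMap.zero_apply, add_zero]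
    rfl
  · refine h.annihilation S isPerfect_subCK6 (confK_part_disjoint 6)
      (neg_mem (ckGen_mem 1 (Nat.zero_le 3))) neg_ckGen_mem_part 0
      (fun v _ => ?_) 0 (fun v _ => by simp)
    rw [confK_br_neg_one 6 neg_ckGen_one_apply_zero, LinearMap.zero_apply, add_zero]
    rfl

end LieConf

end

theorem mainTheorem12 :
    (∀ (R : Type u) [AddCommGroup R] [Module ℂ R] [LieConf.LieConformalSuperalgebra R]
        (S : LieConf.Generators R),
      LieConf.derived R = ⊤ →
      (∃ L : R, ∀ a : R, LieConf.lbr R L a 0 = LieConf.del R a) →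
      Subsingleton (LieConf.H2 (LieConf.Ann S))) ∧
    (∀ (R : Type u) [AddCommGroup R] [Module ℂ R] [LieConf.LieConformalSuperalgebra R]
        (S : LieConf.Generators R),
      LieConf.IsSimple R →
      (∃ L ∈ LieConf.part R 0, ∀ a : R, LieConf.lbr R L a 0 = LieConf.del R a) →
      LieConf.IsUniversalCentralExtension.{u, u, w}
        (LieConf.center (LieConf.Ann S)).mkQ) ∧
    (∀ (R : Type u) [AddCommGroup R] [Module ℂ R] [LieConf.LieConformalSuperalgebra R]
        (S : LieConf.Generators R),
      LieConf.IsListed R →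
      Subsingleton (LieConf.H2 (LieConf.Ann S)) ∧
      LieConf.IsUniversalCentralExtension.{u, u, w}
        (LieConf.center (LieConf.Ann S)).mkQ) := by
  refine ⟨fun R _ _ _ S hder hL => ?_, fun R _ _ _ S hR hL => ?_,
    fun R _ _ _ S hR => hR.annihilation S⟩
  · obtain ⟨L, hL, h⟩ := LieConf.exists_even_of_lbr_zero hL
    exact LieConf.subsingleton_H2 S hL (N := 0) (fun a => by simp [h]) LieConf.isLocFin_zero hder
  · obtain ⟨L, hL, h⟩ := hL
    exact LieConf.isUniversalCentralExtension_mkQ_center S hL (N := 0) (fun a => by simp [h])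
      LieConf.isLocFin_zero (LieConf.derived_eq_top_of_isSimple hR)
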